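/- **Setting.** Let $l:\mathbb R^n\times\mathbb R^m\times\mathbb R^d\to\mathbb R$, $\psi:\mathbb R^n\to\mathbb R^d$, $\mathcal Y\subset\mathbb R^m$, and let $\tilde\epsilon$ be a random vector in $\mathbb R^d$. Put $\mathcal L(x,y)=\mathbb E[l(x,y,\psi(x)+\tilde\epsilon)]$ and $\Phi(x)=\max_{y\in\mathcal Y}\mathcal L(x,y)$ (read as a supremum). Assume: $\Phi$ is bounded below; $\psi$ is twice differentiable, $L_0$-Lipschitz and $\ell_0$-smooth; $\tilde\epsilon$ takes values in a compact set and has mean zero (hence finite variance); $l$ is $L_1$-Lipschitz and $\ell_1$-smooth; $\mathcal Y$ is nonempty, convex and bounded; $l(x,\cdot,z)$ is $\mu$-strongly concave on $\mathcal Y$ for all $x,z$, with $\mu>0$. **Algorithm.** Let $\delta_{\max}>0$, $\gamma>1$, $\eta_1\in(0,1)$, $\eta_2>0$, $\widehat X^0=x_0\in\mathbb R^n$ and $\Delta_0=\delta_0\in(0,\delta_{\max})$. In iteration $k=0,1,2,\dots$ one takes $N_k$ sample points $x^i=\widehat X^k+\Delta_k u^i$ with $\|u^i\|\le1$ (chosen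 in any way that does not look at the noise of iteration $k$) and observes $\omega^i=\psi(x^i)+\epsilon^i$, where the $\epsilon^i$ are i.i.d. copies of $\tilde\epsilon$, independent of everything before, including the sample points. Least squares gives $$(\widehat B^{k,0},\widehat B^{k,1})\in\arg\min_{B^0,B^1}\sum_{i=1}^{N_k}\|\omega^i-(B^1)^\top x^i-(B^0)^\top\|^2,$$ with residuals $e^{k,i}=\omega^i-(\widehat B^{k,1})^\top x^i-(\widehat B^{k,0})^\top$, and the models are $$\mathcal L^k(x,y)=\frac1{N_k}\sum_{i=1}^{N_k}l\big(x,y,(\widehat B^{k,1})^\top x+(\widehat B^{k,0})^\top+e^{k,i}\big),\qquad \widehat\Phi^k(x)=\max_{y\in\mathcal Y}\mathcal L^k(x,y).$$ A trial step $s^k$ with $\|s^k\|\le\Delta_k$ and inexact maximizers $y^{i,*}\in\mathcal Y$ of $\mathcal L^k$ at $\widehat X^k$ and at $\widehat X^k+s^k$ are chosen. The estimates $V_k$, $V_{k+1/2}$ of $\Phi(\widehat X^k)$, $\Phi(\widehat X^k+s^k)$ are averages of $l(x,y^{is,*},\psi(x)+\zeta^j)$ over fresh i.i.d. copies $\zeta^j$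 of $\tilde\epsilon$, at $x=\widehat X^k$ and $x=\widehat X^k+s^k$, with points $y^{is,*}\in\mathcal Y$. Let $g_k=\nabla_1\mathcal L^k(\widehat X^k,y^{i,*}(\widehat X^k))$ and $$\rho_k=\frac{V_k-V_{k+1/2}}{\mathcal L^k(\widehat X^k,y^{i,*}(\widehat X^k))-\mathcal L^k(\widehat X^k+s^k,y^{i,*}(\widehat X^k+s^k))}.$$ If $\rho_k\ge\eta_1$ and $\|g_k\|\ge\eta_2\Delta_k$, then $\widehat X^{k+1}=\widehat X^k+s^k$ and $\Delta_{k+1}=\min\{\gamma\Delta_k,\delta_{\max}\}$; otherwise $\widehat X^{k+1}=\widehat X^k$ and $\Delta_{k+1}=\gamma^{-1}\Delta_k$. Let $\mathcal F_{k-1}$ be the $\sigma$-algebra generated by $\{\widehat\Phi^i(\cdot),V_i,V_{i+1/2}\}_{i=0}^{k-1}$, and $\mathcal B(c,r)$ the closed ball. **Poisedness.** For $\Lambda>0$, the points $x^1,\dots,x^N$ are *strongly $\Lambda$-poised* in a ball $\mathcal B$ (for linear regression) if every $x\in\mathcal B$ can be written as $x=\sum_i w_ix^i$ with $\sum_iw_i=1$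 and $\|w\|\le\frac{n+1}{\sqrt N}\Lambda$. **Statement.** Fix $\Lambda>0$ and $\delta_{\max}>0$. Let $G$ be any event that is determined before the regression noise of iteration $k$ is drawn, and suppose that almost surely on $G$ the points $\{x^i\}_{i=1}^{N_k}$ are strongly $\Lambda$-poised in $\mathcal B(\widehat X^k,\Delta_k)$ and $N_k$ satisfies the bound displayed below. (If this holds almost surely, $G$ may be the whole space, and the conclusions are bounds for $\mathbb P(\,\cdot\mid\mathcal F_{k-1})$ by $\alpha/2$.) All constants below depend only on $(l,\psi,\mathcal Y,\text{law of }\tilde\epsilon)$, the constants in the assumptions, $\Lambda$ and $\delta_{\max}$. (i) There are $\bar\kappa,C_1,C_2>0$ such that for every run of the algorithm, every $k$, every $\alpha\in(0,1)$ and every $\kappa_{ef}\ge\bar\kappa$, if $N_k\ge\max\{C_1\Delta_k^{-4}\kappa_{ef}^{-2}\alpha^{-1},\;C_2\alpha^{-2}\}$ on $G$, then almost surely $$\mathbb P\Big(G\cap\big\{\exists x\in\mathcal B(\widehat X^k,\Delta_k):\ |\Phi(x)-\widehat\Phi^k(x)|\ge\kappa_{ef}\Delta_k^2\big\}\,\Big|\,\mathcal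 F_{k-1}\Big)\le\frac\alpha2\,\mathbb P(G\mid\mathcal F_{k-1}).$$ (ii) $\Phi$ and $\widehat\Phi^k$ are differentiable, and there are $\bar\kappa,C_1,C_2,C_3>0$ such that for every run, every $k$, every $\alpha\in(0,1)$ and every $\kappa_{ed}\ge\bar\kappa$, if $N_k\ge\max\{C_1(1+\log\tfrac1\alpha)\Delta_k^{-4}\kappa_{ed}^{-2},\;C_2\alpha^{-2},\;C_3\Delta_k^{-2}\kappa_{ed}^{-2}\alpha^{-1}\}$ on $G$, then almost surely $$\mathbb P\Big(G\cap\big\{\exists x\in\mathcal B(\widehat X^k,\Delta_k):\ \|\nabla\Phi(x)\|-\|\nabla\widehat\Phi^k(x)\|\ge\kappa_{ed}\Delta_k\big\}\,\Big|\,\mathcal F_{k-1}\Big)\le\frac\alpha2\,\mathbb P(G\mid\mathcal F_{k-1}).$$ In both parts the event in braces is measurable up to a null set. -/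

import Mathlib

open MeasureTheory ProbabilityTheory
open scoped NNReal

universe u

noncomputable section

namespace SMDD

/-- `ℝⁿ` with its Euclidean norm. -/
abbrev Vec (n : ℕ) := EuclideanSpace ℝ (Fin n)

/-- Data of the minimax problem `min_x max_{y ∈ Y} E[l(x, y, ψ(x) + e)]`: the loss `l`, the
regression function `ψ`, the feasible set `Y` and the law `ν` of the noise. -/
structure Problem (n m d : ℕ) where
  l : Vec n × Vec m × Vec d → ℝ
  ψ : Vec n → Vec d
  Y : Set (Vec m)
  ν : Measure (Vec d)

namespace Problem

variable {n m d : ℕ} (p : Problem n m d)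

/-- The objective `𝓛(x, y) = E[l(x, y, ψ(x) + e)]`, where `e` has law `ν`. -/
def L (x : Vec n) (y : Vec m) : ℝ := ∫ e, p.l (x, y, p.ψ x + e) ∂p.ν

/-- The primal function `Φ(x) = max_{y ∈ Y} 𝓛(x, y)`. -/
def Φ (x : Vec n) : ℝ := sSup (p.L x '' p.Y)

/-- The standing assumptions. Lipschitz constants of functions of `(x, y, z)` are taken with
respect to the norm of the product type; passing to the Euclidean norm of `(x, y, z)` only changes
the values of `ℓ₁` and `L₁` by a numerical factor. -/
structure Assumptions (ℓ₀ L₀ ℓ₁ L₁ : ℝ≥0) (μ : ℝ) : Prop where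
  /-- the primal function is bounded below -/
  primal_bddBelow : BddBelow (Set.range p.Φ)
  /-- the regression function is twice differentiable -/
  psi_differentiable : Differentiable ℝ p.ψ
  psi_twice_differentiable : Differentiable ℝ (fderiv ℝ p.ψ)
  /-- the noise is a random vector with compact sample space (hence with finite variance) -/
  noise_prob : IsProbabilityMeasure p.ν
  noise_compact : ∃ K : Set (Vec d), IsCompact K ∧ p.ν Kᶜ = 0
  /-- the noise has mean zero -/
  noise_mean : ∫ e, e ∂p.ν = 0
  /-- `l` is `ℓ₁`-smooth and `L₁`-Lipschitz -/
  l_differentiable : Differentiable ℝ p.l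
  l_smooth : LipschitzWith ℓ₁ (fderiv ℝ p.l)
  l_lipschitz : LipschitzWith L₁ p.l
  /-- `ψ` is `ℓ₀`-smooth and `L₀`-Lipschitz -/
  psi_smooth : LipschitzWith ℓ₀ (fderiv ℝ p.ψ)
  psi_lipschitz : LipschitzWith L₀ p.ψ
  /-- `Y` is a nonempty bounded convex set -/
  Y_nonempty : p.Y.Nonempty
  Y_convex : Convex ℝ p.Y
  Y_bounded : Bornology.IsBounded p.Y
  /-- `l(x, ·, z)` is `μ`-strongly concave on `Y` -/
  mu_pos : 0 < μ
  l_strongConcave : ∀ x z, StrongConcaveOn p.Y μ (fun y => p.l (x, y, z))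

/-- Empirical mean `(1/M) ∑_{j < M} l(x, y, w_j)`. -/
def sampleMean (M : ℕ) (w : ℕ → Vec d) (x : Vec n) (y : Vec m) : ℝ :=
  (M : ℝ)⁻¹ * ∑ j ∈ Finset.range M, p.l (x, y, w j)

end Problem

/-- Strong `Λ`-poisedness, in the sense of linear regression, of the sample points `z₁, …, z_N` in
the ball `B(c, r)`: in the basis `(1, x₁, …, x_n)` of the affine functions, which has `n + 1`
elements, every point `x` of the ball is represented as `1 = ∑ wᵢ`, `x = ∑ wᵢ zᵢ` with
`‖w‖ ≤ ((n + 1) / √N) Λ`. -/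
def StronglyPoised {n : ℕ} (Λ : ℝ) (c : Vec n) (r : ℝ) {N : ℕ} (z : Fin N → Vec n) : Prop :=
  ∀ x ∈ Metric.closedBall c r, ∃ w : Fin N → ℝ,
    ∑ i, w i = 1 ∧ ∑ i, w i • z i = x ∧
      Real.sqrt (∑ i, w i ^ 2) ≤ ((n : ℝ) + 1) / Real.sqrt N * Λ

/-- All random quantities that occur in a run of the trust region algorithm; the first argument of
each is the number `k` of the iteration. -/
structure Run (n m d : ℕ) (Ω : Type*) where
  /-- the information available before the regression noise of iteration `k` is drawn (everything
  that happened in the earlier iterations, and the sample points of iteration `k`) -/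
  hist : ℕ → MeasurableSpace Ω
  /-- the information available before the samples for the value estimates are drawn -/
  mid : ℕ → MeasurableSpace Ω
  /-- iterates -/
  x : ℕ → Ω → Vec n
  /-- trust region radii -/
  δ : ℕ → Ω → ℝ
  /-- sizes of the regression data sets -/
  N : ℕ → Ω → ℕ
  /-- points of the unit ball which, shifted and scaled, give the sample points -/
  u : ℕ → ℕ → Ω → Vec n
  /-- noise in the regression data -/
  ε : ℕ → ℕ → Ω → Vec d
  /-- regression coefficients: the linear map `x ↦ (B¹)ᵀ x` and the intercept `(B⁰)ᵀ` -/
  B₁ : ℕ → Ω → (Vec n →L[ℝ] Vec d)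
  B₀ : ℕ → Ω → Vec d
  /-- trial steps -/
  s : ℕ → Ω → Vec n
  /-- inexact maximizers of the model at the iterate and at the trial point -/
  yi : ℕ → Ω → Vec m
  yiHalf : ℕ → Ω → Vec m
  /-- sizes and noises of the two samples used for the value estimates -/
  M : ℕ → Ω → ℕ
  MHalf : ℕ → Ω → ℕ
  ζ : ℕ → ℕ → Ω → Vec d
  ζHalf : ℕ → ℕ → Ω → Vec d
  /-- inexact maximizers of the two empirical means used for the value estimates -/
  yis : ℕ → Ω → Vec m
  yisHalf : ℕ → Ω → Vec m

namespace Run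

variable {n m d : ℕ} {Ω : Type*} (r : Run n m d Ω) (p : Problem n m d)

/-- Sample points `xⁱ = x̂ᵏ + δ_k uⁱ`. -/
def pt (k i : ℕ) (ω : Ω) : Vec n := r.x k ω + r.δ k ω • r.u k i ω

/-- Observed responses `ωⁱ = ψ(xⁱ) + εⁱ`. -/
def obs (k i : ℕ) (ω : Ω) : Vec d := p.ψ (r.pt k i ω) + r.ε k i ω

/-- The local linear regression model `m_k(x, e) = (B¹)ᵀ x + (B⁰)ᵀ + e`. -/
def model (k : ℕ) (ω : Ω) (x : Vec n) (e : Vec d) : Vec d := r.B₁ k ω x + r.B₀ k ω + e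

/-- Residuals `e^{k,i}` of the regression. -/
def residual (k i : ℕ) (ω : Ω) : Vec d :=
  r.obs p k i ω - r.B₁ k ω (r.pt k i ω) - r.B₀ k ω

/-- The model objective `𝓛ᵏ(x, y)`: the expectation of `l(x, y, m_k(x, e))` when `e` has the
empirical distribution of the residuals. -/
def Lk (k : ℕ) (ω : Ω) (x : Vec n) (y : Vec m) : ℝ :=
  p.sampleMean (r.N k ω) (fun i => r.model k ω x (r.residual p k i ω)) x y

/-- The trust region model `Φᵏ(x) = max_{y ∈ Y} 𝓛ᵏ(x, y)`. -/
def Φk (k : ℕ) (ω : Ω) (x : Vec n) : ℝ := sSup (r.Lk p k ω x '' p.Y)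

/-- `∇₁ 𝓛ᵏ(x̂ᵏ, y^{i,*}(x̂ᵏ))`. -/
def grad₁ (k : ℕ) (ω : Ω) : Vec n :=
  gradient (fun x => r.Lk p k ω x (r.yi k ω)) (r.x k ω)

/-- The estimate `v_k` of `Φ(x̂ᵏ)`. -/
def v (k : ℕ) (ω : Ω) : ℝ :=
  p.sampleMean (r.M k ω) (fun j => p.ψ (r.x k ω) + r.ζ k j ω) (r.x k ω) (r.yis k ω)

/-- The estimate `v_{k+1/2}` of `Φ(x̂ᵏ + sᵏ)`. -/
def vHalf (k : ℕ) (ω : Ω) : ℝ :=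
  p.sampleMean (r.MHalf k ω) (fun j => p.ψ (r.x k ω + r.s k ω) + r.ζHalf k j ω)
    (r.x k ω + r.s k ω) (r.yisHalf k ω)

/-- The ratio `ρ_k` of actual to predicted reduction. -/
def ratio (k : ℕ) (ω : Ω) : ℝ :=
  (r.v p k ω - r.vHalf p k ω) /
    (r.Lk p k ω (r.x k ω) (r.yi k ω) - r.Lk p k ω (r.x k ω + r.s k ω) (r.yiHalf k ω))

/-- The acceptance test of iteration `k`. -/
def Accepted (η₁ η₂ : ℝ) (k : ℕ) (ω : Ω) : Prop :=
  η₁ ≤ r.ratio p k ω ∧ η₂ * r.δ k ω ≤ ‖r.grad₁ p k ω‖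

/-- The `σ`-algebra `𝓕_{k-1}` generated by `Φ̂ⁱ`, `V_i`, `V_{i+1/2}` for `i = 0, …, k - 1`. -/
@[reducible] def past (k : ℕ) : MeasurableSpace Ω :=
  ⨆ i : Fin k,
    (⨆ x : Vec n, MeasurableSpace.comap (fun ω => r.Φk p i ω x) inferInstance) ⊔
      MeasurableSpace.comap (r.v p i) inferInstance ⊔
      MeasurableSpace.comap (r.vHalf p i) inferInstance

/-- The sample points of iteration `k` are strongly `Λ`-poised in the trust region. -/
def Poised (Λ : ℝ) (k : ℕ) (ω : Ω) : Prop :=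
  StronglyPoised Λ (r.x k ω) (r.δ k ω) (fun i : Fin (r.N k ω) => r.pt k i ω)

/-- The event that `|Φ(x) - Φ̂ᵏ(x)| ≥ κ Δ_k²` for some `x ∈ B(X̂ᵏ, Δ_k)`. -/
def badValue (κ : ℝ) (k : ℕ) : Set Ω :=
  {ω | ∃ x ∈ Metric.closedBall (r.x k ω) (r.δ k ω),
    κ * r.δ k ω ^ 2 ≤ |p.Φ x - r.Φk p k ω x|}

/-- The event that `‖∇Φ(x)‖ - ‖∇Φ̂ᵏ(x)‖ ≥ κ Δ_k` for some `x ∈ B(X̂ᵏ, Δ_k)`. -/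
def badGradient (κ : ℝ) (k : ℕ) : Set Ω :=
  {ω | ∃ x ∈ Metric.closedBall (r.x k ω) (r.δ k ω),
    κ * r.δ k ω ≤ ‖gradient p.Φ x‖ - ‖gradient (r.Φk p k ω) x‖}

/-- `r` is a run of the trust region algorithm for the problem `p` on the probability space
`(Ω, P)`, with maximal radius `δmax`, initial point `x₀`, initial radius `δ₀` and parameters
`γ`, `η₁`, `η₂`. The sample points may be chosen from the trust region in any way that does not
look at the noise, the trial steps may be arbitrary steps in the trust region, and the inexact
maximizers arbitrary points of `Y`. -/
structure IsRun [MeasurableSpace Ω] (P : Measure Ω) (δmax : ℝ) (x₀ : Vec n)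
    (δ₀ γ η₁ η₂ : ℝ) : Prop where
  delta0_pos : 0 < δ₀
  delta0_lt : δ₀ < δmax
  one_lt_gamma : 1 < γ
  eta1_pos : 0 < η₁
  eta1_lt_one : η₁ < 1
  eta2_pos : 0 < η₂
  /-- the flow of information -/
  hist_le_mid : ∀ k, r.hist k ≤ r.mid k
  mid_le_hist_succ : ∀ k, r.mid k ≤ r.hist (k + 1)
  hist_le : ∀ k, r.hist k ≤ ‹MeasurableSpace Ω›
  meas_x : ∀ k, Measurable[r.hist k] (r.x k)
  meas_delta : ∀ k, Measurable[r.hist k] (r.δ k)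
  meas_N : ∀ k, Measurable[r.hist k] (r.N k)
  meas_u : ∀ k i, Measurable[r.hist k] (r.u k i)
  meas_eps : ∀ k i, Measurable[r.mid k] (r.ε k i)
  meas_B1 : ∀ k, Measurable[r.mid k] (r.B₁ k)
  meas_B0 : ∀ k, Measurable[r.mid k] (r.B₀ k)
  meas_s : ∀ k, Measurable[r.mid k] (r.s k)
  meas_yi : ∀ k, Measurable[r.mid k] (r.yi k)
  meas_yiHalf : ∀ k, Measurable[r.mid k] (r.yiHalf k)
  meas_M : ∀ k, Measurable[r.mid k] (r.M k)
  meas_MHalf : ∀ k, Measurable[r.mid k] (r.MHalf k)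
  meas_zeta : ∀ k j, Measurable[r.hist (k + 1)] (r.ζ k j)
  meas_zetaHalf : ∀ k j, Measurable[r.hist (k + 1)] (r.ζHalf k j)
  meas_yis : ∀ k, Measurable[r.hist (k + 1)] (r.yis k)
  meas_yisHalf : ∀ k, Measurable[r.hist (k + 1)] (r.yisHalf k)
  /-- the regression noise is i.i.d. with law `ν` and independent of what was known before -/
  eps_law : ∀ k i, Measure.map (r.ε k i) P = p.ν
  eps_iIndep : ∀ k, iIndepFun (r.ε k) P
  eps_indep : ∀ k, Indep (⨆ i, MeasurableSpace.comap (r.ε k i) inferInstance) (r.hist k) P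
  /-- the same for the noise in the two samples for the value estimates -/
  zeta_law : ∀ k j, Measure.map (r.ζ k j) P = p.ν
  zeta_iIndep : ∀ k, iIndepFun (r.ζ k) P
  zeta_indep : ∀ k, Indep (⨆ j, MeasurableSpace.comap (r.ζ k j) inferInstance) (r.mid k) P
  zetaHalf_law : ∀ k j, Measure.map (r.ζHalf k j) P = p.ν
  zetaHalf_iIndep : ∀ k, iIndepFun (r.ζHalf k) P
  zetaHalf_indep : ∀ k,
    Indep (⨆ j, MeasurableSpace.comap (r.ζHalf k j) inferInstance) (r.mid k) P
  /-- the sample points lie in the trust region -/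
  u_mem : ∀ k i ω, r.u k i ω ∈ Metric.closedBall (0 : Vec n) 1
  /-- the regression coefficients minimize the sum of squared errors -/
  least_squares : ∀ k ω, ∀ (b₁ : Vec n →L[ℝ] Vec d) (b₀ : Vec d),
    ∑ i ∈ Finset.range (r.N k ω),
        ‖r.obs p k i ω - r.B₁ k ω (r.pt k i ω) - r.B₀ k ω‖ ^ 2 ≤
      ∑ i ∈ Finset.range (r.N k ω), ‖r.obs p k i ω - b₁ (r.pt k i ω) - b₀‖ ^ 2
  /-- trial steps and inexact maximizers -/
  s_norm : ∀ k ω, ‖r.s k ω‖ ≤ r.δ k ω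
  yi_mem : ∀ k ω, r.yi k ω ∈ p.Y
  yiHalf_mem : ∀ k ω, r.yiHalf k ω ∈ p.Y
  yis_mem : ∀ k ω, r.yis k ω ∈ p.Y
  yisHalf_mem : ∀ k ω, r.yisHalf k ω ∈ p.Y
  /-- initialization and update of the iterate and of the radius -/
  x_zero : ∀ ω, r.x 0 ω = x₀
  delta_zero : ∀ ω, r.δ 0 ω = δ₀
  x_accept : ∀ k ω, r.Accepted p η₁ η₂ k ω → r.x (k + 1) ω = r.x k ω + r.s k ω
  delta_accept : ∀ k ω, r.Accepted p η₁ η₂ k ω → r.δ (k + 1) ω = min (γ * r.δ k ω) δmax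
  x_reject : ∀ k ω, ¬ r.Accepted p η₁ η₂ k ω → r.x (k + 1) ω = r.x k ω
  delta_reject : ∀ k ω, ¬ r.Accepted p η₁ η₂ k ω → r.δ (k + 1) ω = γ⁻¹ * r.δ k ω

end Run

end SMDD

end

/-!
Both parts follow from one deterministic and one probabilistic fact about a single iteration.

*Deterministic part.* The empirical model objective is the objective of a problem of the same kind:
its regression function is the fitted affine map and its noise is uniformly distributed on the
residuals (`Run.Phik_eq_empirical`). By strong concavity in `y`, Danskin's theorem
(`Problem.Regular.hasFDerivAt_Phi`) gives `∇Φ(x) = ∇₁𝓛(x, y*(x))`, for `Φ` and for the model alike,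
where `y*(x)` is the maximizer over the closure of the feasible set. On poised sample points the
normal equation bounds the least squares error by the curvature of `ψ` and by the correlations of
the noise with `1` and with the coordinates of the sample points
(`Problem.Regular.regression_error_le`). Hence, if these correlations are of order `c κ Δ²`, and if
the empirical means of `l(x, y, ψ(x) + e)` and of its `x`-gradient are close to their expectations,
uniformly in `x` and `y`, up to `c κ Δ²` and `c κ Δ` respectively, then the model objective is
accurate up to a small multiple of `κ Δ²`. Strong concavity makes the maximizers agree up to order
`√κ Δ`, and so the gradients agree up to a small multiple of `κ Δ` once `κ` is large
(`Problem.Regular.exists_accuracy_of_notMem_noiseBad`).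

*Probabilistic part.* The three conditions fail with probability at most `A exp(-a N κ² Δ⁴)`
(`Problem.Assumptions.measure_noiseBad_le`). For the correlations this is Hoeffding's inequality.
For the empirical means it is a chaining argument on dyadic grids (`measure_chainBad_le`), which
uses that the integrands are Lipschitz in the finite-dimensional parameter `(x, y)`; chaining avoids
a factor that would depend on the accuracy `κ Δ²`. The bound is at most `α / 2` as soon as `N κ² Δ⁴`
exceeds a multiple of `1 + log (1 / α) ≤ 1 / α`.

Since the regression noise is independent of the history of the run, the bound may be applied for
each frozen value of the design (`measure_inter_le_of_indep`) and integrated over any event of the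
history, in particular over the intersections of `G` with the events of the past; this is the claim
about conditional probabilities.
-/

namespace SMDD

/-! ### The primal function of a strongly concave problem -/

/-- The graph map `v ↦ (v, 0, A v)`, through which the derivative of `l` acts on perturbations of
`x` when the third argument moves along with `x`. -/
noncomputable def graphMap {n d : ℕ} (m : ℕ) (A : Vec n →L[ℝ] Vec d) :
    Vec n →L[ℝ] Vec n × Vec m × Vec d :=
  (ContinuousLinearMap.id ℝ (Vec n)).prod ((0 : Vec n →L[ℝ] Vec m).prod A)

section graphMap

variable {n m d : ℕ}

lemma graphMap_apply (A : Vec n →L[ℝ] Vec d) (v : Vec n) : graphMap m A v = (v, 0, A v) := rfl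

lemma norm_graphMap_le (A : Vec n →L[ℝ] Vec d) : ‖graphMap m A‖ ≤ 1 + ‖A‖ := by
  refine ContinuousLinearMap.opNorm_le_bound _ (by positivity) fun v => ?_
  have h := A.le_opNorm v
  have h1 := norm_nonneg v
  have h2 : 0 ≤ ‖A‖ * ‖v‖ := by positivity
  rw [graphMap_apply, Prod.norm_def, Prod.norm_def]
  simp only [norm_zero]
  refine max_le (by nlinarith) (max_le (by nlinarith) (by nlinarith))

lemma norm_graphMap_sub_le (A B : Vec n →L[ℝ] Vec d) :
    ‖graphMap m A - graphMap m B‖ ≤ ‖A - B‖ := by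
  refine ContinuousLinearMap.opNorm_le_bound _ (by positivity) fun v => ?_
  have h := (A - B).le_opNorm v
  have h2 : 0 ≤ ‖A - B‖ * ‖v‖ := by positivity
  have : (graphMap m A - graphMap m B) v = (0, 0, (A - B) v) := by
    simp [graphMap_apply]
  rw [this, Prod.norm_def, Prod.norm_def]
  simp only [norm_zero]
  exact max_le h2 (max_le h2 h)

end graphMap

namespace Problem

variable {n m d : ℕ}

/-- The part of the standing assumptions that is also satisfied by the empirical model problems:
the noise need not be centred, and its law is only required to have bounded essential range. -/
structure Regular (p : Problem n m d) (ℓ₀ L₀ ℓ₁ L₁ : ℝ≥0) (μ : ℝ) : Prop where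
  psi_differentiable : Differentiable ℝ p.ψ
  noise_prob : IsProbabilityMeasure p.ν
  noise_bounded : ∃ ρ : ℝ, ∀ᵐ e ∂p.ν, ‖e‖ ≤ ρ
  l_differentiable : Differentiable ℝ p.l
  l_smooth : LipschitzWith ℓ₁ (fderiv ℝ p.l)
  l_lipschitz : LipschitzWith L₁ p.l
  psi_smooth : LipschitzWith ℓ₀ (fderiv ℝ p.ψ)
  psi_lipschitz : LipschitzWith L₀ p.ψ
  Y_nonempty : p.Y.Nonempty
  Y_convex : Convex ℝ p.Y
  Y_bounded : Bornology.IsBounded p.Y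
  mu_pos : 0 < μ
  l_strongConcave : ∀ x z, StrongConcaveOn p.Y μ (fun y => p.l (x, y, z))

lemma Assumptions.regular {p : Problem n m d} {ℓ₀ L₀ ℓ₁ L₁ : ℝ≥0} {μ : ℝ}
    (hp : p.Assumptions ℓ₀ L₀ ℓ₁ L₁ μ) : p.Regular ℓ₀ L₀ ℓ₁ L₁ μ where
  psi_differentiable := hp.psi_differentiable
  noise_prob := hp.noise_prob
  noise_bounded := by
    obtain ⟨K, hK, h0⟩ := hp.noise_compact
    obtain ⟨ρ, hρ⟩ := hK.isBounded.exists_norm_le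
    refine ⟨ρ, ?_⟩
    filter_upwards [compl_mem_ae_iff.2 h0] with e he
    exact hρ e (by simpa using he)
  l_differentiable := hp.l_differentiable
  l_smooth := hp.l_smooth
  l_lipschitz := hp.l_lipschitz
  psi_smooth := hp.psi_smooth
  psi_lipschitz := hp.psi_lipschitz
  Y_nonempty := hp.Y_nonempty
  Y_convex := hp.Y_convex
  Y_bounded := hp.Y_bounded
  mu_pos := hp.mu_pos
  l_strongConcave := hp.l_strongConcave

/-- The derivative in `x` of `l(x, y, ψ(x) + e)`. -/
noncomputable def dl (p : Problem n m d) (x : Vec n) (y : Vec m) (e : Vec d) : Vec n →L[ℝ] ℝ :=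
  (fderiv ℝ p.l (x, y, p.ψ x + e)).comp (graphMap m (fderiv ℝ p.ψ x))

/-- The derivative in `x` of the objective `𝓛(x, y)`. -/
noncomputable def DL (p : Problem n m d) (x : Vec n) (y : Vec m) : Vec n →L[ℝ] ℝ :=
  ∫ e, p.dl x y e ∂p.ν

namespace Regular

variable {p : Problem n m d} {ℓ₀ L₀ ℓ₁ L₁ : ℝ≥0} {μ : ℝ}

lemma abs_l_sub_le (hp : p.Regular ℓ₀ L₀ ℓ₁ L₁ μ) (a b : Vec n × Vec m × Vec d) :
    |p.l a - p.l b| ≤ L₁ * ‖a - b‖ := by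
  simpa [Real.norm_eq_abs] using hp.l_lipschitz.norm_sub_le a b

lemma norm_fderiv_l_le (hp : p.Regular ℓ₀ L₀ ℓ₁ L₁ μ) (a : Vec n × Vec m × Vec d) :
    ‖fderiv ℝ p.l a‖ ≤ L₁ :=
  norm_fderiv_le_of_lipschitz ℝ hp.l_lipschitz

lemma norm_fderiv_psi_le (hp : p.Regular ℓ₀ L₀ ℓ₁ L₁ μ) (x : Vec n) :
    ‖fderiv ℝ p.ψ x‖ ≤ L₀ :=
  norm_fderiv_le_of_lipschitz ℝ hp.psi_lipschitz

lemma norm_graphMap_psi_le (hp : p.Regular ℓ₀ L₀ ℓ₁ L₁ μ) (x : Vec n) :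
    ‖graphMap m (fderiv ℝ p.ψ x)‖ ≤ 1 + L₀ :=
  (norm_graphMap_le _).trans (by gcongr; exact hp.norm_fderiv_psi_le x)

lemma norm_arg_sub_le (hp : p.Regular ℓ₀ L₀ ℓ₁ L₁ μ) (x x' : Vec n) (y y' : Vec m) (e : Vec d) :
    ‖((x, y, p.ψ x + e) : Vec n × Vec m × Vec d) - (x', y', p.ψ x' + e)‖ ≤
      (1 + L₀) * (‖x - x'‖ + ‖y - y'‖) := by
  have h := hp.psi_lipschitz.norm_sub_le x x'
  have h1 := norm_nonneg (x - x')
  have h2 := norm_nonneg (y - y')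
  have h3 := L₀.coe_nonneg
  have h4 := mul_nonneg h3 h1
  have h5 := mul_nonneg h3 h2
  simp only [Prod.mk_sub_mk, add_sub_add_right_eq_sub, Prod.norm_def]
  exact max_le (by linarith) (max_le (by linarith) (by linarith))

lemma abs_l_arg_sub_le (hp : p.Regular ℓ₀ L₀ ℓ₁ L₁ μ) (x x' : Vec n) (y y' : Vec m) (e : Vec d) :
    |p.l (x, y, p.ψ x + e) - p.l (x', y', p.ψ x' + e)| ≤
      L₁ * (1 + L₀) * (‖x - x'‖ + ‖y - y'‖) := by
  refine (hp.abs_l_sub_le _ _).trans ?_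
  rw [mul_assoc]
  gcongr
  exact hp.norm_arg_sub_le x x' y y' e

lemma norm_dl_le (hp : p.Regular ℓ₀ L₀ ℓ₁ L₁ μ) (x : Vec n) (y : Vec m) (e : Vec d) :
    ‖p.dl x y e‖ ≤ L₁ * (1 + L₀) :=
  (ContinuousLinearMap.opNorm_comp_le _ _).trans
    (mul_le_mul (hp.norm_fderiv_l_le _) (hp.norm_graphMap_psi_le x) (norm_nonneg _)
      L₁.coe_nonneg)

lemma norm_dl_sub_le (hp : p.Regular ℓ₀ L₀ ℓ₁ L₁ μ) (x x' : Vec n) (y y' : Vec m) (e : Vec d) :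
    ‖p.dl x y e - p.dl x' y' e‖ ≤
      (ℓ₁ * (1 + L₀) * (1 + L₀) + L₁ * ℓ₀) * (‖x - x'‖ + ‖y - y'‖) := by
  have key : p.dl x y e - p.dl x' y' e =
      (fderiv ℝ p.l (x, y, p.ψ x + e) - fderiv ℝ p.l (x', y', p.ψ x' + e)).comp
        (graphMap m (fderiv ℝ p.ψ x)) +
      (fderiv ℝ p.l (x', y', p.ψ x' + e)).comp
        (graphMap m (fderiv ℝ p.ψ x) - graphMap m (fderiv ℝ p.ψ x')) := by
    simp only [dl, ContinuousLinearMap.sub_comp, ContinuousLinearMap.comp_sub]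
    abel
  rw [key, add_mul]
  refine (norm_add_le _ _).trans (add_le_add ?_ ?_)
  · refine (ContinuousLinearMap.opNorm_comp_le _ _).trans ?_
    calc _ ≤ (ℓ₁ * ((1 + L₀) * (‖x - x'‖ + ‖y - y'‖))) * (1 + L₀) := by
          refine mul_le_mul ?_ (hp.norm_graphMap_psi_le x) (norm_nonneg _) (by positivity)
          refine (hp.l_smooth.norm_sub_le _ _).trans ?_
          gcongr
          exact hp.norm_arg_sub_le x x' y y' e
      _ = _ := by ring
  · refine (ContinuousLinearMap.opNorm_comp_le _ _).trans ?_
    rw [mul_assoc]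
    refine mul_le_mul (hp.norm_fderiv_l_le _) ?_ (norm_nonneg _) L₁.coe_nonneg
    refine (norm_graphMap_sub_le _ _).trans ((hp.psi_smooth.norm_sub_le _ _).trans ?_)
    gcongr
    exact le_add_of_nonneg_right (norm_nonneg _)

lemma continuous_l (hp : p.Regular ℓ₀ L₀ ℓ₁ L₁ μ) : Continuous p.l := hp.l_lipschitz.continuous

lemma continuous_psi (hp : p.Regular ℓ₀ L₀ ℓ₁ L₁ μ) : Continuous p.ψ :=
  hp.psi_lipschitz.continuous

lemma continuous_graphMap_psi (hp : p.Regular ℓ₀ L₀ ℓ₁ L₁ μ) :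
    Continuous fun x => graphMap m (fderiv ℝ p.ψ x) := by
  have : LipschitzWith ℓ₀ fun x => graphMap m (fderiv ℝ p.ψ x) :=
    LipschitzWith.of_dist_le_mul fun x x' => by
      rw [dist_eq_norm, dist_eq_norm]
      exact (norm_graphMap_sub_le _ _).trans (hp.psi_smooth.norm_sub_le _ _)
  exact this.continuous

lemma continuous_dl (hp : p.Regular ℓ₀ L₀ ℓ₁ L₁ μ) :
    Continuous fun q : Vec n × Vec m × Vec d => p.dl q.1 q.2.1 q.2.2 := by
  have h1 : Continuous fun q : Vec n × Vec m × Vec d =>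
      fderiv ℝ p.l (q.1, q.2.1, p.ψ q.1 + q.2.2) := by
    refine hp.l_smooth.continuous.comp ?_
    have := hp.continuous_psi
    fun_prop
  have h2 : Continuous fun q : Vec n × Vec m × Vec d => graphMap m (fderiv ℝ p.ψ q.1) :=
    hp.continuous_graphMap_psi.comp continuous_fst
  exact h1.clm_comp h2

lemma continuous_l_arg (hp : p.Regular ℓ₀ L₀ ℓ₁ L₁ μ) (x : Vec n) (y : Vec m) :
    Continuous fun e => p.l (x, y, p.ψ x + e) :=
  hp.continuous_l.comp (by fun_prop)

lemma integrable_l (hp : p.Regular ℓ₀ L₀ ℓ₁ L₁ μ) (x : Vec n) (y : Vec m) :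
    Integrable (fun e => p.l (x, y, p.ψ x + e)) p.ν := by
  have := hp.noise_prob
  obtain ⟨ρ, hρ⟩ := hp.noise_bounded
  refine Integrable.of_bound (hp.continuous_l_arg x y).aestronglyMeasurable
    (|p.l (x, y, p.ψ x)| + L₁ * ρ) ?_
  filter_upwards [hρ] with e he
  have h := hp.abs_l_sub_le (x, y, p.ψ x + e) (x, y, p.ψ x)
  have h2 : ‖((x, y, p.ψ x + e) : Vec n × Vec m × Vec d) - (x, y, p.ψ x)‖ ≤ ρ := by
    simp [Prod.norm_def, he]
  have h3 : |p.l (x, y, p.ψ x + e)| - |p.l (x, y, p.ψ x)| ≤ L₁ * ρ :=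
    (abs_sub_abs_le_abs_sub _ _).trans (h.trans (by gcongr))
  rw [Real.norm_eq_abs]
  linarith

lemma continuous_dl_noise (hp : p.Regular ℓ₀ L₀ ℓ₁ L₁ μ) (x : Vec n) (y : Vec m) :
    Continuous fun e => p.dl x y e :=
  hp.continuous_dl.comp (by fun_prop : Continuous fun e : Vec d => (x, y, e))

lemma integrable_dl (hp : p.Regular ℓ₀ L₀ ℓ₁ L₁ μ) (x : Vec n) (y : Vec m) :
    Integrable (fun e => p.dl x y e) p.ν := by
  have := hp.noise_prob
  exact Integrable.of_bound (hp.continuous_dl_noise x y).aestronglyMeasurable _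
    (Filter.Eventually.of_forall fun e => hp.norm_dl_le x y e)

lemma hasFDerivAt_l (hp : p.Regular ℓ₀ L₀ ℓ₁ L₁ μ) (x : Vec n) (y : Vec m) (e : Vec d) :
    HasFDerivAt (fun x => p.l (x, y, p.ψ x + e)) (p.dl x y e) x := by
  have h1 : HasFDerivAt (fun x => ((x, y, p.ψ x + e) : Vec n × Vec m × Vec d))
      (graphMap m (fderiv ℝ p.ψ x)) x :=
    (hasFDerivAt_id x).prodMk ((hasFDerivAt_const y x).prodMk
      ((hp.psi_differentiable x).hasFDerivAt.add_const e))
  exact (hp.l_differentiable _).hasFDerivAt.comp x h1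

lemma hasFDerivAt_L (hp : p.Regular ℓ₀ L₀ ℓ₁ L₁ μ) (x : Vec n) (y : Vec m) :
    HasFDerivAt (fun x => p.L x y) (p.DL x y) x := by
  have := hp.noise_prob
  exact hasFDerivAt_integral_of_dominated_of_fderiv_le (bound := fun _ => L₁ * (1 + L₀))
    (F' := fun x e => p.dl x y e) Filter.univ_mem
    (Filter.Eventually.of_forall fun x => (hp.continuous_l_arg x y).aestronglyMeasurable)
    (hp.integrable_l x y) (hp.continuous_dl_noise x y).aestronglyMeasurable
    (Filter.Eventually.of_forall fun e x _ => hp.norm_dl_le x y e) (integrable_const _)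
    (Filter.Eventually.of_forall fun e x _ => hp.hasFDerivAt_l x y e)

lemma abs_L_sub_le (hp : p.Regular ℓ₀ L₀ ℓ₁ L₁ μ) (x x' : Vec n) (y y' : Vec m) :
    |p.L x y - p.L x' y'| ≤ L₁ * (1 + L₀) * (‖x - x'‖ + ‖y - y'‖) := by
  have := hp.noise_prob
  rw [L, L, ← integral_sub (hp.integrable_l x y) (hp.integrable_l x' y')]
  simpa using norm_integral_le_of_norm_le_const (μ := p.ν)
    (f := fun e => p.l (x, y, p.ψ x + e) - p.l (x', y', p.ψ x' + e))
    (Filter.Eventually.of_forall fun e => hp.abs_l_arg_sub_le x x' y y' e)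

lemma norm_DL_sub_le (hp : p.Regular ℓ₀ L₀ ℓ₁ L₁ μ) (x x' : Vec n) (y y' : Vec m) :
    ‖p.DL x y - p.DL x' y'‖ ≤
      (ℓ₁ * (1 + L₀) * (1 + L₀) + L₁ * ℓ₀) * (‖x - x'‖ + ‖y - y'‖) := by
  have := hp.noise_prob
  rw [DL, DL, ← integral_sub (hp.integrable_dl x y) (hp.integrable_dl x' y')]
  simpa using norm_integral_le_of_norm_le_const (μ := p.ν)
    (Filter.Eventually.of_forall fun e => hp.norm_dl_sub_le x x' y y' e)

lemma continuous_L (hp : p.Regular ℓ₀ L₀ ℓ₁ L₁ μ) :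
    Continuous fun q : Vec n × Vec m => p.L q.1 q.2 := by
  have : LipschitzWith (L₁ * (1 + L₀) * 2) fun q : Vec n × Vec m => p.L q.1 q.2 := by
    refine LipschitzWith.of_dist_le_mul fun q q' => ?_
    rw [Real.dist_eq]
    refine (hp.abs_L_sub_le _ _ _ _).trans ?_
    push_cast
    rw [mul_assoc _ (2 : ℝ)]
    gcongr
    have h1 := norm_fst_le (q - q')
    have h2 := norm_snd_le (q - q')
    rw [dist_eq_norm, two_mul]
    exact add_le_add h1 h2
  exact this.continuous

lemma continuous_L_snd (hp : p.Regular ℓ₀ L₀ ℓ₁ L₁ μ) (x : Vec n) : Continuous (p.L x) :=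
  hp.continuous_L.comp (by fun_prop : Continuous fun y : Vec m => (x, y))

lemma isCompact_closure_Y (hp : p.Regular ℓ₀ L₀ ℓ₁ L₁ μ) : IsCompact (closure p.Y) :=
  hp.Y_bounded.isCompact_closure

/-- Strong concavity in the form used below: the value at a midpoint exceeds the mean value. -/
lemma L_midpoint (hp : p.Regular ℓ₀ L₀ ℓ₁ L₁ μ) (x : Vec n) {y y' : Vec m}
    (hy : y ∈ closure p.Y) (hy' : y' ∈ closure p.Y) :
    (p.L x y + p.L x y') / 2 + μ / 8 * ‖y - y'‖ ^ 2 ≤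
      p.L x ((1 / 2 : ℝ) • y + (1 / 2 : ℝ) • y') := by
  have := hp.noise_prob
  have hL := hp.continuous_L_snd x
  have main : ∀ q ∈ closure (p.Y ×ˢ p.Y), (p.L x q.1 + p.L x q.2) / 2 + μ / 8 * ‖q.1 - q.2‖ ^ 2 ≤
      p.L x ((1 / 2 : ℝ) • q.1 + (1 / 2 : ℝ) • q.2) := by
    intro q hq
    refine closure_minimal (s := p.Y ×ˢ p.Y) (t := {q : Vec m × Vec m |
      (p.L x q.1 + p.L x q.2) / 2 + μ / 8 * ‖q.1 - q.2‖ ^ 2 ≤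
      p.L x ((1 / 2 : ℝ) • q.1 + (1 / 2 : ℝ) • q.2)}) ?_ ?_ hq
    · rintro ⟨a, b⟩ ⟨ha, hb⟩
      have hc : ∀ e, (p.l (x, a, p.ψ x + e) + p.l (x, b, p.ψ x + e)) / 2 + μ / 8 * ‖a - b‖ ^ 2 ≤
          p.l (x, (1 / 2 : ℝ) • a + (1 / 2 : ℝ) • b, p.ψ x + e) := by
        intro e
        obtain ⟨-, hsc⟩ := hp.l_strongConcave x (p.ψ x + e)
        have := hsc ha hb (a := 1 / 2) (b := 1 / 2)
          (by norm_num) (by norm_num) (by norm_num)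
        simp only [smul_eq_mul] at this
        linarith
      have hi := ((hp.integrable_l x a).add (hp.integrable_l x b)).div_const 2
      have := integral_mono (hi.add (integrable_const (μ / 8 * ‖a - b‖ ^ 2)))
        (hp.integrable_l x _) hc
      simp only [Pi.add_apply] at this hi
      rw [integral_add hi (integrable_const _), integral_div,
        integral_add (hp.integrable_l x a) (hp.integrable_l x b)] at this
      simpa [L] using this
    · exact isClosed_le (by fun_prop) (by fun_prop)
  exact main (y, y') (by rw [closure_prod_eq]; exact ⟨hy, hy'⟩)

lemma bddAbove_L (hp : p.Regular ℓ₀ L₀ ℓ₁ L₁ μ) (x : Vec n) : BddAbove (p.L x '' closure p.Y) :=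
  (hp.isCompact_closure_Y.image (hp.continuous_L_snd x)).bddAbove

lemma L_le_Phi (hp : p.Regular ℓ₀ L₀ ℓ₁ L₁ μ) (x : Vec n) {y : Vec m} (hy : y ∈ closure p.Y) :
    p.L x y ≤ p.Φ x := by
  refine closure_minimal (s := p.Y) (t := {y | p.L x y ≤ p.Φ x}) (fun y hy => ?_)
    (isClosed_le (hp.continuous_L_snd x) continuous_const) hy
  exact le_csSup ((hp.bddAbove_L x).mono (Set.image_mono subset_closure)) ⟨y, hy, rfl⟩

/-- The supremum defining the primal function is attained on the closure of the feasible set. -/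
lemma exists_argmax (hp : p.Regular ℓ₀ L₀ ℓ₁ L₁ μ) (x : Vec n) :
    ∃ y ∈ closure p.Y, p.L x y = p.Φ x := by
  obtain ⟨y, hy, hmax⟩ := hp.isCompact_closure_Y.exists_isMaxOn hp.Y_nonempty.closure
    (hp.continuous_L_snd x).continuousOn
  refine ⟨y, hy, le_antisymm (hp.L_le_Phi x hy) ?_⟩
  refine csSup_le (hp.Y_nonempty.image _) ?_
  rintro _ ⟨z, hz, rfl⟩
  exact hmax (subset_closure hz)

/-- Strong concavity separates the maximizer from points with almost maximal value. -/
lemma quadratic_growth (hp : p.Regular ℓ₀ L₀ ℓ₁ L₁ μ) (x : Vec n) {y z : Vec m}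
    (hy : y ∈ closure p.Y) (hmax : p.L x y = p.Φ x) (hz : z ∈ closure p.Y) :
    μ / 4 * ‖y - z‖ ^ 2 ≤ p.Φ x - p.L x z := by
  have h1 := hp.L_midpoint x hy hz
  have h2 : (1 / 2 : ℝ) • y + (1 / 2 : ℝ) • z ∈ closure p.Y :=
    hp.Y_convex.closure hy hz (by norm_num) (by norm_num) (by norm_num)
  have h3 := hp.L_le_Phi x h2
  linarith

lemma argmax_sub_sq_le (hp : p.Regular ℓ₀ L₀ ℓ₁ L₁ μ) {x x' : Vec n} {y y' : Vec m}
    (hy : y ∈ closure p.Y) (hmax : p.L x y = p.Φ x) (hy' : y' ∈ closure p.Y)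
    (hmax' : p.L x' y' = p.Φ x') :
    ‖y - y'‖ ^ 2 ≤ 4 / μ * (2 * (L₁ * (1 + L₀))) * ‖x - x'‖ := by
  have h1 := hp.quadratic_growth x hy hmax hy'
  have h2 := hp.L_le_Phi x' hy
  have h3 := abs_le.1 (hp.abs_L_sub_le x x' y y)
  have h4 := abs_le.1 (hp.abs_L_sub_le x x' y' y')
  have hμ := hp.mu_pos
  simp only [sub_self, norm_zero, add_zero] at h3 h4
  have h5 : μ / 4 * ‖y - y'‖ ^ 2 ≤ 2 * (L₁ * (1 + L₀)) * ‖x - x'‖ := by linarith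
  calc ‖y - y'‖ ^ 2 = 4 / μ * (μ / 4 * ‖y - y'‖ ^ 2) := by field_simp
    _ ≤ 4 / μ * (2 * (L₁ * (1 + L₀)) * ‖x - x'‖) := by gcongr
    _ = _ := by ring

/-- First order expansion of `𝓛(·, y)` with a remainder uniform in `y`. -/
lemma abs_L_sub_DL_le (hp : p.Regular ℓ₀ L₀ ℓ₁ L₁ μ) (x x' : Vec n) (y : Vec m) :
    |p.L x' y - p.L x y - p.DL x y (x' - x)| ≤
      (ℓ₁ * (1 + L₀) * (1 + L₀) + L₁ * ℓ₀) * ‖x' - x‖ * ‖x' - x‖ := by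
  have := (convex_segment x x').norm_image_sub_le_of_norm_hasFDerivWithin_le'
    (f := fun x => p.L x y) (f' := fun x => p.DL x y) (φ := p.DL x y)
    (C := (ℓ₁ * (1 + L₀) * (1 + L₀) + L₁ * ℓ₀) * ‖x' - x‖)
    (fun z _ => (hp.hasFDerivAt_L z y).hasFDerivWithinAt) (fun z hz => ?_)
    (left_mem_segment ℝ x x') (right_mem_segment ℝ x x')
  · simpa using this
  · refine (hp.norm_DL_sub_le z x y y).trans ?_
    rw [sub_self, norm_zero, add_zero]
    gcongr
    exact norm_sub_le_of_mem_segment hz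

/-- Danskin's theorem: at a maximizer `y` of `𝓛(x, ·)`, the primal function has the derivative of
`𝓛(·, y)`. -/
lemma hasFDerivAt_Phi (hp : p.Regular ℓ₀ L₀ ℓ₁ L₁ μ) {x : Vec n} {y : Vec m}
    (hy : y ∈ closure p.Y) (hmax : p.L x y = p.Φ x) : HasFDerivAt p.Φ (p.DL x y) x := by
  set K : ℝ := ℓ₁ * (1 + L₀) * (1 + L₀) + L₁ * ℓ₀ with hK
  have hK0 : 0 ≤ K := by positivity
  set M : ℝ := 4 / μ * (2 * (L₁ * (1 + L₀))) with hM
  have hM0 : 0 ≤ M := by have := hp.mu_pos; positivity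
  have bound : ∀ x', |p.Φ x' - p.Φ x - p.DL x y (x' - x)| ≤
      (2 * K * ‖x' - x‖ + K * Real.sqrt (M * ‖x' - x‖)) * ‖x' - x‖ := by
    intro x'
    obtain ⟨y', hy', hmax'⟩ := hp.exists_argmax x'
    have hd : ‖y' - y‖ ≤ Real.sqrt (M * ‖x' - x‖) :=
      Real.le_sqrt_of_sq_le (hp.argmax_sub_sq_le hy' hmax' hy hmax)
    have h1 := abs_le.1 (hp.abs_L_sub_DL_le x x' y)
    have h2 := abs_le.1 (hp.abs_L_sub_DL_le x x' y')
    have h3 := hp.L_le_Phi x' hy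
    have h4 := hp.L_le_Phi x hy'
    have h5 : |(p.DL x y' - p.DL x y) (x' - x)| ≤ K * Real.sqrt (M * ‖x' - x‖) * ‖x' - x‖ := by
      refine ((p.DL x y' - p.DL x y).le_opNorm _).trans ?_
      refine mul_le_mul_of_nonneg_right ?_ (norm_nonneg _)
      refine (hp.norm_DL_sub_le x x y' y).trans ?_
      rw [sub_self, norm_zero, zero_add, ← hK]
      gcongr
    have h6 := abs_le.1 h5
    rw [_root_.sub_apply] at h6
    rw [← hK] at h1 h2
    have h7 : 0 ≤ K * ‖x' - x‖ * ‖x' - x‖ := by positivity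
    have h8 : 0 ≤ K * Real.sqrt (M * ‖x' - x‖) * ‖x' - x‖ := by positivity
    rw [abs_le]
    constructor <;> linarith
  rw [hasFDerivAt_iff_isLittleO, Asymptotics.isLittleO_iff]
  intro c hc
  have hlim : Filter.Tendsto (fun x' => 2 * K * ‖x' - x‖ + K * Real.sqrt (M * ‖x' - x‖))
      (nhds x) (nhds 0) := by
    have : Continuous fun x' => 2 * K * ‖x' - x‖ + K * Real.sqrt (M * ‖x' - x‖) := by fun_prop
    simpa using this.tendsto x
  filter_upwards [hlim.eventually (gt_mem_nhds hc)] with x' hx'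
  rw [Real.norm_eq_abs]
  exact (bound x').trans (by gcongr)

lemma differentiable_Phi (hp : p.Regular ℓ₀ L₀ ℓ₁ L₁ μ) : Differentiable ℝ p.Φ := fun x => by
  obtain ⟨y, hy, hmax⟩ := hp.exists_argmax x
  exact (hp.hasFDerivAt_Phi hy hmax).differentiableAt

lemma continuous_fderiv_Phi (hp : p.Regular ℓ₀ L₀ ℓ₁ L₁ μ) : Continuous (fderiv ℝ p.Φ) := by
  rw [continuous_iff_continuousAt]
  intro x
  obtain ⟨y, hy, hmax⟩ := hp.exists_argmax x
  set K : ℝ := ℓ₁ * (1 + L₀) * (1 + L₀) + L₁ * ℓ₀ with hK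
  have hK0 : 0 ≤ K := by positivity
  rw [ContinuousAt, tendsto_iff_norm_sub_tendsto_zero]
  have hlim : Filter.Tendsto
      (fun x' => K * (‖x' - x‖ + Real.sqrt (4 / μ * (2 * (L₁ * (1 + L₀))) * ‖x' - x‖)))
      (nhds x) (nhds 0) := by
    have : Continuous fun x' =>
      K * (‖x' - x‖ + Real.sqrt (4 / μ * (2 * (L₁ * (1 + L₀))) * ‖x' - x‖)) := by fun_prop
    simpa using this.tendsto x
  refine squeeze_zero (fun _ => norm_nonneg _) (fun x' => ?_) hlim
  obtain ⟨y', hy', hmax'⟩ := hp.exists_argmax x'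
  rw [(hp.hasFDerivAt_Phi hy hmax).fderiv, (hp.hasFDerivAt_Phi hy' hmax').fderiv]
  refine (hp.norm_DL_sub_le _ _ _ _).trans ?_
  gcongr
  exact Real.le_sqrt_of_sq_le (hp.argmax_sub_sq_le hy' hmax' hy hmax)

end Regular

end Problem

/-! ### A uniform law of large numbers with Gaussian tails -/

section Tail

variable {Ω V : Type*} [MeasurableSpace Ω] [MeasurableSpace V] {P : Measure Ω}
  [IsProbabilityMeasure P] {ν : Measure V} {ε : ℕ → Ω → V}

/-- Two-sided Hoeffding inequality for functions of i.i.d. random variables. -/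
lemma measureReal_abs_sum_ge_le (hm : ∀ i, Measurable (ε i)) (hlaw : ∀ i, P.map (ε i) = ν)
    (hind : iIndepFun ε P) (N : ℕ) {g : ℕ → V → ℝ} (hg : ∀ i, Measurable (g i)) {b : ℝ}
    (hb : ∀ i, ∀ᵐ v ∂ν, |g i v| ≤ b) (h0 : ∀ i, ∫ v, g i v ∂ν = 0) {a : ℝ} (ha : 0 ≤ a) :
    P.real {ω | a ≤ |∑ i ∈ Finset.range N, g i (ε i ω)|} ≤
      2 * Real.exp (-a ^ 2 / (2 * N * b ^ 2)) := by
  have hsub : ∀ i, HasSubgaussianMGF (fun ω => g i (ε i ω)) ((‖b - -b‖₊ / 2) ^ 2) P := by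
    intro i
    refine hasSubgaussianMGF_of_mem_Icc_of_integral_eq_zero
      ((hg i).comp (hm i)).aemeasurable ?_ ?_
    · have := hb i
      rw [← hlaw i] at this
      filter_upwards [ae_of_ae_map (hm i).aemeasurable this] with ω hω
      exact abs_le.1 hω
    · rw [← h0 i, ← hlaw i, integral_map (hm i).aemeasurable (hg i).aestronglyMeasurable]
  have hI : iIndepFun (fun i ω => g i (ε i ω)) P := hind.comp g hg
  have hI' : iIndepFun (fun i ω => -g i (ε i ω)) P :=
    hind.comp (fun i v => -g i v) fun i => (hg i).neg
  have hc : (((‖b - -b‖₊ / 2) ^ 2 : ℝ≥0) : ℝ) = b ^ 2 := by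
    push_cast
    rw [sub_neg_eq_add, ← two_mul, norm_mul, Real.norm_ofNat, Real.norm_eq_abs,
      mul_div_cancel_left₀ _ two_ne_zero, sq_abs]
  have h1 := HasSubgaussianMGF.measure_sum_range_ge_le_of_iIndepFun hI (n := N)
    (fun i _ => hsub i) ha
  have h2 := HasSubgaussianMGF.measure_sum_range_ge_le_of_iIndepFun hI' (n := N)
    (fun i _ => (hsub i).neg) ha
  rw [hc] at h1 h2
  have hsubset : {ω | a ≤ |∑ i ∈ Finset.range N, g i (ε i ω)|} ⊆
      {ω | a ≤ ∑ i ∈ Finset.range N, g i (ε i ω)} ∪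
        {ω | a ≤ ∑ i ∈ Finset.range N, -g i (ε i ω)} := by
    intro ω hω
    rw [Set.mem_ofPred_eq, le_abs] at hω
    simpa [Finset.sum_neg_distrib] using hω
  calc _ ≤ _ := measureReal_mono hsubset
    _ ≤ _ := measureReal_union_le _ _
    _ ≤ _ := by linarith

end Tail

section Chaining

variable {ι : Type*} {V : Type*} [MeasurableSpace V]

/-- The point `k / 2 ^ j` of the dyadic grid of level `j`. -/
noncomputable def gridPt (j : ℕ) (k : ι → ℤ) : ι → ℝ := fun a => (k a : ℝ) / 2 ^ j

/-- The increment of the centred function `w ↦ f w v - ∫ f w` along the link of the chain that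
ends in the grid point `k / 2 ^ j` and starts in its lower left neighbour of the next coarser
level; for `j = 0` it is the value of the centred function. -/
noncomputable def chainInc (ν : Measure V) (f : (ι → ℝ) → V → ℝ) : ℕ → (ι → ℤ) → V → ℝ
  | 0, k, v => f (gridPt 0 k) v - ∫ v, f (gridPt 0 k) v ∂ν
  | j + 1, k, v => (f (gridPt (j + 1) k) v - ∫ v, f (gridPt (j + 1) k) v ∂ν) -
      (f (gridPt j fun a => k a / 2) v - ∫ v, f (gridPt j fun a => k a / 2) v ∂ν)

open Classical in
/-- Indices of the points of the dyadic grid of level `j` in the cube `[-R, R] ^ ι`. -/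
noncomputable def gridIdx [Fintype ι] (R j : ℕ) : Finset (ι → ℤ) :=
  Fintype.piFinset fun _ => Finset.Icc (-(R * 2 ^ j : ℤ)) (R * 2 ^ j)

/-- The noise sequences for which some link of the chain is too long. The admissible lengths
`N τ (3/4) ^ j / 4` sum up to `N τ`. -/
def chainBad [Fintype ι] (ν : Measure V) (f : (ι → ℝ) → V → ℝ) (R N : ℕ) (τ : ℝ) :
    Set (ℕ → V) :=
  ⋃ j, ⋃ k ∈ gridIdx (ι := ι) R j,
    {e | N * τ * ((3 / 4) ^ j / 4) ≤ |∑ i ∈ Finset.range N, chainInc ν f j k (e i)|}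

/-- The dyadic approximation of `w` of level `j`. -/
noncomputable def gridApprox (w : ι → ℝ) (j : ℕ) : ι → ℤ := fun a => ⌊w a * 2 ^ j⌋

lemma gridApprox_succ (w : ι → ℝ) (j : ℕ) :
    (fun a => gridApprox w (j + 1) a / 2) = gridApprox w j := by
  funext a
  simp only [gridApprox]
  symm
  rw [Int.floor_eq_iff]
  have h1 := Int.floor_le (w a * 2 ^ (j + 1))
  have h2 := Int.lt_floor_add_one (w a * 2 ^ (j + 1))
  set z : ℤ := ⌊w a * 2 ^ (j + 1)⌋
  have h3 : 2 * (z / 2) ≤ z := by omega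
  have h4 : z + 1 ≤ 2 * (z / 2) + 2 := by omega
  have h3' : (2 : ℝ) * ((z / 2 : ℤ) : ℝ) ≤ z := by exact_mod_cast h3
  have h4' : (z : ℝ) + 1 ≤ 2 * ((z / 2 : ℤ) : ℝ) + 2 := by exact_mod_cast h4
  rw [pow_succ] at h1 h2
  constructor <;> linarith

lemma norm_sub_gridPt_approx_le [Fintype ι] (w : ι → ℝ) (j : ℕ) :
    ‖w - gridPt j (gridApprox w j)‖ ≤ (1 / 2) ^ j := by
  rw [pi_norm_le_iff_of_nonneg (by positivity)]
  intro a
  have h1 := Int.floor_le (w a * 2 ^ j)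
  have h2 := Int.lt_floor_add_one (w a * 2 ^ j)
  have hpos : (0 : ℝ) < 2 ^ j := by positivity
  simp only [Pi.sub_apply, gridPt, gridApprox]
  have h3 : w a - (⌊w a * 2 ^ j⌋ : ℝ) / 2 ^ j = (w a * 2 ^ j - ⌊w a * 2 ^ j⌋) / 2 ^ j := by
    field_simp
  rw [h3, Real.norm_eq_abs, abs_div, abs_of_pos hpos, one_div, inv_pow, ← one_div]
  gcongr
  rw [abs_le]
  constructor <;> linarith

lemma gridApprox_mem [Fintype ι] {w : ι → ℝ} {R : ℕ} (hw : ‖w‖ ≤ R) (j : ℕ) :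
    gridApprox w j ∈ gridIdx (ι := ι) R j := by
  classical
  rw [gridIdx, Fintype.mem_piFinset]
  intro a
  have h := abs_le.1 ((norm_le_pi_norm w a).trans hw)
  have hpos : (0 : ℝ) < 2 ^ j := by positivity
  rw [Finset.mem_Icc]
  constructor
  · rw [gridApprox, Int.le_floor]
    push_cast
    nlinarith
  · have h1 : (gridApprox w j a : ℝ) ≤ w a * 2 ^ j := Int.floor_le _
    have h2 : w a * 2 ^ j ≤ (R : ℝ) * 2 ^ j := by nlinarith
    exact_mod_cast h1.trans h2

lemma norm_gridPt_sub_parent_le [Fintype ι] (j : ℕ) (k : ι → ℤ) :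
    ‖gridPt (j + 1) k - gridPt j fun a => k a / 2‖ ≤ (1 / 2) ^ (j + 1) := by
  rw [pi_norm_le_iff_of_nonneg (by positivity)]
  intro a
  have hpos : (0 : ℝ) < 2 ^ j := by positivity
  simp only [Pi.sub_apply, gridPt]
  have h3 : (k a : ℝ) / 2 ^ (j + 1) - ((k a / 2 : ℤ) : ℝ) / 2 ^ j =
      ((k a : ℝ) - 2 * ((k a / 2 : ℤ) : ℝ)) / 2 ^ (j + 1) := by
    rw [pow_succ]
    field_simp
  have h1 : 2 * (k a / 2) ≤ k a := by omega
  have h2 : k a ≤ 2 * (k a / 2) + 1 := by omega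
  have h1' : (2 : ℝ) * ((k a / 2 : ℤ) : ℝ) ≤ k a := by exact_mod_cast h1
  have h2' : (k a : ℝ) ≤ 2 * ((k a / 2 : ℤ) : ℝ) + 1 := by exact_mod_cast h2
  rw [h3, Real.norm_eq_abs, abs_div, abs_of_pos (by positivity : (0 : ℝ) < 2 ^ (j + 1)), one_div,
    inv_pow, ← one_div]
  gcongr
  rw [abs_le]
  constructor <;> linarith

lemma card_gridIdx_le [Fintype ι] {R : ℕ} (hR : 1 ≤ R) (j : ℕ) :
    ((gridIdx (ι := ι) R j).card : ℝ) ≤ ((6 * R : ℝ) ^ Fintype.card ι) ^ (j + 1) := by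
  have hR' : (1 : ℝ) ≤ R := by exact_mod_cast hR
  have h1 : (Finset.Icc (-(R * 2 ^ j : ℤ)) (R * 2 ^ j)).card = 2 * R * 2 ^ j + 1 := by
    rw [Int.card_Icc]
    have : (R * 2 ^ j + 1 - -(R * 2 ^ j) : ℤ) = ((2 * R * 2 ^ j + 1 : ℕ) : ℤ) := by
      push_cast; ring
    rw [this, Int.toNat_natCast]
  have h2 : (2 * R * 2 ^ j + 1 : ℝ) ≤ (6 * R) ^ (j + 1) := by
    have h3 : (2 : ℝ) ^ j ≤ (6 * R) ^ j := by gcongr; linarith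
    have h4 : (1 : ℝ) ≤ (6 * R) ^ j := one_le_pow₀ (by linarith)
    rw [pow_succ]
    nlinarith
  classical
  rw [gridIdx, Fintype.card_piFinset, Finset.prod_const, Finset.card_univ, h1,
    pow_right_comm]
  push_cast
  gcongr

variable {ν : Measure V} {f : (ι → ℝ) → V → ℝ} {K : ℝ}

lemma abs_centred_sub_le [Fintype ι] [IsProbabilityMeasure ν] (hint : ∀ w, Integrable (f w) ν)
    (hlip : ∀ w w' v, |f w v - f w' v| ≤ K * ‖w - w'‖) (w w' : ι → ℝ) (v : V) :
    |(f w v - ∫ v, f w v ∂ν) - (f w' v - ∫ v, f w' v ∂ν)| ≤ 2 * K * ‖w - w'‖ := by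
  have h1 := hlip w w' v
  have h2 : |(∫ v, f w v ∂ν) - ∫ v, f w' v ∂ν| ≤ K * ‖w - w'‖ := by
    rw [← integral_sub (hint w) (hint w')]
    simpa using norm_integral_le_of_norm_le_const (μ := ν) (f := fun v => f w v - f w' v)
      (Filter.Eventually.of_forall fun v => hlip w w' v)
  rw [abs_le] at *
  constructor <;> linarith

lemma sum_chainInc_eq (w : ι → ℝ) (v : V) (J : ℕ) :
    ∑ j ∈ Finset.range (J + 1), chainInc ν f j (gridApprox w j) v =
      f (gridPt J (gridApprox w J)) v - ∫ v, f (gridPt J (gridApprox w J)) v ∂ν := by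
  induction J with
  | zero => simp [chainInc]
  | succ J ih =>
    rw [Finset.sum_range_succ, ih]
    simp only [chainInc, gridApprox_succ]
    ring

/-- If no link is too long, then the empirical means are uniformly close to the expectations. -/
lemma abs_sum_centred_le_of_notMem_chainBad [Fintype ι] [IsProbabilityMeasure ν] (hint : ∀ w, Integrable (f w) ν)
    (hlip : ∀ w w' v, |f w v - f w' v| ≤ K * ‖w - w'‖) {R N : ℕ} {τ : ℝ} (hτ : 0 ≤ τ) {e : ℕ → V}
    (he : e ∉ chainBad ν f R N τ) {w : ι → ℝ} (hw : ‖w‖ ≤ R) :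
    |∑ i ∈ Finset.range N, (f w (e i) - ∫ v, f w v ∂ν)| ≤ N * τ := by
  have hlink : ∀ j, |∑ i ∈ Finset.range N, chainInc ν f j (gridApprox w j) (e i)| ≤
      N * τ * ((3 / 4) ^ j / 4) := by
    intro j
    by_contra! h
    exact he (Set.mem_iUnion.2 ⟨j, Set.mem_iUnion₂.2 ⟨_, gridApprox_mem hw j, h.le⟩⟩)
  have hlevel : ∀ J, |∑ i ∈ Finset.range N, (f (gridPt J (gridApprox w J)) (e i) -
      ∫ v, f (gridPt J (gridApprox w J)) v ∂ν)| ≤ N * τ := by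
    intro J
    simp_rw [← sum_chainInc_eq]
    rw [Finset.sum_comm]
    calc _ ≤ ∑ j ∈ Finset.range (J + 1), N * τ * ((3 / 4) ^ j / 4) :=
          (Finset.abs_sum_le_sum_abs _ _).trans (Finset.sum_le_sum fun j _ => hlink j)
      _ = N * τ * (1 - (3 / 4) ^ (J + 1)) := by
          rw [← Finset.mul_sum, ← Finset.sum_div, geom_sum_eq (by norm_num)]
          ring
      _ ≤ N * τ := by
          have : (0 : ℝ) ≤ (3 / 4) ^ (J + 1) := by positivity
          have h2 : 0 ≤ N * τ := by positivity
          nlinarith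
  have hdiff : ∀ J, |∑ i ∈ Finset.range N, (f w (e i) - ∫ v, f w v ∂ν)| ≤
      N * τ + N * (2 * |K| * (1 / 2) ^ J) := by
    intro J
    have h1 : |(∑ i ∈ Finset.range N, (f w (e i) - ∫ v, f w v ∂ν)) -
        ∑ i ∈ Finset.range N, (f (gridPt J (gridApprox w J)) (e i) -
      ∫ v, f (gridPt J (gridApprox w J)) v ∂ν)| ≤ N * (2 * |K| * (1 / 2) ^ J) := by
      rw [← Finset.sum_sub_distrib]
      refine (Finset.abs_sum_le_sum_abs _ _).trans ?_
      have : ∀ i ∈ Finset.range N, |(f w (e i) - ∫ v, f w v ∂ν) -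
          (f (gridPt J (gridApprox w J)) (e i) - ∫ v, f (gridPt J (gridApprox w J)) v ∂ν)| ≤
          2 * |K| * (1 / 2) ^ J := fun i _ => by
        refine (abs_centred_sub_le hint hlip w _ (e i)).trans ?_
        have h3 := norm_sub_gridPt_approx_le w J
        have h4 := le_abs_self K
        have h5 := norm_nonneg (w - gridPt J (gridApprox w J))
        calc _ ≤ 2 * |K| * ‖w - gridPt J (gridApprox w J)‖ := by gcongr
          _ ≤ _ := by gcongr
      refine (Finset.sum_le_sum this).trans ?_
      simp
    have h2 := hlevel J
    rw [abs_le] at *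
    constructor <;> linarith
  refine ge_of_tendsto' (f := fun J : ℕ => N * τ + N * (2 * |K| * (1 / 2) ^ J)) (x := Filter.atTop)
    ?_ hdiff
  have : Filter.Tendsto (fun J : ℕ => ((1 : ℝ) / 2) ^ J) Filter.atTop (nhds 0) :=
    tendsto_pow_atTop_nhds_zero_of_lt_one (by norm_num) (by norm_num)
  simpa using ((this.const_mul (2 * |K|)).const_mul (N : ℝ)).const_add (N * τ)

lemma measurable_chainInc (hmeas : ∀ w, Measurable (f w)) (j : ℕ) (k : ι → ℤ) :
    Measurable (chainInc ν f j k) := by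
  cases j with
  | zero => exact (hmeas _).sub_const _
  | succ j => exact ((hmeas _).sub_const _).sub ((hmeas _).sub_const _)

lemma integral_chainInc [IsProbabilityMeasure ν] (hint : ∀ w, Integrable (f w) ν) (j : ℕ) (k : ι → ℤ) :
    ∫ v, chainInc ν f j k v ∂ν = 0 := by
  have h : ∀ w, ∫ v, (f w v - ∫ v, f w v ∂ν) ∂ν = 0 := fun w => by
    rw [integral_sub (hint w) (integrable_const _)]
    simp
  cases j with
  | zero => exact h _
  | succ j =>
    have hi : ∀ w, Integrable (fun v => f w v - ∫ v, f w v ∂ν) ν := fun w =>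
      (hint w).sub (integrable_const _)
    simp only [chainInc]
    rw [integral_sub (hi _) (hi _), h, h, sub_zero]

lemma abs_chainInc_le [Fintype ι] [IsProbabilityMeasure ν] (hint : ∀ w, Integrable (f w) ν) (hK : 0 ≤ K)
    (hlip : ∀ w w' v, |f w v - f w' v| ≤ K * ‖w - w'‖)
    (hbd : ∀ w, ∀ᵐ v ∂ν, |f w v - ∫ v, f w v ∂ν| ≤ K) (j : ℕ) (k : ι → ℤ) :
    ∀ᵐ v ∂ν, |chainInc ν f j k v| ≤ 2 * K * (1 / 2) ^ j := by
  cases j with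
  | zero =>
    filter_upwards [hbd (gridPt 0 k)] with v hv
    simp only [chainInc, pow_zero]
    linarith
  | succ j =>
    filter_upwards with v
    refine (abs_centred_sub_le hint hlip _ _ v).trans ?_
    gcongr
    exact norm_gridPt_sub_parent_le j k

/-- Tail bound for the failure of the uniform law of large numbers, by a union bound over all
links of the chain. The number of links of level `j` grows like `B ^ j`, while the probability
that a given one is too long decays like `exp (-v (9/4) ^ j)`. -/
lemma measure_chainBad_le [Fintype ι] [IsProbabilityMeasure ν] {Ω : Type*} [MeasurableSpace Ω] {P : Measure Ω}
    [IsProbabilityMeasure P] {ε : ℕ → Ω → V} (hm : ∀ i, Measurable (ε i))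
    (hlaw : ∀ i, P.map (ε i) = ν) (hind : iIndepFun ε P) (hmeas : ∀ w, Measurable (f w))
    (hint : ∀ w, Integrable (f w) ν) (hK : 0 < K)
    (hlip : ∀ w w' v, |f w v - f w' v| ≤ K * ‖w - w'‖)
    (hbd : ∀ w, ∀ᵐ v ∂ν, |f w v - ∫ v, f w v ∂ν| ≤ K) {R N : ℕ} (hR : 1 ≤ R) (hN : 0 < N)
    {τ : ℝ} (hτ : 0 ≤ τ) :
    P {ω | (fun i => ε i ω) ∈ chainBad ν f R N τ} ≤
      ENNReal.ofReal (4 * (6 * R : ℝ) ^ Fintype.card ι *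
        Real.exp (-(N * τ ^ 2 / (128 * K ^ 2)))) := by
  set B : ℝ := (6 * R : ℝ) ^ Fintype.card ι with hB
  set v : ℝ := N * τ ^ 2 / (128 * K ^ 2) with hv
  have hN' : (0 : ℝ) < N := by exact_mod_cast hN
  have hv0 : 0 ≤ v := by positivity
  have hB0 : 0 ≤ B := by positivity
  set r : ℝ := B * Real.exp (-v) with hr
  have hr0 : 0 ≤ r := by positivity
  rcases lt_or_ge (1 / 2) r with hr1 | hr1
  · refine prob_le_one.trans ?_
    rw [← ENNReal.ofReal_one]
    exact ENNReal.ofReal_le_ofReal (by nlinarith)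
  have hlink : ∀ j, ∀ k : ι → ℤ, P {ω | N * τ * ((3 / 4) ^ j / 4) ≤
      |∑ i ∈ Finset.range N, chainInc ν f j k (ε i ω)|} ≤
      ENNReal.ofReal (2 * Real.exp (-v) ^ (j + 1)) := by
    intro j k
    have h := measureReal_abs_sum_ge_le hm hlaw hind N (g := fun _ => chainInc ν f j k)
      (fun _ => measurable_chainInc hmeas j k) (fun _ => abs_chainInc_le hint hK.le hlip hbd j k)
      (fun _ => integral_chainInc hint j k) (a := N * τ * ((3 / 4) ^ j / 4)) (by positivity)
    rw [← ENNReal.ofReal_toReal (measure_ne_top P _)]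
    refine ENNReal.ofReal_le_ofReal (h.trans ?_)
    rw [← Real.exp_nat_mul]
    have hexp : -(N * τ * ((3 / 4) ^ j / 4)) ^ 2 / (2 * N * (2 * K * (1 / 2) ^ j) ^ 2) =
        -(v * (9 / 4) ^ j) := by
      have h94 : ((9 : ℝ) / 4) ^ j = ((3 / 4) ^ j) ^ 2 / ((1 / 2) ^ j) ^ 2 := by
        rw [← pow_mul, ← pow_mul, mul_comm j 2, pow_mul, pow_mul, ← div_pow]
        norm_num
      rw [h94, hv]
      field_simp
      ring
    rw [hexp]
    have hbern : 1 + (j : ℝ) * (5 / 4) ≤ (1 + 5 / 4) ^ j :=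
      one_add_mul_le_pow (by norm_num) j
    norm_num at hbern
    have hj : (0 : ℝ) ≤ j := by positivity
    have : v * ((j : ℝ) + 1) ≤ v * (9 / 4) ^ j := by
      gcongr
      linarith
    gcongr
    push_cast
    linarith
  have hset : {ω | (fun i => ε i ω) ∈ chainBad ν f R N τ} =
      ⋃ j, ⋃ k ∈ gridIdx (ι := ι) R j, {ω | N * τ * ((3 / 4) ^ j / 4) ≤
      |∑ i ∈ Finset.range N, chainInc ν f j k (ε i ω)|} := by
    ext ω
    simp [chainBad]
  rw [hset]
  have hsum : HasSum (fun j : ℕ => 2 * r * r ^ j) (2 * r * (1 - r)⁻¹) :=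
    (hasSum_geometric_of_lt_one hr0 (by linarith)).mul_left _
  calc _ ≤ ∑' j, P (⋃ k ∈ gridIdx (ι := ι) R j, {ω | N * τ * ((3 / 4) ^ j / 4) ≤
      |∑ i ∈ Finset.range N, chainInc ν f j k (ε i ω)|}) := measure_iUnion_le _
    _ ≤ ∑' j : ℕ, ENNReal.ofReal (2 * r * r ^ j) := by
        refine ENNReal.tsum_le_tsum fun j => ?_
        calc _ ≤ ∑ k ∈ gridIdx (ι := ι) R j, P {ω | N * τ * ((3 / 4) ^ j / 4) ≤
              |∑ i ∈ Finset.range N, chainInc ν f j k (ε i ω)|} :=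
              measure_biUnion_finset_le _ _
          _ ≤ ∑ k ∈ gridIdx (ι := ι) R j, ENNReal.ofReal (2 * Real.exp (-v) ^ (j + 1)) :=
              Finset.sum_le_sum fun k _ => hlink j k
          _ = ENNReal.ofReal ((gridIdx (ι := ι) R j).card * (2 * Real.exp (-v) ^ (j + 1))) := by
              rw [Finset.sum_const, nsmul_eq_mul,
                ENNReal.ofReal_mul (p := ((gridIdx (ι := ι) R j).card : ℝ)) (by positivity),
                ENNReal.ofReal_natCast]
          _ ≤ _ := by
              refine ENNReal.ofReal_le_ofReal ?_
              calc _ ≤ B ^ (j + 1) * (2 * Real.exp (-v) ^ (j + 1)) := by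
                    gcongr
                    exact card_gridIdx_le hR j
                _ = _ := by rw [hr]; ring
    _ = ENNReal.ofReal (2 * r * (1 - r)⁻¹) := by
        rw [← ENNReal.ofReal_tsum_of_nonneg (fun j => by positivity) hsum.summable, hsum.tsum_eq]
    _ ≤ _ := by
        refine ENNReal.ofReal_le_ofReal ?_
        have : (1 - r)⁻¹ ≤ 2 := by
          rw [inv_le_comm₀ (by linarith) (by norm_num)]
          linarith
        calc 2 * r * (1 - r)⁻¹ ≤ 2 * r * 2 := by gcongr
          _ = _ := by rw [hr]; ring

end Chaining

/-! ### Least squares on poised sample points -/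

section Regression

/-- A minimizer of a sum of squares in a direction `h` has residuals that are not negatively
correlated with `h`. -/
lemma sum_inner_nonneg_of_forall_le {ι F : Type*} [NormedAddCommGroup F] [InnerProductSpace ℝ F]
    (s : Finset ι) (a h : ι → F)
    (hmin : ∀ t : ℝ, ∑ i ∈ s, ‖a i‖ ^ 2 ≤ ∑ i ∈ s, ‖a i + t • h i‖ ^ 2) :
    0 ≤ ∑ i ∈ s, inner ℝ (a i) (h i) := by
  set I := ∑ i ∈ s, inner ℝ (a i) (h i) with hI
  set H := ∑ i ∈ s, ‖h i‖ ^ 2 with hH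
  have hH0 : 0 ≤ H := Finset.sum_nonneg fun i _ => by positivity
  have key : ∀ t : ℝ, 0 ≤ 2 * t * I + t ^ 2 * H := by
    intro t
    have h1 := hmin t
    have h2 : ∑ i ∈ s, ‖a i + t • h i‖ ^ 2 = ∑ i ∈ s, ‖a i‖ ^ 2 + 2 * t * I + t ^ 2 * H := by
      rw [hI, hH, Finset.mul_sum, Finset.mul_sum, ← Finset.sum_add_distrib,
        ← Finset.sum_add_distrib]
      refine Finset.sum_congr rfl fun i _ => ?_
      rw [norm_add_sq_real, inner_smul_right, norm_smul, mul_pow, Real.norm_eq_abs, sq_abs]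
      ring
    linarith
  by_contra! hneg
  have h1 := key (-I / (H + 1))
  have h2 : 2 * (-I / (H + 1)) * I + (-I / (H + 1)) ^ 2 * H =
      -(I ^ 2 * (H + 2) / (H + 1) ^ 2) := by
    field_simp
    ring
  rw [h2] at h1
  have h3 : 0 < I ^ 2 * (H + 2) / (H + 1) ^ 2 := by
    have : 0 < I ^ 2 := by rw [sq]; exact mul_pos_of_neg_of_neg hneg hneg
    positivity
  linarith

variable {n d : ℕ}

lemma clm_apply_eq_sum {F : Type*} [NormedAddCommGroup F] [NormedSpace ℝ F] (A : Vec n →L[ℝ] F)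
    (v : Vec n) : A v = ∑ j, v j • A (EuclideanSpace.single j 1) := by
  conv_lhs => rw [← (EuclideanSpace.basisFun (Fin n) ℝ).sum_repr v]
  simp [map_sum]

/-- Error bound for an affine map `v ↦ h₀ + A v` fitted to data `r i + e i` at the points `u i` of
the unit ball: by poisedness its supremum on the ball is controlled by its empirical second moment,
which the normal equation bounds by the bias `β` and by the correlations of the noise `e` with the
coordinates of the sample points. -/
lemma norm_affine_fit_le {N : ℕ} (hN : 0 < N) {Λ δ : ℝ} (hΛ : 0 < Λ) (hδ : 0 < δ) {c : Vec n}
    {u : ℕ → Vec n} (hpo : StronglyPoised Λ c δ fun i : Fin N => c + δ • u i)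
    {r e : ℕ → Vec d} {A : Vec n →L[ℝ] Vec d} {h₀ : Vec d}
    (hno : 0 ≤ ∑ i ∈ Finset.range N, inner ℝ (r i + e i - (h₀ + A (u i))) (h₀ + A (u i)))
    {β τ : ℝ} (hτ : 0 ≤ τ) (hr : ∀ i, ‖r i‖ ≤ β)
    (he : ‖∑ i ∈ Finset.range N, e i‖ ≤ N * τ)
    (heu : ∀ j, ‖∑ i ∈ Finset.range N, u i j • e i‖ ≤ N * τ) {v : Vec n} (hv : ‖v‖ ≤ 1) :
    ‖h₀ + A v‖ ≤ (n + 1) * Λ * (β + (2 * n + 1) * ((n + 1) * Λ) * τ) := by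
  have hN' : (0 : ℝ) < N := by exact_mod_cast hN
  have hβ : 0 ≤ β := (norm_nonneg _).trans (hr 0)
  set W : ℝ := (n + 1) * Λ with hW
  have hW0 : 0 < W := by positivity
  set Q : ℝ := ∑ i ∈ Finset.range N, ‖h₀ + A (u i)‖ ^ 2 with hQ
  have hQ0 : 0 ≤ Q := Finset.sum_nonneg fun i _ => by positivity
  set a : ℝ := Real.sqrt (Q / N) with ha
  have ha0 : 0 ≤ a := Real.sqrt_nonneg _
  have haQ : Q = N * a ^ 2 := by
    rw [ha, Real.sq_sqrt (by positivity)]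
    field_simp
  have hsup : ∀ v : Vec n, ‖v‖ ≤ 1 → ‖h₀ + A v‖ ≤ W * a := by
    intro v hv
    obtain ⟨w, hw1, hw2, hw3⟩ := hpo (c + δ • v) (by
      rw [Metric.mem_closedBall, dist_eq_norm, add_sub_cancel_left, norm_smul, Real.norm_eq_abs,
        abs_of_pos hδ]
      nlinarith)
    have hwv : ∑ i, w i • u i = v := by
      simp only [smul_add, Finset.sum_add_distrib, ← Finset.sum_smul, hw1, one_smul] at hw2
      have h1 : δ • ∑ i, w i • u i = δ • v := by
        rw [Finset.smul_sum]
        rw [← add_left_cancel hw2]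
        exact Finset.sum_congr rfl fun i _ => smul_comm _ _ _
      exact smul_right_injective _ hδ.ne' h1
    have hrep : h₀ + A v = ∑ i, w i • (h₀ + A (u i)) := by
      simp only [smul_add, Finset.sum_add_distrib, ← Finset.sum_smul, hw1, one_smul]
      rw [← hwv, map_sum]
      simp only [map_smul]
    have hQ' : Q = ∑ i : Fin N, ‖h₀ + A (u i)‖ ^ 2 :=
      (Fin.sum_univ_eq_sum_range (fun i => ‖h₀ + A (u i)‖ ^ 2) N).symm
    calc ‖h₀ + A v‖ ≤ ∑ i : Fin N, |w i| * ‖h₀ + A (u i)‖ := by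
          rw [hrep]
          refine (norm_sum_le _ _).trans (le_of_eq ?_)
          simp only [norm_smul, Real.norm_eq_abs]
      _ ≤ Real.sqrt (∑ i, |w i| ^ 2) * Real.sqrt (∑ i : Fin N, ‖h₀ + A (u i)‖ ^ 2) :=
          Real.sum_mul_le_sqrt_mul_sqrt _ _ _
      _ = Real.sqrt (∑ i, w i ^ 2) * Real.sqrt Q := by simp only [sq_abs, hQ']
      _ ≤ ((n : ℝ) + 1) / Real.sqrt N * Λ * Real.sqrt Q := by gcongr
      _ = W * a := by
          rw [ha, Real.sqrt_div hQ0, hW]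
          ring
  have h0 : ‖h₀‖ ≤ W * a := by simpa using hsup 0 (by simp)
  have hAj : ∀ j, ‖A (EuclideanSpace.single j 1)‖ ≤ 2 * (W * a) := by
    intro j
    have h1 := hsup (EuclideanSpace.single j 1) (by simp)
    have h2 := norm_sub_le (h₀ + A (EuclideanSpace.single j 1)) h₀
    rw [add_sub_cancel_left] at h2
    linarith
  -- the normal equation bounds the empirical second moment `Q`
  have hQ1 : Q ≤ ∑ i ∈ Finset.range N, inner ℝ (r i) (h₀ + A (u i)) +
      ∑ i ∈ Finset.range N, inner ℝ (e i) (h₀ + A (u i)) := by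
    refine sub_nonneg.1 (hno.trans (le_of_eq ?_))
    rw [hQ, ← Finset.sum_add_distrib, ← Finset.sum_sub_distrib]
    refine Finset.sum_congr rfl fun i _ => ?_
    rw [inner_sub_left, inner_add_left, real_inner_self_eq_norm_sq]
  have hbias : ∑ i ∈ Finset.range N, inner ℝ (r i) (h₀ + A (u i)) ≤ N * β * a := by
    have h1 : ∑ i ∈ Finset.range N, ‖h₀ + A (u i)‖ ≤ N * a := by
      have h2 := Finset.sum_mul_sq_le_sq_mul_sq (Finset.range N) (fun _ => (1 : ℝ))
        fun i => ‖h₀ + A (u i)‖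
      simp only [one_mul, one_pow, Finset.sum_const, Finset.card_range, nsmul_eq_mul, mul_one,
        ← hQ, haQ] at h2
      exact abs_le_of_sq_le_sq' (by linarith : _ ≤ (N * a) ^ 2) (by positivity) |>.2
    calc _ ≤ ∑ i ∈ Finset.range N, β * ‖h₀ + A (u i)‖ :=
          Finset.sum_le_sum fun i _ => (real_inner_le_norm _ _).trans (by gcongr; exact hr i)
      _ = β * ∑ i ∈ Finset.range N, ‖h₀ + A (u i)‖ := by rw [Finset.mul_sum]
      _ ≤ β * (N * a) := by gcongr
      _ = _ := by ring
  have hnoise : ∑ i ∈ Finset.range N, inner ℝ (e i) (h₀ + A (u i)) ≤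
      N * τ * ((2 * n + 1) * (W * a)) := by
    have h1 : ∑ i ∈ Finset.range N, inner ℝ (e i) (h₀ + A (u i)) =
        inner ℝ (∑ i ∈ Finset.range N, e i) h₀ +
          ∑ j, inner ℝ (∑ i ∈ Finset.range N, u i j • e i) (A (EuclideanSpace.single j 1)) := by
      simp only [inner_add_right, Finset.sum_add_distrib, sum_inner]
      congr 1
      rw [Finset.sum_comm]
      refine Finset.sum_congr rfl fun i _ => ?_
      rw [clm_apply_eq_sum A (u i), inner_sum]
      refine Finset.sum_congr rfl fun j _ => ?_
      rw [inner_smul_left, inner_smul_right]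
      simp
    rw [h1]
    have h2 : inner ℝ (∑ i ∈ Finset.range N, e i) h₀ ≤ N * τ * (W * a) :=
      (real_inner_le_norm _ _).trans (by gcongr)
    have h3 : ∑ j, inner ℝ (∑ i ∈ Finset.range N, u i j • e i) (A (EuclideanSpace.single j 1)) ≤
        ∑ _j : Fin n, N * τ * (2 * (W * a)) :=
      Finset.sum_le_sum fun j _ => (real_inner_le_norm _ _).trans
        (mul_le_mul (heu j) (hAj j) (norm_nonneg _) (by positivity))
    rw [Finset.sum_const, Finset.card_univ, Fintype.card_fin, nsmul_eq_mul] at h3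
    linarith
  have hfinal : a ≤ β + (2 * n + 1) * W * τ := by
    rcases ha0.eq_or_lt with h | h
    · rw [← h]; positivity
    · have h1 : N * a * a ≤ N * a * (β + (2 * n + 1) * W * τ) := by
        have := hQ1.trans (add_le_add hbias hnoise)
        rw [haQ] at this
        linarith
      exact le_of_mul_le_mul_left h1 (by positivity)
  exact (hsup v hv).trans (by gcongr)

end Regression

/-! ### Accuracy of the model for well-behaved noise -/

namespace Problem

variable {n m d : ℕ}

/-- The problem whose objective is the model objective: the regression function is the affine map
`x ↦ B₁ x + B₀`, and the noise has the empirical distribution of the residuals `res`. -/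
noncomputable def empirical (p : Problem n m d) (N : ℕ) (B₁ : Vec n →L[ℝ] Vec d) (B₀ : Vec d)
    (res : ℕ → Vec d) : Problem n m d where
  l := p.l
  ψ x := B₁ x + B₀
  Y := p.Y
  ν := (N : ENNReal)⁻¹ • ∑ i ∈ Finset.range N, Measure.dirac (res i)

variable {p : Problem n m d} {ℓ₀ L₀ ℓ₁ L₁ : ℝ≥0} {μ : ℝ}

lemma integral_empirical {F : Type*} [NormedAddCommGroup F] [NormedSpace ℝ F] [CompleteSpace F]
    (N : ℕ) (B₁ : Vec n →L[ℝ] Vec d) (B₀ : Vec d) (res : ℕ → Vec d) (g : Vec d → F) :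
    ∫ e, g e ∂(p.empirical N B₁ B₀ res).ν = (N : ℝ)⁻¹ • ∑ i ∈ Finset.range N, g (res i) := by
  simp only [empirical]
  rw [integral_smul_measure, integral_finsetSum_measure]
  · simp
  · intro i _
    exact integrable_dirac (by simp)

lemma fderiv_empirical_psi (N : ℕ) (B₁ : Vec n →L[ℝ] Vec d) (B₀ : Vec d) (res : ℕ → Vec d)
    (x : Vec n) : fderiv ℝ (p.empirical N B₁ B₀ res).ψ x = B₁ :=
  (B₁.hasFDerivAt.add_const B₀).fderiv

lemma Regular.empirical (hp : p.Regular ℓ₀ L₀ ℓ₁ L₁ μ) {N : ℕ} (hN : 0 < N)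
    (B₁ : Vec n →L[ℝ] Vec d) (B₀ : Vec d) (res : ℕ → Vec d) :
    (p.empirical N B₁ B₀ res).Regular 0 ‖B₁‖₊ ℓ₁ L₁ μ where
  psi_differentiable x := (B₁.hasFDerivAt.add_const B₀).differentiableAt
  noise_prob := by
    refine ⟨?_⟩
    simp only [Problem.empirical, Measure.smul_apply, Measure.coe_finsetSum, Finset.sum_apply,
      measure_univ, Finset.sum_const, Finset.card_range, smul_eq_mul, nsmul_eq_mul, mul_one]
    exact ENNReal.inv_mul_cancel (by simpa using hN.ne') (by simp)
  noise_bounded := by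
    refine ⟨∑ i ∈ Finset.range N, ‖res i‖, ?_⟩
    simp only [Problem.empirical]
    refine Measure.ae_smul_measure ?_ _
    rw [ae_finsetSum_measure_iff]
    intro i hi
    rw [ae_dirac_eq, Filter.eventually_pure]
    exact Finset.single_le_sum (f := fun i => ‖res i‖) (fun _ _ => norm_nonneg _) hi
  l_differentiable := hp.l_differentiable
  l_smooth := hp.l_smooth
  l_lipschitz := hp.l_lipschitz
  psi_smooth := by
    have : fderiv ℝ (p.empirical N B₁ B₀ res).ψ = fun _ => B₁ :=
      funext fun x => fderiv_empirical_psi N B₁ B₀ res x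
    rw [this]
    exact LipschitzWith.const' _
  psi_lipschitz := by
    refine LipschitzWith.of_dist_le_mul fun x y => ?_
    simp only [Problem.empirical, dist_add_right]
    exact B₁.lipschitz.dist_le_mul x y
  Y_nonempty := hp.Y_nonempty
  Y_convex := hp.Y_convex
  Y_bounded := hp.Y_bounded
  mu_pos := hp.mu_pos
  l_strongConcave := hp.l_strongConcave

namespace Regular

lemma norm_taylor_psi_le (hp : p.Regular ℓ₀ L₀ ℓ₁ L₁ μ) (c x : Vec n) :
    ‖p.ψ x - p.ψ c - fderiv ℝ p.ψ c (x - c)‖ ≤ ℓ₀ * ‖x - c‖ ^ 2 := by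
  have := (convex_segment c x).norm_image_sub_le_of_norm_hasFDerivWithin_le'
    (f := p.ψ) (f' := fderiv ℝ p.ψ) (φ := fderiv ℝ p.ψ c) (C := ℓ₀ * ‖x - c‖)
    (fun z _ => (hp.psi_differentiable z).hasFDerivAt.hasFDerivWithinAt) (fun z hz => ?_)
    (left_mem_segment ℝ c x) (right_mem_segment ℝ c x)
  · rwa [sq, ← mul_assoc]
  · refine (hp.psi_smooth.norm_sub_le z c).trans ?_
    gcongr
    exact norm_sub_le_of_mem_segment hz

/-- The fitted affine model is close to `ψ` on the trust region, in value and in derivative. -/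
lemma regression_error_le (hp : p.Regular ℓ₀ L₀ ℓ₁ L₁ μ) {N : ℕ} (hN : 0 < N) {Λ δ : ℝ}
    (hΛ : 0 < Λ) (hδ : 0 < δ) {c : Vec n} {u : ℕ → Vec n} (hu : ∀ i, ‖u i‖ ≤ 1)
    (hpo : StronglyPoised Λ c δ fun i : Fin N => c + δ • u i)
    {e : ℕ → Vec d} {B₁ : Vec n →L[ℝ] Vec d} {B₀ : Vec d}
    (hls : ∀ (b₁ : Vec n →L[ℝ] Vec d) (b₀ : Vec d),
      ∑ i ∈ Finset.range N, ‖p.ψ (c + δ • u i) + e i - B₁ (c + δ • u i) - B₀‖ ^ 2 ≤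
        ∑ i ∈ Finset.range N, ‖p.ψ (c + δ • u i) + e i - b₁ (c + δ • u i) - b₀‖ ^ 2)
    {τ : ℝ} (hτ : 0 ≤ τ) (he : ‖∑ i ∈ Finset.range N, e i‖ ≤ N * τ)
    (heu : ∀ j, ‖∑ i ∈ Finset.range N, u i j • e i‖ ≤ N * τ) {S : ℝ}
    (hS : (n + 1) * Λ * (ℓ₀ * δ ^ 2 + (2 * n + 1) * ((n + 1) * Λ) * τ) ≤ S) {x : Vec n}
    (hx : x ∈ Metric.closedBall c δ) :
    ‖B₁ x + B₀ - p.ψ x‖ ≤ S + ℓ₀ * δ ^ 2 ∧ ‖B₁ - fderiv ℝ p.ψ x‖ ≤ 2 * S / δ + ℓ₀ * δ := by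
  set T := fderiv ℝ p.ψ c with hT
  set h₀ : Vec d := B₁ c + B₀ - p.ψ c with hh₀
  have hr : ∀ i, ‖p.ψ (c + δ • u i) - p.ψ c - T (δ • u i)‖ ≤ ℓ₀ * δ ^ 2 := by
    intro i
    have h1 := hp.norm_taylor_psi_le c (c + δ • u i)
    rw [add_sub_cancel_left, norm_smul, Real.norm_eq_abs, abs_of_pos hδ] at h1
    refine h1.trans ?_
    have := hu i
    gcongr
    nlinarith
  have hno : 0 ≤ ∑ i ∈ Finset.range N,
      inner ℝ ((p.ψ (c + δ • u i) - p.ψ c - T (δ • u i)) + e i - (h₀ + (δ • (B₁ - T)) (u i)))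
        (h₀ + (δ • (B₁ - T)) (u i)) := by
    refine sum_inner_nonneg_of_forall_le _ _ _ fun t => ?_
    -- compare with the affine map obtained by moving from the fit towards the Taylor polynomial
    have h1 := hls (B₁ - t • (B₁ - T)) (B₀ - t • (h₀ - (B₁ - T) c))
    refine le_trans (le_of_eq ?_) (h1.trans (le_of_eq ?_)) <;>
    · refine Finset.sum_congr rfl fun i _ => ?_
      congr 2
      simp only [hh₀, _root_.sub_apply, _root_.smul_apply, map_add, map_smul, smul_sub, smul_add]
      module
  have hfit : ∀ v : Vec n, ‖v‖ ≤ 1 → ‖h₀ + (δ • (B₁ - T)) v‖ ≤ S := fun v hv =>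
    (norm_affine_fit_le hN hΛ hδ hpo hno hτ hr he heu hv).trans hS
  have hxc : ‖x - c‖ ≤ δ := by simpa [dist_eq_norm] using hx
  constructor
  · have h1 := hfit (δ⁻¹ • (x - c)) (by
      rw [norm_smul, norm_inv, Real.norm_eq_abs, abs_of_pos hδ, inv_mul_le_iff₀ hδ]
      linarith)
    have h2 := hp.norm_taylor_psi_le c x
    have h3 : B₁ x + B₀ - p.ψ x = (h₀ + (δ • (B₁ - T)) (δ⁻¹ • (x - c))) -
        (p.ψ x - p.ψ c - T (x - c)) := by
      rw [_root_.smul_apply, map_smul, smul_smul, mul_inv_cancel₀ hδ.ne', one_smul, hh₀,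
        _root_.sub_apply, map_sub, map_sub]
      abel
    rw [h3]
    refine (norm_sub_le _ _).trans (add_le_add h1 (h2.trans ?_))
    gcongr
  · have hS0 : 0 ≤ S := (norm_nonneg _).trans (hfit 0 (by simp))
    have h1 : ‖B₁ - T‖ ≤ 2 * S / δ := by
      refine ContinuousLinearMap.opNorm_le_of_unit_norm (by positivity) fun v hv => ?_
      have h2 := hfit v hv.le
      have h3 := hfit 0 (by simp)
      have h4 := norm_sub_le (h₀ + (δ • (B₁ - T)) v) (h₀ + (δ • (B₁ - T)) 0)
      rw [map_zero, add_zero, add_sub_cancel_left, _root_.smul_apply, norm_smul, Real.norm_eq_abs,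
        abs_of_pos hδ] at h4
      rw [map_zero, add_zero] at h3
      rw [_root_.smul_apply] at h2
      rw [le_div_iff₀ hδ]
      linarith
    have h5 : ‖T - fderiv ℝ p.ψ x‖ ≤ ℓ₀ * δ := by
      refine (hp.psi_smooth.norm_sub_le c x).trans ?_
      rw [norm_sub_rev]
      gcongr
    calc ‖B₁ - fderiv ℝ p.ψ x‖ = ‖(B₁ - T) + (T - fderiv ℝ p.ψ x)‖ := by rw [sub_add_sub_cancel]
      _ ≤ _ := (norm_add_le _ _).trans (add_le_add h1 h5)

end Regular

end Problem

namespace Problem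

variable {n m d : ℕ} {p : Problem n m d} {ℓ₀ L₀ ℓ₁ L₁ : ℝ≥0} {μ : ℝ}

lemma abs_avg_le {N : ℕ} (hN : 0 < N) {a : ℕ → ℝ} {b : ℝ} (h : ∀ i, |a i| ≤ b) :
    |(N : ℝ)⁻¹ * ∑ i ∈ Finset.range N, a i| ≤ b := by
  have hN' : (0 : ℝ) < N := by exact_mod_cast hN
  rw [abs_mul, abs_of_pos (by positivity), inv_mul_le_iff₀ hN']
  refine (Finset.abs_sum_le_sum_abs _ _).trans ((Finset.sum_le_sum fun i _ => h i).trans ?_)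
  simp

lemma norm_clm_le_of_basis {A : Vec n →L[ℝ] ℝ} {b : ℝ}
    (h : ∀ j, |A (EuclideanSpace.single j 1)| ≤ b) (hb : 0 ≤ b) : ‖A‖ ≤ n * b := by
  refine ContinuousLinearMap.opNorm_le_bound _ (by positivity) fun v => ?_
  rw [clm_apply_eq_sum A v]
  refine (norm_sum_le _ _).trans ?_
  calc _ ≤ ∑ _j : Fin n, ‖v‖ * b := by
        refine Finset.sum_le_sum fun j _ => ?_
        rw [norm_smul]
        exact mul_le_mul (PiLp.norm_apply_le v j) (h j) (norm_nonneg _) (norm_nonneg _)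
    _ = n * b * ‖v‖ := by
        rw [Finset.sum_const, Finset.card_univ, Fintype.card_fin, nsmul_eq_mul]
        ring

/-- The residuals of an affine fit `x ↦ B₁ x + B₀` to the responses `ψ(z i) + e i`. -/
def fitResidual (p : Problem n m d) (z : ℕ → Vec n) (e : ℕ → Vec d) (B₁ : Vec n →L[ℝ] Vec d)
    (B₀ : Vec d) (i : ℕ) : Vec d :=
  p.ψ (z i) + e i - B₁ (z i) - B₀

namespace Regular

variable {N : ℕ} {s : Set (Vec n)} {z : ℕ → Vec n} {e : ℕ → Vec d} {B₁ : Vec n →L[ℝ] Vec d}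
  {B₀ : Vec d} {D τ : ℝ}

/-- Adding the residuals to the fitted model instead of the noise to the regression function moves
the third argument of `l` by at most twice the error of the fit. -/
lemma norm_arg_fit_sub_le (hz : ∀ i, z i ∈ s) (hfit : ∀ x ∈ s, ‖B₁ x + B₀ - p.ψ x‖ ≤ D)
    {x : Vec n} (hx : x ∈ s) (y : Vec m) (i : ℕ) :
    ‖((x, y, B₁ x + B₀ + p.fitResidual z e B₁ B₀ i) : Vec n × Vec m × Vec d) -
      (x, y, p.ψ x + e i)‖ ≤ 2 * D := by
  have h1 : B₁ x + B₀ + p.fitResidual z e B₁ B₀ i - (p.ψ x + e i) =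
      (B₁ x + B₀ - p.ψ x) - (B₁ (z i) + B₀ - p.ψ (z i)) := by
    rw [fitResidual]
    abel
  have h2 := hfit x hx
  have h3 := hfit _ (hz i)
  have h4 := norm_sub_le (B₁ x + B₀ - p.ψ x) (B₁ (z i) + B₀ - p.ψ (z i))
  have h5 := norm_nonneg (B₁ x + B₀ - p.ψ x)
  simp only [Prod.mk_sub_mk, sub_self, Prod.norm_def, norm_zero, h1]
  exact max_le (by linarith) (max_le (by linarith) (by linarith))

lemma abs_empirical_L_sub_le (hp : p.Regular ℓ₀ L₀ ℓ₁ L₁ μ) (hN : 0 < N) (hz : ∀ i, z i ∈ s)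
    (hfit : ∀ x ∈ s, ‖B₁ x + B₀ - p.ψ x‖ ≤ D) {x : Vec n} (hx : x ∈ s) {y : Vec m}
    (hE : |(N : ℝ)⁻¹ * ∑ i ∈ Finset.range N, p.l (x, y, p.ψ x + e i) - p.L x y| ≤ τ) :
    |(p.empirical N B₁ B₀ (p.fitResidual z e B₁ B₀)).L x y - p.L x y| ≤ 2 * L₁ * D + τ := by
  set q := p.empirical N B₁ B₀ (p.fitResidual z e B₁ B₀) with hq
  have h1 : q.L x y =
      (N : ℝ)⁻¹ * ∑ i ∈ Finset.range N, p.l (x, y, B₁ x + B₀ + p.fitResidual z e B₁ B₀ i) :=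
    integral_empirical N B₁ B₀ _ fun e => p.l (x, y, B₁ x + B₀ + e)
  have h2 : |(N : ℝ)⁻¹ * ∑ i ∈ Finset.range N,
      (p.l (x, y, B₁ x + B₀ + p.fitResidual z e B₁ B₀ i) - p.l (x, y, p.ψ x + e i))| ≤
      2 * L₁ * D := by
    refine abs_avg_le hN fun i => (hp.abs_l_sub_le _ _).trans ?_
    have := norm_arg_fit_sub_le (e := e) hz hfit hx y i
    have h3 := L₁.coe_nonneg
    nlinarith
  rw [Finset.sum_sub_distrib, mul_sub, ← h1] at h2
  rw [abs_le] at *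
  constructor <;> linarith

lemma abs_empirical_Phi_sub_le (hp : p.Regular ℓ₀ L₀ ℓ₁ L₁ μ) (hN : 0 < N) {res : ℕ → Vec d}
    {x : Vec n} {η : ℝ}
    (h : ∀ y ∈ closure p.Y, |(p.empirical N B₁ B₀ res).L x y - p.L x y| ≤ η) :
    |p.Φ x - (p.empirical N B₁ B₀ res).Φ x| ≤ η := by
  set q := p.empirical N B₁ B₀ res
  have hq := hp.empirical hN B₁ B₀ res
  obtain ⟨y, hy, hmax⟩ := hp.exists_argmax x
  obtain ⟨y', hy', hmax'⟩ := hq.exists_argmax x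
  have h1 := abs_le.1 (h y hy)
  have h2 := abs_le.1 (h y' hy')
  have h3 := hp.L_le_Phi x hy'
  have h4 := hq.L_le_Phi x hy
  rw [abs_le]
  constructor <;> linarith

/-- The gradient of the model is close to that of the primal function. The maximizers are compared
through strong concavity, which turns closeness of order `η` of the objectives into closeness of
order `√η` of their maximizers. -/
lemma norm_fderiv_Phi_sub_le (hp : p.Regular ℓ₀ L₀ ℓ₁ L₁ μ) (hN : 0 < N) (hz : ∀ i, z i ∈ s)
    (hfit : ∀ x ∈ s, ‖B₁ x + B₀ - p.ψ x‖ ≤ D) {x : Vec n} (hx : x ∈ s) {D' η : ℝ} (hτ : 0 ≤ τ)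
    (hfit' : ‖B₁ - fderiv ℝ p.ψ x‖ ≤ D')
    (hL : ∀ y ∈ closure p.Y,
      |(p.empirical N B₁ B₀ (p.fitResidual z e B₁ B₀)).L x y - p.L x y| ≤ η)
    (hE : ∀ y ∈ closure p.Y, ∀ j, |(N : ℝ)⁻¹ * ∑ i ∈ Finset.range N,
      p.dl x y (e i) (EuclideanSpace.single j 1) - p.DL x y (EuclideanSpace.single j 1)| ≤ τ) :
    ‖fderiv ℝ p.Φ x - fderiv ℝ (p.empirical N B₁ B₀ (p.fitResidual z e B₁ B₀)).Φ x‖ ≤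
      (ℓ₁ * (1 + L₀) * (1 + L₀) + L₁ * ℓ₀) * Real.sqrt (8 * η / μ) + n * τ +
        (ℓ₁ * (2 * D) * (1 + L₀) + L₁ * D') := by
  set q := p.empirical N B₁ B₀ (p.fitResidual z e B₁ B₀) with hqdef
  have hq := hp.empirical hN B₁ B₀ (p.fitResidual z e B₁ B₀)
  have hμ := hp.mu_pos
  have hN' : (0 : ℝ) < N := by exact_mod_cast hN
  obtain ⟨y, hy, hmax⟩ := hp.exists_argmax x
  obtain ⟨y', hy', hmax'⟩ := hq.exists_argmax x
  have hy'' : y' ∈ closure p.Y := hy'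
  rw [(hp.hasFDerivAt_Phi hy hmax).fderiv, (hq.hasFDerivAt_Phi hy' hmax').fderiv]
  have hyy : ‖y - y'‖ ≤ Real.sqrt (8 * η / μ) := by
    refine Real.le_sqrt_of_sq_le ?_
    have h1 := hp.quadratic_growth x hy hmax hy''
    have h2 := hq.L_le_Phi x hy
    have h3 := abs_le.1 (hL y hy)
    have h4 := abs_le.1 (hL y' hy'')
    rw [le_div_iff₀ hμ]
    linarith
  have hA : ‖p.DL x y - p.DL x y'‖ ≤
      (ℓ₁ * (1 + L₀) * (1 + L₀) + L₁ * ℓ₀) * Real.sqrt (8 * η / μ) := by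
    refine (hp.norm_DL_sub_le x x y y').trans ?_
    rw [sub_self, norm_zero, zero_add]
    gcongr
  have hB : ‖(N : ℝ)⁻¹ • ∑ i ∈ Finset.range N, p.dl x y' (e i) - p.DL x y'‖ ≤ n * τ := by
    refine norm_clm_le_of_basis (fun j => ?_) hτ
    have := hE y' hy'' j
    simpa [sum_apply] using this
  have hqDL : q.DL x y' = (N : ℝ)⁻¹ • ∑ i ∈ Finset.range N,
      q.dl x y' (p.fitResidual z e B₁ B₀ i) :=
    integral_empirical N B₁ B₀ _ fun e => q.dl x y' e
  have hC : ‖(N : ℝ)⁻¹ • ∑ i ∈ Finset.range N, p.dl x y' (e i) - q.DL x y'‖ ≤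
      ℓ₁ * (2 * D) * (1 + L₀) + L₁ * D' := by
    have hsub : (N : ℝ)⁻¹ • ∑ i ∈ Finset.range N, p.dl x y' (e i) - q.DL x y' =
        (N : ℝ)⁻¹ • ∑ i ∈ Finset.range N,
          (p.dl x y' (e i) - q.dl x y' (p.fitResidual z e B₁ B₀ i)) := by
      rw [hqDL, Finset.sum_sub_distrib]
      exact (smul_sub _ _ _).symm
    rw [hsub, norm_smul, norm_inv, Real.norm_natCast,
      inv_mul_le_iff₀ hN']
    have hterm : ∀ i ∈ Finset.range N,
        ‖p.dl x y' (e i) - q.dl x y' (p.fitResidual z e B₁ B₀ i)‖ ≤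
          ℓ₁ * (2 * D) * (1 + L₀) + L₁ * D' := by
      intro i _
      have hqdl : q.dl x y' (p.fitResidual z e B₁ B₀ i) =
          (fderiv ℝ p.l (x, y', B₁ x + B₀ + p.fitResidual z e B₁ B₀ i)).comp (graphMap m B₁) := by
        rw [dl, hqdef, fderiv_empirical_psi]
        rfl
      have key : p.dl x y' (e i) - q.dl x y' (p.fitResidual z e B₁ B₀ i) =
          (fderiv ℝ p.l (x, y', p.ψ x + e i) -
            fderiv ℝ p.l (x, y', B₁ x + B₀ + p.fitResidual z e B₁ B₀ i)).comp
              (graphMap m (fderiv ℝ p.ψ x)) +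
          (fderiv ℝ p.l (x, y', B₁ x + B₀ + p.fitResidual z e B₁ B₀ i)).comp
              (graphMap m (fderiv ℝ p.ψ x) - graphMap m B₁) := by
        rw [hqdl, dl, ContinuousLinearMap.sub_comp, ContinuousLinearMap.comp_sub]
        abel
      have harg := norm_arg_fit_sub_le (e := e) hz hfit hx y' i
      have hD : 0 ≤ 2 * D := (norm_nonneg _).trans harg
      rw [key]
      refine (norm_add_le _ _).trans (add_le_add ?_ ?_)
      · refine (ContinuousLinearMap.opNorm_comp_le _ _).trans ?_
        refine mul_le_mul ?_ (hp.norm_graphMap_psi_le x) (norm_nonneg _) (by positivity)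
        refine (hp.l_smooth.norm_sub_le _ _).trans ?_
        rw [norm_sub_rev]
        gcongr
      · refine (ContinuousLinearMap.opNorm_comp_le _ _).trans ?_
        refine mul_le_mul (hp.norm_fderiv_l_le _) ?_ (norm_nonneg _) L₁.coe_nonneg
        refine (norm_graphMap_sub_le _ _).trans ?_
        rwa [norm_sub_rev]
    refine (norm_sum_le _ _).trans ((Finset.sum_le_sum hterm).trans ?_)
    rw [Finset.sum_const, Finset.card_range, nsmul_eq_mul]
  calc ‖p.DL x y - q.DL x y'‖
      = ‖(p.DL x y - p.DL x y') -
          ((N : ℝ)⁻¹ • ∑ i ∈ Finset.range N, p.dl x y' (e i) - p.DL x y') +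
          ((N : ℝ)⁻¹ • ∑ i ∈ Finset.range N, p.dl x y' (e i) - q.DL x y')‖ := by
        congr 1
        abel
    _ ≤ _ := (norm_add_le _ _).trans
        (add_le_add ((norm_sub_le _ _).trans (add_le_add hA hB)) hC)

end Regular

end Problem

/-! ### Measurability of the model and of the error events -/

section Measurability

lemma sSup_image_eq_of_dense {F : Type*} [TopologicalSpace F] {s t : Set F} {f : F → ℝ}
    (hf : Continuous f) (hbdd : BddAbove (f '' s)) (hts : t ⊆ s) (hst : s ⊆ closure t)
    (ht : t.Nonempty) : sSup (f '' s) = sSup (f '' t) := by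
  refine le_antisymm (csSup_le ((ht.mono hts).image f) ?_)
    (csSup_le_csSup hbdd (ht.image f) (Set.image_mono hts))
  rintro _ ⟨y, hy, rfl⟩
  refine closure_minimal (s := t) (t := {y | f y ≤ sSup (f '' t)}) (fun y hy => ?_)
    (isClosed_le hf continuous_const) (hst hy)
  exact le_csSup (hbdd.mono (Set.image_mono hts)) ⟨y, hy, rfl⟩

/-- The existential quantifier over a compact set of parameters can be replaced by countably many
strict inequalities at the points of a dense subset. -/
lemma measurableSet_exists_mem_compact {Ω E : Type*} {mΩ : MeasurableSpace Ω}
    [TopologicalSpace E] [SecondCountableTopology E] {K : Set E} (hK : IsCompact K)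
    {F : Ω → E → ℝ} (hcont : ∀ ω, Continuous (F ω)) (hmeas : ∀ u, Measurable fun ω => F ω u) :
    MeasurableSet {ω | ∃ u ∈ K, 0 ≤ F ω u} := by
  obtain ⟨t, htc, htd⟩ := TopologicalSpace.exists_countable_dense K
  have hset : {ω | ∃ u ∈ K, 0 ≤ F ω u} =
      ⋂ j : ℕ, ⋃ u ∈ t, {ω | -((1 : ℝ) / (j + 1)) < F ω (u : E)} := by
    ext ω
    simp only [Set.mem_iInter, Set.mem_iUnion, Set.mem_ofPred_eq, exists_prop]
    constructor
    · rintro ⟨u, hu, h0⟩ j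
      have hopen : IsOpen {v : K | -((1 : ℝ) / (j + 1)) < F ω (v : E)} :=
        isOpen_lt continuous_const ((hcont ω).comp continuous_subtype_val)
      obtain ⟨v, hv, hvt⟩ := htd.inter_open_nonempty _ hopen
        ⟨⟨u, hu⟩, lt_of_lt_of_le (neg_lt_zero.2 (by positivity)) h0⟩
      exact ⟨v, hvt, hv⟩
    · intro h
      obtain ⟨v, -, -⟩ := h 0
      obtain ⟨u, hu, hmax⟩ := hK.exists_isMaxOn ⟨v, v.2⟩ (hcont ω).continuousOn
      refine ⟨u, hu, ?_⟩
      refine le_of_forall_pos_lt_add fun δ hδ => ?_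
      obtain ⟨j, hj⟩ := exists_nat_one_div_lt hδ
      obtain ⟨v', -, hv'⟩ := h j
      have : F ω (v' : E) ≤ F ω u := hmax v'.2
      linarith
  rw [hset]
  exact MeasurableSet.iInter fun j => MeasurableSet.biUnion htc fun u _ =>
    measurableSet_lt measurable_const (hmeas u)

lemma measurable_sum_range {Ω : Type*} {mΩ : MeasurableSpace Ω} {M : Ω → ℕ} (hM : Measurable M)
    {g : ℕ → Ω → ℝ} (hg : ∀ i, Measurable (g i)) :
    Measurable fun ω => ∑ i ∈ Finset.range (M ω), g i ω := by
  have h : Measurable fun q : Ω × ℕ => ∑ i ∈ Finset.range q.2, g i q.1 :=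
    measurable_from_prod_countable_left fun k =>
      Finset.measurable_fun_sum (Finset.range k) fun i _ => hg i
  exact h.comp (measurable_id.prodMk hM)

end Measurability

namespace Run

variable {n m d : ℕ} {p : Problem n m d} {ℓ₀ L₀ ℓ₁ L₁ : ℝ≥0} {μ : ℝ}
  {Ω : Type*} {mΩ : MeasurableSpace Ω}

lemma measurable_sampleMean (hp : p.Regular ℓ₀ L₀ ℓ₁ L₁ μ) {M : Ω → ℕ} (hM : Measurable M)
    {w : ℕ → Ω → Vec d} (hw : ∀ j, Measurable (w j)) {x : Ω → Vec n} (hx : Measurable x)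
    {y : Ω → Vec m} (hy : Measurable y) :
    Measurable fun ω => p.sampleMean (M ω) (fun j => w j ω) (x ω) (y ω) := by
  simp only [Problem.sampleMean]
  refine Measurable.mul ?_ (measurable_sum_range hM fun i => ?_)
  · exact (measurable_of_countable (fun k : ℕ => (k : ℝ)⁻¹)).comp hM
  · exact hp.continuous_l.measurable.comp (hx.prodMk (hy.prodMk (hw i)))

variable {r : Run n m d Ω} {k : ℕ}

lemma measurable_pt (hx : Measurable (r.x k)) (hδ : Measurable (r.δ k))
    (hu : ∀ i, Measurable (r.u k i)) (i : ℕ) : Measurable (r.pt k i) :=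
  hx.add (hδ.smul (hu i))

lemma measurable_Phik (hp : p.Regular ℓ₀ L₀ ℓ₁ L₁ μ) (hx : Measurable (r.x k))
    (hδ : Measurable (r.δ k)) (hN : Measurable (r.N k)) (hu : ∀ i, Measurable (r.u k i))
    (hε : ∀ i, Measurable (r.ε k i)) (hB₁ : Measurable (r.B₁ k)) (hB₀ : Measurable (r.B₀ k))
    {ξ : Ω → Vec n} (hξ : Measurable ξ) : Measurable fun ω => r.Φk p k ω (ξ ω) := by
  have hpt := measurable_pt hx hδ hu
  have hLk : ∀ y, Measurable fun ω => r.Lk p k ω (ξ ω) y := by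
    intro y
    refine measurable_sampleMean hp hN (fun j => ?_) hξ measurable_const
    have happ : ∀ {ζ : Ω → Vec n}, Measurable ζ → Measurable fun ω => r.B₁ k ω (ζ ω) :=
      fun hζ => (ContinuousLinearMap.measurable_apply₂ (E := Vec n) (F := Vec d) (𝕜 := ℝ)).comp
        (hB₁.prodMk hζ)
    have hobs : Measurable (r.obs p k j) :=
      (hp.continuous_psi.measurable.comp (hpt j)).add (hε j)
    have hres : Measurable (r.residual p k j) := (hobs.sub (happ (hpt j))).sub hB₀
    exact ((happ hξ).add hB₀).add hres
  have hcont : ∀ ω, Continuous (r.Lk p k ω (ξ ω)) := by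
    intro ω
    have := hp.continuous_l
    unfold Lk Problem.sampleMean
    fun_prop
  obtain ⟨t, htY, htc, hYt⟩ :=
    (TopologicalSpace.IsSeparable.of_separableSpace p.Y).exists_countable_dense_subset
  have ht : t.Nonempty := by
    obtain ⟨y, hy⟩ := hp.Y_nonempty
    exact closure_nonempty_iff.1 ⟨y, hYt hy⟩
  have heq : (fun ω => r.Φk p k ω (ξ ω)) = fun ω => ⨆ y : t, r.Lk p k ω (ξ ω) y := by
    funext ω
    rw [Φk, sSup_image_eq_of_dense (hcont ω)
      (((hp.isCompact_closure_Y.image (hcont ω)).bddAbove).mono (Set.image_mono subset_closure))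
      htY hYt ht, sSup_image']
  have := htc.to_subtype
  rw [heq]
  exact Measurable.iSup fun y => hLk y

/-- The model `Φ̂ᵏ` is the primal function of the empirical problem. This includes the case of an
empty data set, in which both vanish. -/
lemma Phik_eq_empirical (r : Run n m d Ω) (p : Problem n m d) (k : ℕ) (ω : Ω) :
    r.Φk p k ω = (p.empirical (r.N k ω) (r.B₁ k ω) (r.B₀ k ω)
      (p.fitResidual (fun i => r.pt k i ω) (fun i => r.ε k i ω) (r.B₁ k ω) (r.B₀ k ω))).Φ := by
  funext x
  have : ∀ y, r.Lk p k ω x y = (p.empirical (r.N k ω) (r.B₁ k ω) (r.B₀ k ω)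
      (p.fitResidual (fun i => r.pt k i ω) (fun i => r.ε k i ω) (r.B₁ k ω) (r.B₀ k ω))).L x y :=
    fun y => (Problem.integral_empirical (p := p) (r.N k ω) (r.B₁ k ω) (r.B₀ k ω) _
      fun e => p.l (x, y, r.B₁ k ω x + r.B₀ k ω + e)).symm
  rw [Φk, Problem.Φ, show r.Lk p k ω x = _ from funext this]
  rfl

lemma Phik_of_N_eq_zero {ω : Ω} (h : r.N k ω = 0) (hY : p.Y.Nonempty) :
    r.Φk p k ω = fun _ => 0 := by
  funext x
  have : r.Lk p k ω x = fun _ => 0 := by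
    funext y
    simp [Lk, Problem.sampleMean, h]
  rw [Φk, this, hY.image_const, csSup_singleton]

lemma differentiable_Phik (hp : p.Regular ℓ₀ L₀ ℓ₁ L₁ μ) (r : Run n m d Ω) (k : ℕ) (ω : Ω) :
    Differentiable ℝ (r.Φk p k ω) := by
  rcases Nat.eq_zero_or_pos (r.N k ω) with h | h
  · rw [Phik_of_N_eq_zero h hp.Y_nonempty]
    exact differentiable_const 0
  · rw [Phik_eq_empirical]
    exact (hp.empirical h _ _ _).differentiable_Phi

lemma continuous_fderiv_Phik (hp : p.Regular ℓ₀ L₀ ℓ₁ L₁ μ) (r : Run n m d Ω) (k : ℕ) (ω : Ω) :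
    Continuous (fderiv ℝ (r.Φk p k ω)) := by
  rcases Nat.eq_zero_or_pos (r.N k ω) with h | h
  · rw [Phik_of_N_eq_zero h hp.Y_nonempty, fderiv_fun_const]
    exact continuous_const
  · rw [Phik_eq_empirical]
    exact (hp.empirical h _ _ _).continuous_fderiv_Phi

lemma norm_gradient_eq (f : Vec n → ℝ) (x : Vec n) : ‖gradient f x‖ = ‖fderiv ℝ f x‖ := by
  rw [gradient, LinearIsometryEquiv.norm_map]

lemma norm_clm_eq_sqrt (A : Vec n →L[ℝ] ℝ) :
    ‖A‖ = Real.sqrt (∑ j, A (EuclideanSpace.single j 1) ^ 2) := by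
  rw [← (InnerProductSpace.toDual ℝ (Vec n)).symm.norm_map A, EuclideanSpace.norm_eq]
  congr 1
  refine Finset.sum_congr rfl fun j _ => ?_
  have h := InnerProductSpace.toDual_symm_apply (𝕜 := ℝ) (x := EuclideanSpace.single j 1) (y := A)
  rw [EuclideanSpace.inner_single_right] at h
  rw [← h]
  simp

lemma measurable_norm_fderiv_Phik (hp : p.Regular ℓ₀ L₀ ℓ₁ L₁ μ) (hx : Measurable (r.x k))
    (hδ : Measurable (r.δ k)) (hN : Measurable (r.N k)) (hu : ∀ i, Measurable (r.u k i))
    (hε : ∀ i, Measurable (r.ε k i)) (hB₁ : Measurable (r.B₁ k)) (hB₀ : Measurable (r.B₀ k))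
    {ξ : Ω → Vec n} (hξ : Measurable ξ) :
    Measurable fun ω => ‖fderiv ℝ (r.Φk p k ω) (ξ ω)‖ := by
  have hcoord : ∀ v, Measurable fun ω => fderiv ℝ (r.Φk p k ω) (ξ ω) v := by
    intro v
    -- a directional derivative is the limit of difference quotients
    refine measurable_of_tendsto_metrizable
      (f := fun (j : ℕ) ω => (j : ℝ) • (r.Φk p k ω (ξ ω + (j : ℝ)⁻¹ • v) - r.Φk p k ω (ξ ω)))
      (fun j => ?_) ?_
    · have h1 := measurable_Phik hp hx hδ hN hu hε hB₁ hB₀ (hξ.add_const ((j : ℝ)⁻¹ • v))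
      have h2 := measurable_Phik hp hx hδ hN hu hε hB₁ hB₀ hξ
      exact (h1.sub h2).const_mul (j : ℝ)
    · rw [tendsto_pi_nhds]
      intro ω
      refine HasFDerivAt.lim (differentiable_Phik hp r k ω (ξ ω)).hasFDerivAt v ?_
      simpa using tendsto_natCast_atTop_atTop (R := ℝ)
  simp only [norm_clm_eq_sqrt]
  exact (Finset.measurable_fun_sum _ fun j _ => (hcoord _).pow_const 2).sqrt

lemma measurableSet_badValue (hp : p.Regular ℓ₀ L₀ ℓ₁ L₁ μ) (hx : Measurable (r.x k))
    (hδ : Measurable (r.δ k)) (hN : Measurable (r.N k)) (hu : ∀ i, Measurable (r.u k i))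
    (hε : ∀ i, Measurable (r.ε k i)) (hB₁ : Measurable (r.B₁ k)) (hB₀ : Measurable (r.B₀ k))
    (hpos : ∀ ω, 0 < r.δ k ω) (κ : ℝ) : MeasurableSet (r.badValue p κ k) := by
  have hset : r.badValue p κ k = {ω | ∃ v ∈ Metric.closedBall (0 : Vec n) 1,
      0 ≤ |p.Φ (r.x k ω + r.δ k ω • v) - r.Φk p k ω (r.x k ω + r.δ k ω • v)| -
        κ * r.δ k ω ^ 2} := by
    ext ω
    simp only [badValue, Set.mem_ofPred_eq, sub_nonneg]
    rw [← Set.exists_mem_image (s := Metric.closedBall (0 : Vec n) 1)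
        (f := fun v => r.x k ω + r.δ k ω • v)
        (p := fun x => κ * r.δ k ω ^ 2 ≤ |p.Φ x - r.Φk p k ω x|),
      show (fun v : Vec n => r.x k ω + r.δ k ω • v) '' Metric.closedBall 0 1 =
        Metric.closedBall (r.x k ω) (r.δ k ω) from ?_]
    have h1 := affinity_unitClosedBall (E := Vec n) (hpos ω).le (r.x k ω)
    rw [← h1, ← Set.image_smul, ← Set.image_vadd, Set.image_image]
    rfl
  rw [hset]
  refine measurableSet_exists_mem_compact (isCompact_closedBall 0 1) (fun ω => ?_) fun v => ?_
  · have h1 := hp.differentiable_Phi.continuous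
    have h2 := (differentiable_Phik hp r k ω).continuous
    fun_prop
  · have hξ : Measurable fun ω => r.x k ω + r.δ k ω • v := hx.add (hδ.smul_const v)
    have h1 := hp.differentiable_Phi.continuous.measurable.comp hξ
    have h2 := measurable_Phik hp hx hδ hN hu hε hB₁ hB₀ hξ
    exact (h1.sub h2).abs.sub ((hδ.pow_const 2).const_mul κ)

lemma measurableSet_badGradient (hp : p.Regular ℓ₀ L₀ ℓ₁ L₁ μ) (hx : Measurable (r.x k))
    (hδ : Measurable (r.δ k)) (hN : Measurable (r.N k)) (hu : ∀ i, Measurable (r.u k i))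
    (hε : ∀ i, Measurable (r.ε k i)) (hB₁ : Measurable (r.B₁ k)) (hB₀ : Measurable (r.B₀ k))
    (hpos : ∀ ω, 0 < r.δ k ω) (κ : ℝ) : MeasurableSet (r.badGradient p κ k) := by
  have hset : r.badGradient p κ k = {ω | ∃ v ∈ Metric.closedBall (0 : Vec n) 1,
      0 ≤ ‖fderiv ℝ p.Φ (r.x k ω + r.δ k ω • v)‖ -
        ‖fderiv ℝ (r.Φk p k ω) (r.x k ω + r.δ k ω • v)‖ - κ * r.δ k ω} := by
    ext ω
    simp only [badGradient, Set.mem_ofPred_eq, sub_nonneg, norm_gradient_eq]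
    rw [← Set.exists_mem_image (s := Metric.closedBall (0 : Vec n) 1)
        (f := fun v => r.x k ω + r.δ k ω • v)
        (p := fun x => κ * r.δ k ω ≤ ‖fderiv ℝ p.Φ x‖ - ‖fderiv ℝ (r.Φk p k ω) x‖),
      show (fun v : Vec n => r.x k ω + r.δ k ω • v) '' Metric.closedBall 0 1 =
        Metric.closedBall (r.x k ω) (r.δ k ω) from ?_]
    have h1 := affinity_unitClosedBall (E := Vec n) (hpos ω).le (r.x k ω)
    rw [← h1, ← Set.image_smul, ← Set.image_vadd, Set.image_image]
    rfl
  rw [hset]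
  refine measurableSet_exists_mem_compact (isCompact_closedBall 0 1) (fun ω => ?_) fun v => ?_
  · have h1 := hp.continuous_fderiv_Phi
    have h2 := continuous_fderiv_Phik hp r k ω
    fun_prop
  · have hξ : Measurable fun ω => r.x k ω + r.δ k ω • v := hx.add (hδ.smul_const v)
    have h1 := hp.continuous_fderiv_Phi.norm.measurable.comp hξ
    have h2 := measurable_norm_fderiv_Phik hp hx hδ hN hu hε hB₁ hB₀ hξ
    exact (h1.sub h2).sub (hδ.const_mul κ)

namespace IsRun

variable {P : Measure Ω} {δmax δ₀ γ η₁ η₂ : ℝ} {x₀ : Vec n}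

lemma delta_pos (h : r.IsRun p P δmax x₀ δ₀ γ η₁ η₂) (k : ℕ) (ω : Ω) : 0 < r.δ k ω := by
  have hγ : 0 < γ := zero_lt_one.trans h.one_lt_gamma
  induction k with
  | zero => rw [h.delta_zero]; exact h.delta0_pos
  | succ k ih =>
    by_cases hacc : r.Accepted p η₁ η₂ k ω
    · rw [h.delta_accept k ω hacc]
      exact lt_min (mul_pos hγ ih) (h.delta0_pos.trans h.delta0_lt)
    · rw [h.delta_reject k ω hacc]
      exact mul_pos (inv_pos.2 hγ) ih

lemma delta_le (h : r.IsRun p P δmax x₀ δ₀ γ η₁ η₂) (k : ℕ) (ω : Ω) : r.δ k ω ≤ δmax := by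
  induction k with
  | zero => rw [h.delta_zero]; exact h.delta0_lt.le
  | succ k ih =>
    by_cases hacc : r.Accepted p η₁ η₂ k ω
    · rw [h.delta_accept k ω hacc]
      exact min_le_right _ _
    · rw [h.delta_reject k ω hacc]
      exact (mul_le_of_le_one_left (h.delta_pos k ω).le
        (inv_le_one_of_one_le₀ h.one_lt_gamma.le)).trans ih

lemma mid_le (h : r.IsRun p P δmax x₀ δ₀ γ η₁ η₂) (k : ℕ) : r.mid k ≤ mΩ :=
  (h.mid_le_hist_succ k).trans (h.hist_le (k + 1))

lemma hist_mono (h : r.IsRun p P δmax x₀ δ₀ γ η₁ η₂) : Monotone r.hist :=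
  monotone_nat_of_le_succ fun k => (h.hist_le_mid k).trans (h.mid_le_hist_succ k)

lemma measurableSet_badValue (h : r.IsRun p P δmax x₀ δ₀ γ η₁ η₂)
    (hp : p.Regular ℓ₀ L₀ ℓ₁ L₁ μ) (k : ℕ) (κ : ℝ) : MeasurableSet (r.badValue p κ k) :=
  Run.measurableSet_badValue hp ((h.meas_x k).mono (h.hist_le k) le_rfl)
    ((h.meas_delta k).mono (h.hist_le k) le_rfl) ((h.meas_N k).mono (h.hist_le k) le_rfl)
    (fun i => (h.meas_u k i).mono (h.hist_le k) le_rfl)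
    (fun i => (h.meas_eps k i).mono (h.mid_le k) le_rfl)
    ((h.meas_B1 k).mono (h.mid_le k) le_rfl) ((h.meas_B0 k).mono (h.mid_le k) le_rfl)
    (h.delta_pos k) κ

lemma measurableSet_badGradient (h : r.IsRun p P δmax x₀ δ₀ γ η₁ η₂)
    (hp : p.Regular ℓ₀ L₀ ℓ₁ L₁ μ) (k : ℕ) (κ : ℝ) : MeasurableSet (r.badGradient p κ k) :=
  Run.measurableSet_badGradient hp ((h.meas_x k).mono (h.hist_le k) le_rfl)
    ((h.meas_delta k).mono (h.hist_le k) le_rfl) ((h.meas_N k).mono (h.hist_le k) le_rfl)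
    (fun i => (h.meas_u k i).mono (h.hist_le k) le_rfl)
    (fun i => (h.meas_eps k i).mono (h.mid_le k) le_rfl)
    ((h.meas_B1 k).mono (h.mid_le k) le_rfl) ((h.meas_B0 k).mono (h.mid_le k) le_rfl)
    (h.delta_pos k) κ

/-- What the algorithm reveals in the first `k` iterations is known before the regression noise of
iteration `k` is drawn. -/
lemma past_le_hist (h : r.IsRun p P δmax x₀ δ₀ γ η₁ η₂)
    (hp : p.Regular ℓ₀ L₀ ℓ₁ L₁ μ) (k : ℕ) : r.past p k ≤ r.hist k := by
  refine iSup_le fun i => ?_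
  have hle : r.hist (i + 1) ≤ r.hist k := h.hist_mono i.2
  have hmid : r.mid i ≤ r.hist (i + 1) := h.mid_le_hist_succ i
  have hhist : r.hist i ≤ r.hist (i + 1) := (h.hist_le_mid i).trans hmid
  refine le_trans ?_ hle
  have hx := (h.meas_x i).mono hhist le_rfl
  have hs := (h.meas_s i).mono hmid le_rfl
  refine sup_le (sup_le (iSup_le fun x => ?_) ?_) ?_
  · refine Measurable.comap_le ?_
    exact (measurable_Phik (mΩ := r.hist (i + 1)) hp hx
      ((h.meas_delta i).mono hhist le_rfl) ((h.meas_N i).mono hhist le_rfl)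
      (fun j => (h.meas_u i j).mono hhist le_rfl)
      (fun j => (h.meas_eps i j).mono hmid le_rfl)
      ((h.meas_B1 i).mono hmid le_rfl) ((h.meas_B0 i).mono hmid le_rfl) measurable_const)
  · refine Measurable.comap_le ?_
    refine measurable_sampleMean (mΩ := r.hist (i + 1)) hp ((h.meas_M i).mono hmid le_rfl)
      (fun j => ?_) hx (h.meas_yis i)
    exact (hp.continuous_psi.measurable.comp hx).add (h.meas_zeta i j)
  · refine Measurable.comap_le ?_
    refine measurable_sampleMean (mΩ := r.hist (i + 1)) hp ((h.meas_MHalf i).mono hmid le_rfl)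
      (fun j => ?_) (hx.add hs) (h.meas_yisHalf i)
    exact (hp.continuous_psi.measurable.comp (hx.add hs)).add (h.meas_zetaHalf i j)

end IsRun

end Run

/-! ### The exceptional noise of an iteration -/

namespace Problem

variable {n m d : ℕ}

lemma norm_le_sum_abs {k : ℕ} (v : Vec k) : ‖v‖ ≤ ∑ j, |v j| := by
  have h := clm_apply_eq_sum (ContinuousLinearMap.id ℝ (Vec k)) v
  simp only [ContinuousLinearMap.id_apply] at h
  calc ‖v‖ = ‖∑ j, v j • EuclideanSpace.single j (1 : ℝ)‖ := by rw [← h]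
    _ ≤ _ := (norm_sum_le _ _).trans (le_of_eq (by simp [norm_smul]))

/-- The displacement of `x` encoded in the parameter `w` of the empirical processes. -/
noncomputable def xPart (w : Fin n ⊕ Fin m → ℝ) : Vec n := WithLp.toLp 2 fun i => w (Sum.inl i)

/-- The point `y` encoded in the parameter `w` of the empirical processes. -/
noncomputable def yPart (w : Fin n ⊕ Fin m → ℝ) : Vec m := WithLp.toLp 2 fun i => w (Sum.inr i)

lemma norm_xPart_sub_le (w w' : Fin n ⊕ Fin m → ℝ) : ‖xPart w - xPart w'‖ ≤ n * ‖w - w'‖ := by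
  refine (norm_le_sum_abs _).trans ?_
  calc _ ≤ ∑ _j : Fin n, ‖w - w'‖ :=
        Finset.sum_le_sum fun j _ => norm_le_pi_norm (w - w') (Sum.inl j)
    _ = _ := by simp

lemma norm_yPart_sub_le (w w' : Fin n ⊕ Fin m → ℝ) : ‖yPart w - yPart w'‖ ≤ m * ‖w - w'‖ := by
  refine (norm_le_sum_abs _).trans ?_
  calc _ ≤ ∑ _j : Fin m, ‖w - w'‖ :=
        Finset.sum_le_sum fun j _ => norm_le_pi_norm (w - w') (Sum.inr j)
    _ = _ := by simp

lemma exists_param {R : ℕ} {v : Vec n} {y : Vec m} (hv : ‖v‖ ≤ R) (hy : ‖y‖ ≤ R) :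
    ∃ w : Fin n ⊕ Fin m → ℝ, ‖w‖ ≤ R ∧ xPart w = v ∧ yPart w = y := by
  refine ⟨Sum.elim (fun i => v i) (fun i => y i), ?_, rfl, rfl⟩
  rw [pi_norm_le_iff_of_nonneg (by positivity)]
  rintro (i | i)
  · exact (PiLp.norm_apply_le v i).trans hv
  · exact (PiLp.norm_apply_le y i).trans hy

/-- The values `l(x, y, ψ(x) + e)` as a function of the parameter of `(x - X, y)`. -/
noncomputable def valueField (p : Problem n m d) (X : Vec n) (w : Fin n ⊕ Fin m → ℝ)
    (e : Vec d) : ℝ :=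
  p.l (X + xPart w, yPart w, p.ψ (X + xPart w) + e)

/-- The `j`-th partial derivative in `x` of `l(x, y, ψ(x) + e)` as a function of the parameter of
`(x - X, y)`. -/
noncomputable def gradField (p : Problem n m d) (X : Vec n) (j : Fin n) (w : Fin n ⊕ Fin m → ℝ)
    (e : Vec d) : ℝ :=
  p.dl (X + xPart w) (yPart w) e (EuclideanSpace.single j 1)

/-- The noise sequences that are exceptional for a design with centre `q.1`, radius `q.2.1`, size
`q.2.2.1` and normalized sample points `q.2.2.2`: the uniform law of large numbers for the values
fails at scale `c κ δ²`, or that for the gradients at scale `c κ δ`, or the noise is correlated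
with an affine function of the sample points at scale `c κ δ²`. -/
def noiseBad (p : Problem n m d) (R : ℕ) (c κ : ℝ) (q : Vec n × ℝ × ℕ × (ℕ → Vec n)) :
    Set (ℕ → Vec d) :=
  (chainBad p.ν (p.valueField q.1) R q.2.2.1 (c * κ * q.2.1 ^ 2) ∪
    ⋃ j, chainBad p.ν (p.gradField q.1 j) R q.2.2.1 (c * κ * q.2.1)) ∪
  ((⋃ a : Fin d, {e | q.2.2.1 * (c * κ * q.2.1 ^ 2) / (d + 1) ≤
      |∑ i ∈ Finset.range q.2.2.1, e i a|}) ∪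
    ⋃ j : Fin n, ⋃ a : Fin d, {e | q.2.2.1 * (c * κ * q.2.1 ^ 2) / (d + 1) ≤
      |∑ i ∈ Finset.range q.2.2.1, q.2.2.2 i j * e i a|})

namespace Regular

variable {p : Problem n m d} {ℓ₀ L₀ ℓ₁ L₁ : ℝ≥0} {μ : ℝ}

lemma continuous_valueField (hp : p.Regular ℓ₀ L₀ ℓ₁ L₁ μ) (w : Fin n ⊕ Fin m → ℝ) :
    Continuous fun q : Vec n × Vec d => p.valueField q.1 w q.2 := by
  have h1 := hp.continuous_l
  have h2 := hp.continuous_psi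
  unfold valueField
  fun_prop

lemma continuous_gradField (hp : p.Regular ℓ₀ L₀ ℓ₁ L₁ μ) (j : Fin n) (w : Fin n ⊕ Fin m → ℝ) :
    Continuous fun q : Vec n × Vec d => p.gradField q.1 j w q.2 := by
  have h : Continuous fun q : Vec n × Vec d => p.dl (q.1 + xPart w) (yPart w) q.2 :=
    hp.continuous_dl.comp
      (by fun_prop : Continuous fun q : Vec n × Vec d => (q.1 + xPart w, yPart w, q.2))
  exact h.clm_apply continuous_const

lemma integral_gradField (hp : p.Regular ℓ₀ L₀ ℓ₁ L₁ μ) (X : Vec n) (j : Fin n)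
    (w : Fin n ⊕ Fin m → ℝ) : ∫ e, p.gradField X j w e ∂p.ν =
      p.DL (X + xPart w) (yPart w) (EuclideanSpace.single j 1) :=
  (ContinuousLinearMap.integral_apply (hp.integrable_dl _ _) _).symm

lemma integrable_gradField (hp : p.Regular ℓ₀ L₀ ℓ₁ L₁ μ) (X : Vec n) (j : Fin n)
    (w : Fin n ⊕ Fin m → ℝ) : Integrable (p.gradField X j w) p.ν :=
  (hp.integrable_dl (X + xPart w) (yPart w)).apply_continuousLinearMap _

lemma norm_param_sub_le (X : Vec n) (w w' : Fin n ⊕ Fin m → ℝ) :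
    ‖(X + xPart w) - (X + xPart w')‖ + ‖yPart w - yPart w'‖ ≤ (n + m) * ‖w - w'‖ := by
  rw [add_sub_add_left_eq_sub, add_mul]
  exact add_le_add (norm_xPart_sub_le w w') (norm_yPart_sub_le w w')

lemma abs_valueField_sub_le (hp : p.Regular ℓ₀ L₀ ℓ₁ L₁ μ) (X : Vec n)
    (w w' : Fin n ⊕ Fin m → ℝ) (e : Vec d) :
    |p.valueField X w e - p.valueField X w' e| ≤ L₁ * (1 + L₀) * (n + m) * ‖w - w'‖ := by
  refine (hp.abs_l_arg_sub_le _ _ _ _ e).trans ?_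
  rw [mul_assoc _ ((n : ℝ) + m)]
  gcongr
  exact norm_param_sub_le X w w'

lemma abs_clm_single_le (A : Vec n →L[ℝ] ℝ) (j : Fin n) :
    |A (EuclideanSpace.single j 1)| ≤ ‖A‖ := by
  simpa using A.le_opNorm (EuclideanSpace.single j 1)

lemma abs_gradField_sub_le (hp : p.Regular ℓ₀ L₀ ℓ₁ L₁ μ) (X : Vec n) (j : Fin n)
    (w w' : Fin n ⊕ Fin m → ℝ) (e : Vec d) :
    |p.gradField X j w e - p.gradField X j w' e| ≤
      (ℓ₁ * (1 + L₀) * (1 + L₀) + L₁ * ℓ₀) * (n + m) * ‖w - w'‖ := by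
  rw [gradField, gradField, ← _root_.sub_apply]
  refine (abs_clm_single_le _ j).trans ((hp.norm_dl_sub_le _ _ _ _ e).trans ?_)
  rw [mul_assoc _ ((n : ℝ) + m)]
  gcongr
  exact norm_param_sub_le X w w'

lemma abs_valueField_centred_le (hp : p.Regular ℓ₀ L₀ ℓ₁ L₁ μ) {ρ : ℝ}
    (hρ : ∀ᵐ e ∂p.ν, ‖e‖ ≤ ρ) (X : Vec n) (w : Fin n ⊕ Fin m → ℝ) :
    ∀ᵐ e ∂p.ν, |p.valueField X w e - ∫ e, p.valueField X w e ∂p.ν| ≤ 2 * L₁ * ρ := by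
  have := hp.noise_prob
  set b := p.l (X + xPart w, yPart w, p.ψ (X + xPart w))
  have h1 : ∀ᵐ e ∂p.ν, |p.valueField X w e - b| ≤ L₁ * ρ := by
    filter_upwards [hρ] with e he
    refine (hp.abs_l_sub_le _ _).trans ?_
    gcongr
    simpa [Prod.norm_def] using he
  have h2 : |(∫ e, p.valueField X w e ∂p.ν) - b| ≤ L₁ * ρ := by
    have h3 := norm_integral_le_of_norm_le_const (μ := p.ν)
      (f := fun e => p.valueField X w e - b) h1
    rw [integral_sub (show Integrable (p.valueField X w) p.ν from hp.integrable_l _ _)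
      (integrable_const _)] at h3
    simpa using h3
  filter_upwards [h1] with e he
  rw [abs_le] at *
  constructor <;> linarith

lemma abs_gradField_centred_le (hp : p.Regular ℓ₀ L₀ ℓ₁ L₁ μ) (X : Vec n) (j : Fin n)
    (w : Fin n ⊕ Fin m → ℝ) (e : Vec d) :
    |p.gradField X j w e - ∫ e, p.gradField X j w e ∂p.ν| ≤ 2 * (L₁ * (1 + L₀)) := by
  have := hp.noise_prob
  have h1 : ∀ e, |p.gradField X j w e| ≤ L₁ * (1 + L₀) := fun e =>
    (abs_clm_single_le _ j).trans (hp.norm_dl_le _ _ e)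
  have h2 : |∫ e, p.gradField X j w e ∂p.ν| ≤ L₁ * (1 + L₀) := by
    simpa using norm_integral_le_of_norm_le_const (μ := p.ν)
      (f := fun e => p.gradField X j w e) (Filter.Eventually.of_forall h1)
  have h3 := h1 e
  rw [abs_le] at *
  constructor <;> linarith

end Regular

end Problem

section JointMeasurability

variable {D V ι : Type*} [MeasurableSpace D] [MeasurableSpace V] {ν : Measure V}
  {f : D → (ι → ℝ) → V → ℝ}

lemma measurable_chainInc_prod [SFinite ν] (hf : ∀ w, Measurable fun q : D × V => f q.1 w q.2)
    (j : ℕ) (k : ι → ℤ) : Measurable fun q : D × V => chainInc ν (f q.1) j k q.2 := by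
  have hI : ∀ w, Measurable fun t : D => ∫ v, f t w v ∂ν := fun w =>
    ((hf w).stronglyMeasurable.integral_prod_right' (ν := ν)).measurable
  have hc : ∀ w, Measurable fun q : D × V => f q.1 w q.2 - ∫ v, f q.1 w v ∂ν := fun w =>
    (hf w).sub ((hI w).comp measurable_fst)
  cases j with
  | zero => exact hc _
  | succ j => exact (hc _).sub (hc _)

lemma measurableSet_chainBad_prod [Fintype ι] [SFinite ν]
    (hf : ∀ w, Measurable fun q : D × V => f q.1 w q.2) (R : ℕ) {N : D → ℕ} (hN : Measurable N)
    {τ : D → ℝ} (hτ : Measurable τ) :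
    MeasurableSet {q : D × (ℕ → V) | q.2 ∈ chainBad ν (f q.1) R (N q.1) (τ q.1)} := by
  have hset : {q : D × (ℕ → V) | q.2 ∈ chainBad ν (f q.1) R (N q.1) (τ q.1)} =
      ⋃ j, ⋃ k ∈ gridIdx (ι := ι) R j, {q : D × (ℕ → V) | N q.1 * τ q.1 * ((3 / 4) ^ j / 4) ≤
        |∑ i ∈ Finset.range (N q.1), chainInc ν (f q.1) j k (q.2 i)|} := by
    ext q
    simp [chainBad]
  rw [hset]
  refine MeasurableSet.iUnion fun j => Finset.measurableSet_biUnion _ fun k _ => ?_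
  have hN' : Measurable fun q : D × (ℕ → V) => N q.1 := hN.comp measurable_fst
  refine measurableSet_le ?_ ?_
  · exact (((measurable_of_countable (fun k : ℕ => (k : ℝ))).comp hN').mul
      (hτ.comp measurable_fst)).mul_const _
  · refine (measurable_sum_range hN' fun i => ?_).abs
    exact (measurable_chainInc_prod hf j k).comp
      (measurable_fst.prodMk ((measurable_pi_apply i).comp measurable_snd))

end JointMeasurability

namespace Problem

variable {n m d : ℕ} {p : Problem n m d} {ℓ₀ L₀ ℓ₁ L₁ : ℝ≥0} {μ : ℝ}

namespace Regular

lemma measurableSet_noiseBad (hp : p.Regular ℓ₀ L₀ ℓ₁ L₁ μ) (R : ℕ) (c κ : ℝ) :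
    MeasurableSet {q : (Vec n × ℝ × ℕ × (ℕ → Vec n)) × (ℕ → Vec d) |
      q.2 ∈ p.noiseBad R c κ q.1} := by
  have := hp.noise_prob
  have hN : Measurable fun q : Vec n × ℝ × ℕ × (ℕ → Vec n) => q.2.2.1 := by fun_prop
  have hδ : Measurable fun q : Vec n × ℝ × ℕ × (ℕ → Vec n) => q.2.1 := by fun_prop
  have hN' : Measurable fun q : (Vec n × ℝ × ℕ × (ℕ → Vec n)) × (ℕ → Vec d) => q.1.2.2.1 :=
    hN.comp measurable_fst
  have hlhs : Measurable fun q : (Vec n × ℝ × ℕ × (ℕ → Vec n)) × (ℕ → Vec d) =>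
      (q.1.2.2.1 : ℝ) * (c * κ * q.1.2.1 ^ 2) / (d + 1) := by
    refine (((measurable_of_countable (fun k : ℕ => (k : ℝ))).comp hN').mul ?_).div_const _
    fun_prop
  have hcoord : ∀ (i : ℕ) (a : Fin d),
      Measurable fun q : (Vec n × ℝ × ℕ × (ℕ → Vec n)) × (ℕ → Vec d) => q.2 i a := by
    intro i a
    exact (by fun_prop : Measurable fun v : Vec d => v a).comp
      ((measurable_pi_apply i).comp measurable_snd)
  have hcoord' : ∀ (i : ℕ) (j : Fin n),
      Measurable fun q : (Vec n × ℝ × ℕ × (ℕ → Vec n)) × (ℕ → Vec d) => q.1.2.2.2 i j := by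
    intro i j
    exact (by fun_prop : Measurable fun v : Vec n => v j).comp
      ((measurable_pi_apply i).comp (by fun_prop))
  have h1 := measurableSet_chainBad_prod (ν := p.ν)
    (f := fun q : Vec n × ℝ × ℕ × (ℕ → Vec n) => p.valueField q.1)
    (fun w => (hp.continuous_valueField w).measurable.comp
      ((measurable_fst.comp measurable_fst).prodMk measurable_snd)) R hN
    ((hδ.pow_const 2).const_mul (c * κ))
  have h2 := fun j => measurableSet_chainBad_prod (ν := p.ν)
    (f := fun q : Vec n × ℝ × ℕ × (ℕ → Vec n) => p.gradField q.1 j)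
    (fun w => (hp.continuous_gradField j w).measurable.comp
      ((measurable_fst.comp measurable_fst).prodMk measurable_snd)) R hN
    (hδ.const_mul (c * κ))
  have h3 : ∀ a : Fin d, MeasurableSet {q : (Vec n × ℝ × ℕ × (ℕ → Vec n)) × (ℕ → Vec d) |
      (q.1.2.2.1 : ℝ) * (c * κ * q.1.2.1 ^ 2) / (d + 1) ≤
        |∑ i ∈ Finset.range q.1.2.2.1, q.2 i a|} := fun a =>
    measurableSet_le hlhs (measurable_sum_range hN' fun i => hcoord i a).abs
  have h4 : ∀ (j : Fin n) (a : Fin d),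
      MeasurableSet {q : (Vec n × ℝ × ℕ × (ℕ → Vec n)) × (ℕ → Vec d) |
      (q.1.2.2.1 : ℝ) * (c * κ * q.1.2.1 ^ 2) / (d + 1) ≤
        |∑ i ∈ Finset.range q.1.2.2.1, q.1.2.2.2 i j * q.2 i a|} := fun j a =>
    measurableSet_le hlhs
      (measurable_sum_range hN' fun i => (hcoord' i j).mul (hcoord i a)).abs
  have := (h1.union (MeasurableSet.iUnion h2)).union ((MeasurableSet.iUnion h3).union
    (MeasurableSet.iUnion fun j => MeasurableSet.iUnion fun a => h4 j a))
  convert this using 1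
  ext q
  simp [noiseBad]

end Regular

end Problem

namespace Problem

variable {n m d : ℕ} {p : Problem n m d} {ℓ₀ L₀ ℓ₁ L₁ : ℝ≥0} {μ : ℝ}

section NoiseProbability

variable {Ω : Type*} [MeasurableSpace Ω] {P : Measure Ω} [IsProbabilityMeasure P]
  {ε : ℕ → Ω → Vec d}

lemma Regular.measure_chainBad_valueField_le (hp : p.Regular ℓ₀ L₀ ℓ₁ L₁ μ)
    (hm : ∀ i, Measurable (ε i)) (hlaw : ∀ i, P.map (ε i) = p.ν) (hind : iIndepFun ε P)
    {ρ : ℝ} (hρ0 : 0 ≤ ρ) (hρ : ∀ᵐ e ∂p.ν, ‖e‖ ≤ ρ) (X : Vec n) {R N : ℕ} (hR : 1 ≤ R)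
    (hN : 0 < N) {τ : ℝ} (hτ : 0 ≤ τ) :
    P {ω | (fun i => ε i ω) ∈ chainBad p.ν (p.valueField X) R N τ} ≤
      ENNReal.ofReal (4 * (6 * R : ℝ) ^ Fintype.card (Fin n ⊕ Fin m) *
        Real.exp (-(N * τ ^ 2 /
          (128 * (L₁ * (1 + L₀) * (n + m) + 2 * L₁ * ρ + 1) ^ 2)))) := by
  have := hp.noise_prob
  have h1 : 0 ≤ L₁ * (1 + L₀) * ((n : ℝ) + m) := by positivity
  have h2 : 0 ≤ 2 * L₁ * ρ := by positivity
  refine measure_chainBad_le (f := p.valueField X) hm hlaw hind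
    (fun w => (hp.continuous_l_arg _ _).measurable) (fun w => hp.integrable_l _ _) (by positivity)
    (fun w w' e => ?_) (fun w => ?_) hR hN hτ
  · refine (hp.abs_valueField_sub_le X w w' e).trans ?_
    exact mul_le_mul_of_nonneg_right (by linarith) (norm_nonneg _)
  · filter_upwards [hp.abs_valueField_centred_le hρ X w] with e he
    linarith

lemma Regular.measure_chainBad_gradField_le (hp : p.Regular ℓ₀ L₀ ℓ₁ L₁ μ)
    (hm : ∀ i, Measurable (ε i)) (hlaw : ∀ i, P.map (ε i) = p.ν) (hind : iIndepFun ε P)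
    (X : Vec n) (j : Fin n) {R N : ℕ} (hR : 1 ≤ R) (hN : 0 < N) {τ : ℝ} (hτ : 0 ≤ τ) :
    P {ω | (fun i => ε i ω) ∈ chainBad p.ν (p.gradField X j) R N τ} ≤
      ENNReal.ofReal (4 * (6 * R : ℝ) ^ Fintype.card (Fin n ⊕ Fin m) *
        Real.exp (-(N * τ ^ 2 / (128 *
          ((ℓ₁ * (1 + L₀) * (1 + L₀) + L₁ * ℓ₀) * (n + m) + 2 * (L₁ * (1 + L₀)) + 1) ^ 2)))) := by
  have := hp.noise_prob
  have h1 : 0 ≤ (ℓ₁ * (1 + L₀) * (1 + L₀) + L₁ * ℓ₀) * ((n : ℝ) + m) := by positivity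
  have h2 : (0 : ℝ) ≤ 2 * (L₁ * (1 + L₀)) := by positivity
  refine measure_chainBad_le (f := p.gradField X j) hm hlaw hind
    (fun w => (hp.continuous_gradField j w).measurable.comp (by fun_prop :
      Measurable fun e : Vec d => (X, e)))
    (fun w => hp.integrable_gradField X j w) (by positivity) (fun w w' e => ?_)
    (fun w => Filter.Eventually.of_forall fun e => ?_) hR hN hτ
  · refine (hp.abs_gradField_sub_le X j w w' e).trans ?_
    exact mul_le_mul_of_nonneg_right (by linarith) (norm_nonneg _)
  · have := hp.abs_gradField_centred_le X j w e
    linarith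

lemma measure_abs_weighted_sum_ge_le (hmean : ∫ e, e ∂p.ν = 0) (hm : ∀ i, Measurable (ε i))
    (hlaw : ∀ i, P.map (ε i) = p.ν) (hind : iIndepFun ε P) {ρ : ℝ}
    (hρ : ∀ᵐ e ∂p.ν, ‖e‖ ≤ ρ) {b : ℕ → ℝ} (hb : ∀ i, |b i| ≤ 1) (j : Fin d) (N : ℕ) {t : ℝ}
    (ht : 0 ≤ t) :
    P {ω | t ≤ |∑ i ∈ Finset.range N, b i * ε i ω j|} ≤
      ENNReal.ofReal (2 * Real.exp (-t ^ 2 / (2 * N * ρ ^ 2))) := by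
  have : IsProbabilityMeasure p.ν := by
    rw [← hlaw 0]
    exact Measure.isProbabilityMeasure_map (hm 0).aemeasurable
  have hmean' : ∫ e : Vec d, e j ∂p.ν = 0 := by
    have hi : Integrable (fun e : Vec d => e) p.ν :=
      Integrable.of_bound measurable_id.aestronglyMeasurable ρ hρ
    have h1 := (EuclideanSpace.proj (𝕜 := ℝ) j).integral_comp_comm hi
    rw [hmean, map_zero] at h1
    exact h1
  have h1 := measureReal_abs_sum_ge_le hm hlaw hind N (g := fun i e => b i * e j)
    (fun i => by fun_prop) (b := ρ) (fun i => by
      filter_upwards [hρ] with e he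
      rw [abs_mul]
      have h2 : |e j| ≤ ρ := (PiLp.norm_apply_le e j).trans he
      exact (mul_le_of_le_one_left (abs_nonneg _) (hb i)).trans h2)
    (fun i => by rw [integral_const_mul, hmean', mul_zero]) ht
  rw [← ENNReal.ofReal_toReal (measure_ne_top P _)]
  exact ENNReal.ofReal_le_ofReal h1

end NoiseProbability

lemma measure_iUnion_fin_le {Ω : Type*} [MeasurableSpace Ω] {P : Measure Ω} {k : ℕ}
    {s : Fin k → Set Ω} {b : ℝ}
    (hs : ∀ j, P (s j) ≤ ENNReal.ofReal b) : P (⋃ j, s j) ≤ ENNReal.ofReal (k * b) :=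
  calc P (⋃ j, s j) ≤ ∑ j, P (s j) := measure_iUnion_fintype_le P s
    _ ≤ ∑ _j : Fin k, ENNReal.ofReal b := Finset.sum_le_sum fun j _ => hs j
    _ = ENNReal.ofReal (k * b) := by
      rw [Finset.sum_const, Finset.card_univ, Fintype.card_fin, nsmul_eq_mul,
        ENNReal.ofReal_mul (by positivity), ENNReal.ofReal_natCast]

/-- The exceptional noise has a probability that is exponentially small in `N κ² δ⁴`. -/
lemma Assumptions.measure_noiseBad_le (hA : p.Assumptions ℓ₀ L₀ ℓ₁ L₁ μ) {R : ℕ} (hR : 1 ≤ R)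
    {c δmax : ℝ} (hc : 0 < c) (hδmax : 0 < δmax) :
    ∃ A > (0 : ℝ), ∃ a > (0 : ℝ), ∀ {Ω : Type u} [MeasurableSpace Ω] (P : Measure Ω)
      [IsProbabilityMeasure P] (ε : ℕ → Ω → Vec d), (∀ i, Measurable (ε i)) →
      (∀ i, P.map (ε i) = p.ν) → iIndepFun ε P → ∀ (X : Vec n) (δ : ℝ) (N : ℕ) (v : ℕ → Vec n),
      0 < δ → δ ≤ δmax → 0 < N → (∀ i, ‖v i‖ ≤ 1) → ∀ κ > 0,
      P {ω | (fun i => ε i ω) ∈ p.noiseBad R c κ (X, δ, N, v)} ≤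
        ENNReal.ofReal (A * Real.exp (-(a * (N * κ ^ 2 * δ ^ 4)))) := by
  have hp := hA.regular
  have := hp.noise_prob
  obtain ⟨ρ', hρ'⟩ := hp.noise_bounded
  set ρ : ℝ := |ρ'| + 1 with hρdef
  have hρpos : 0 < ρ := by positivity
  have hρ : ∀ᵐ e ∂p.ν, ‖e‖ ≤ ρ := by
    filter_upwards [hρ'] with e he
    have := le_abs_self ρ'
    linarith
  obtain ⟨K, hK⟩ : ∃ K : ℝ, K = L₁ * (1 + L₀) * (n + m) + 2 * L₁ * ρ + 1 := ⟨_, rfl⟩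
  obtain ⟨K', hK'⟩ : ∃ K' : ℝ, K' =
    (ℓ₁ * (1 + L₀) * (1 + L₀) + L₁ * ℓ₀) * (n + m) + 2 * (L₁ * (1 + L₀)) + 1 := ⟨_, rfl⟩
  obtain ⟨B, hB⟩ : ∃ B : ℝ, B = 4 * (6 * R : ℝ) ^ Fintype.card (Fin n ⊕ Fin m) := ⟨_, rfl⟩
  have hKpos : 0 < K := by rw [hK]; positivity
  have hK'pos : 0 < K' := by rw [hK']; positivity
  have hBpos : 0 < B := by
    have : (0 : ℝ) < R := by exact_mod_cast hR
    rw [hB]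
    positivity
  obtain ⟨a₁, ha₁⟩ : ∃ a₁ : ℝ, a₁ = c ^ 2 / (128 * K ^ 2) := ⟨_, rfl⟩
  obtain ⟨a₂, ha₂⟩ : ∃ a₂ : ℝ, a₂ = c ^ 2 / (128 * K' ^ 2 * δmax ^ 2) := ⟨_, rfl⟩
  obtain ⟨a₃, ha₃⟩ : ∃ a₃ : ℝ, a₃ = c ^ 2 / (2 * ρ ^ 2 * (d + 1) ^ 2) := ⟨_, rfl⟩
  have ha₁pos : 0 < a₁ := by rw [ha₁]; positivity
  have ha₂pos : 0 < a₂ := by rw [ha₂]; positivity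
  have ha₃pos : 0 < a₃ := by rw [ha₃]; positivity
  obtain ⟨a, hapos, haa₁, haa₂, haa₃⟩ : ∃ a : ℝ, 0 < a ∧ a ≤ a₁ ∧ a ≤ a₂ ∧ a ≤ a₃ :=
    ⟨min a₁ (min a₂ a₃), lt_min ha₁pos (lt_min ha₂pos ha₃pos), min_le_left _ _,
      (min_le_right _ _).trans (min_le_left _ _), (min_le_right _ _).trans (min_le_right _ _)⟩
  refine ⟨B + n * B + d * 2 + n * (d * 2), by positivity, a, hapos, ?_⟩
  intro Ω _ P _ ε hεm hlaw hind X δ N v hδ hδle hN hv κ hκ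
  have hN' : (0 : ℝ) < N := by exact_mod_cast hN
  obtain ⟨Q, hQ⟩ : ∃ Q : ℝ, Q = N * κ ^ 2 * δ ^ 4 := ⟨_, rfl⟩
  have hQ0 : 0 ≤ Q := by rw [hQ]; positivity
  rw [← hQ]
  obtain ⟨E, hE⟩ : ∃ E : ℝ, E = Real.exp (-(a * Q)) := ⟨_, rfl⟩
  have hE0 : 0 ≤ E := by rw [hE]; exact (Real.exp_pos _).le
  rw [← hE]
  have hexp : ∀ b : ℝ, a * Q ≤ b → Real.exp (-b) ≤ E := fun b hb => by
    rw [hE]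
    exact Real.exp_le_exp.2 (neg_le_neg hb)
  have hval : P {ω | (fun i => ε i ω) ∈ chainBad p.ν (p.valueField X) R N (c * κ * δ ^ 2)} ≤
      ENNReal.ofReal (B * E) := by
    refine (hp.measure_chainBad_valueField_le hεm hlaw hind hρpos.le hρ X hR hN
      (by positivity)).trans (ENNReal.ofReal_le_ofReal ?_)
    rw [← hB, ← hK]
    refine mul_le_mul_of_nonneg_left (hexp _ ?_) hBpos.le
    have h1 : N * (c * κ * δ ^ 2) ^ 2 / (128 * K ^ 2) = a₁ * Q := by
      rw [ha₁, hQ]; ring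
    rw [h1]
    exact mul_le_mul_of_nonneg_right haa₁ hQ0
  have hgrad : ∀ j, P {ω | (fun i => ε i ω) ∈ chainBad p.ν (p.gradField X j) R N (c * κ * δ)} ≤
      ENNReal.ofReal (B * E) := by
    intro j
    refine (hp.measure_chainBad_gradField_le hεm hlaw hind X j hR hN
      (by positivity)).trans (ENNReal.ofReal_le_ofReal ?_)
    rw [← hB, ← hK']
    refine mul_le_mul_of_nonneg_left (hexp _ ?_) hBpos.le
    -- `δ ≤ δmax` makes the gradient tolerance `c κ δ` at least `c κ δ² / δmax`
    have h1 : a₂ * Q ≤ N * (c * κ * δ) ^ 2 / (128 * K' ^ 2) := by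
      have h2 : a₂ * Q = N * (c * κ * δ) ^ 2 / (128 * K' ^ 2) * (δ ^ 2 / δmax ^ 2) := by
        rw [ha₂, hQ]
        field_simp
      rw [h2]
      refine mul_le_of_le_one_right (by positivity) ?_
      rw [div_le_one (by positivity)]
      gcongr
    exact (mul_le_mul_of_nonneg_right haa₂ hQ0).trans h1
  have hlin : ∀ (b : ℕ → ℝ), (∀ i, |b i| ≤ 1) → ∀ j : Fin d,
      P {ω | N * (c * κ * δ ^ 2) / (d + 1) ≤ |∑ i ∈ Finset.range N, b i * ε i ω j|} ≤
        ENNReal.ofReal (2 * E) := by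
    intro b hb j
    refine (measure_abs_weighted_sum_ge_le hA.noise_mean hεm hlaw hind hρ hb j N
      (by positivity)).trans (ENNReal.ofReal_le_ofReal ?_)
    have h2 : -(N * (c * κ * δ ^ 2) / (d + 1)) ^ 2 / (2 * N * ρ ^ 2) = -(a₃ * Q) := by
      rw [ha₃, hQ]
      field_simp
    rw [h2]
    exact mul_le_mul_of_nonneg_left (hexp _ (mul_le_mul_of_nonneg_right haa₃ hQ0)) zero_le_two
  have hset : {ω | (fun i => ε i ω) ∈ p.noiseBad R c κ (X, δ, N, v)} =
      ({ω | (fun i => ε i ω) ∈ chainBad p.ν (p.valueField X) R N (c * κ * δ ^ 2)} ∪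
        ⋃ j, {ω | (fun i => ε i ω) ∈ chainBad p.ν (p.gradField X j) R N (c * κ * δ)}) ∪
      ((⋃ j : Fin d, {ω | N * (c * κ * δ ^ 2) / (d + 1) ≤
        |∑ i ∈ Finset.range N, 1 * ε i ω j|}) ∪
      ⋃ j' : Fin n, ⋃ j : Fin d, {ω | N * (c * κ * δ ^ 2) / (d + 1) ≤
        |∑ i ∈ Finset.range N, v i j' * ε i ω j|}) := by
    ext ω
    simp [noiseBad]
  rw [hset]
  have h1 := measure_iUnion_fin_le hgrad
  have h2 := measure_iUnion_fin_le (hlin (fun _ => 1) (by simp))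
  have h3 := measure_iUnion_fin_le fun j' => measure_iUnion_fin_le
    (hlin (fun i => v i j') fun i => (PiLp.norm_apply_le (v i) j').trans (hv i))
  calc _ ≤ (ENNReal.ofReal (B * E) + ENNReal.ofReal (n * (B * E))) +
        (ENNReal.ofReal (d * (2 * E)) + ENNReal.ofReal (n * (d * (2 * E)))) :=
        (measure_union_le _ _).trans (add_le_add
          ((measure_union_le _ _).trans (add_le_add hval h1))
          ((measure_union_le _ _).trans (add_le_add h2 h3)))
    _ = _ := by
        rw [← ENNReal.ofReal_add (by positivity) (by positivity),
          ← ENNReal.ofReal_add (by positivity) (by positivity),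
          ← ENNReal.ofReal_add (by positivity) (by positivity)]
        congr 1
        ring

/-- For a small relative scale `c` of the noise, all error terms are below the tolerance `κ` as
soon as `κ` is large. -/
lemma exists_scale {b₀ b₁ d₀ d₁ g₀ g₁ k : ℝ} (hb₀ : 0 ≤ b₀) (hb₁ : 0 ≤ b₁) (hd₀ : 0 ≤ d₀)
    (hd₁ : 0 ≤ d₁) (hg₀ : 0 ≤ g₀) (hg₁ : 0 ≤ g₁) (hk : 0 ≤ k) :
    ∃ c > (0 : ℝ), ∃ κ₀ > (0 : ℝ), ∀ κ ≥ κ₀, g₀ + g₁ * (c * κ) < κ ∧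
      k * Real.sqrt (b₀ + b₁ * (c * κ)) + d₀ + d₁ * (c * κ) < κ := by
  set c : ℝ := 1 / (4 * (1 + b₁ + d₁ + g₁)) with hc
  have hcpos : 0 < c := by positivity
  refine ⟨c, hcpos, 4 * (g₀ + d₀) + 32 * k ^ 2 + b₀ + 1, by positivity, fun κ hκ => ?_⟩
  have hk2 : 0 ≤ k ^ 2 := sq_nonneg k
  have hκpos : 0 < κ := by linarith
  have hc1 : c * (1 + b₁ + d₁ + g₁) = 1 / 4 := by
    rw [hc]
    field_simp
  have h1 : g₁ * (c * κ) ≤ κ / 4 := by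
    have : g₁ * c ≤ 1 / 4 := by nlinarith [mul_nonneg hcpos.le hb₁, mul_nonneg hcpos.le hd₁]
    nlinarith
  have h2 : d₁ * (c * κ) ≤ κ / 4 := by
    have : d₁ * c ≤ 1 / 4 := by nlinarith [mul_nonneg hcpos.le hb₁, mul_nonneg hcpos.le hg₁]
    nlinarith
  have h3 : b₁ * (c * κ) ≤ κ := by
    have : b₁ * c ≤ 1 / 4 := by nlinarith [mul_nonneg hcpos.le hd₁, mul_nonneg hcpos.le hg₁]
    nlinarith
  have h4 : k * Real.sqrt (b₀ + b₁ * (c * κ)) ≤ κ / 4 := by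
    rw [← Real.sqrt_sq hk, ← Real.sqrt_mul hk2]
    refine Real.sqrt_le_iff.2 ⟨by positivity, ?_⟩
    have h5 : k ^ 2 * (b₀ + b₁ * (c * κ)) ≤ k ^ 2 * (b₀ + κ) := by gcongr
    have h6 : 32 * k ^ 2 ≤ κ := by linarith
    have h7 : b₀ ≤ κ := by linarith
    have h8 : k ^ 2 * (b₀ + κ) ≤ κ / 32 * (κ + κ) := by
      refine mul_le_mul (by linarith) (by linarith) (by linarith) (by linarith)
    nlinarith
  constructor <;> linarith

lemma norm_sum_le_of_coord {N : ℕ} {e : ℕ → Vec d} {t : ℝ} (ht : 0 ≤ t)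
    (h : ∀ a : Fin d, |∑ i ∈ Finset.range N, e i a| ≤ t / (d + 1)) :
    ‖∑ i ∈ Finset.range N, e i‖ ≤ t := by
  refine (norm_le_sum_abs _).trans ?_
  have h1 : ∀ a : Fin d, |(∑ i ∈ Finset.range N, e i) a| ≤ t / (d + 1) := fun a => by
    simpa using h a
  refine (Finset.sum_le_sum fun a _ => h1 a).trans ?_
  rw [Finset.sum_const, Finset.card_univ, Fintype.card_fin, nsmul_eq_mul, mul_div_assoc']
  rw [div_le_iff₀ (by positivity)]
  nlinarith

/-- Outside the exceptional noise, the model is accurate in value and in gradient on the whole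
trust region, provided the sample points are poised. -/
lemma Regular.exists_accuracy_of_notMem_noiseBad (hp : p.Regular ℓ₀ L₀ ℓ₁ L₁ μ) {Λ δmax : ℝ}
    (hΛ : 0 < Λ) (hδmax : 0 < δmax) {R : ℕ} (hRδ : δmax ≤ R)
    (hRY : ∀ y ∈ closure p.Y, ‖y‖ ≤ R) :
    ∃ c > (0 : ℝ), ∃ κ₀ > (0 : ℝ), ∀ κ ≥ κ₀, ∀ (X : Vec n) (δ : ℝ) (N : ℕ) (v : ℕ → Vec n)
      (e : ℕ → Vec d) (B₁ : Vec n →L[ℝ] Vec d) (B₀ : Vec d), 0 < δ → δ ≤ δmax → 0 < N →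
      (∀ i, ‖v i‖ ≤ 1) → StronglyPoised Λ X δ (fun i : Fin N => X + δ • v i) →
      (∀ (b₁ : Vec n →L[ℝ] Vec d) (b₀ : Vec d),
        ∑ i ∈ Finset.range N, ‖p.ψ (X + δ • v i) + e i - B₁ (X + δ • v i) - B₀‖ ^ 2 ≤
          ∑ i ∈ Finset.range N, ‖p.ψ (X + δ • v i) + e i - b₁ (X + δ • v i) - b₀‖ ^ 2) →
      e ∉ p.noiseBad R c κ (X, δ, N, v) → ∀ x ∈ Metric.closedBall X δ,
        |p.Φ x - (p.empirical N B₁ B₀ (p.fitResidual (fun i => X + δ • v i) e B₁ B₀)).Φ x| <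
          κ * δ ^ 2 ∧
        ‖fderiv ℝ p.Φ x - fderiv ℝ
          (p.empirical N B₁ B₀ (p.fitResidual (fun i => X + δ • v i) e B₁ B₀)).Φ x‖ < κ * δ := by
  have hμ := hp.mu_pos
  have := hp.noise_prob
  set W : ℝ := (n + 1) * Λ with hW
  have hW0 : 0 < W := by positivity
  -- `(s₀ + s₁ c κ) δ²` bounds the error of the regression around the Taylor polynomial
  set s₀ : ℝ := W * ℓ₀ with hs₀
  set s₁ : ℝ := W * ((2 * n + 1) * W) with hs₁
  set K : ℝ := ℓ₁ * (1 + L₀) * (1 + L₀) + L₁ * ℓ₀ with hK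
  have hs₀0 : 0 ≤ s₀ := by positivity
  have hs₁0 : 0 ≤ s₁ := by positivity
  have hK0 : 0 ≤ K := by positivity
  obtain ⟨c, hc, κ₀, hκ₀, hscale⟩ := exists_scale
    (b₀ := 8 / μ * (2 * L₁ * (s₀ + ℓ₀))) (b₁ := 8 / μ * (2 * L₁ * s₁ + 1))
    (d₀ := 2 * ℓ₁ * (1 + L₀) * δmax * (s₀ + ℓ₀) + L₁ * (2 * s₀ + ℓ₀))
    (d₁ := n + 2 * ℓ₁ * (1 + L₀) * δmax * s₁ + L₁ * (2 * s₁))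
    (g₀ := 2 * L₁ * (s₀ + ℓ₀)) (g₁ := 2 * L₁ * s₁ + 1) (k := K)
    (by positivity) (by positivity) (by positivity) (by positivity) (by positivity)
    (by positivity) hK0
  refine ⟨c, hc, κ₀, hκ₀, ?_⟩
  intro κ hκ X δ N v e B₁ B₀ hδ hδle hN hv hpo hls hgood x hx
  obtain ⟨hs1, hs2⟩ := hscale κ hκ
  have hκpos : 0 < κ := hκ₀.trans_le hκ
  have hN' : (0 : ℝ) < N := by exact_mod_cast hN
  set t : ℝ := c * κ with ht
  have ht0 : 0 < t := by positivity
  simp only [noiseBad, Set.mem_union, Set.mem_iUnion, Set.mem_ofPred_eq, not_or, not_exists,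
    not_le] at hgood
  obtain ⟨⟨hgV, hgG⟩, hgE, hgU⟩ := hgood
  -- averages of the empirical processes
  have havg : ∀ (f : (Fin n ⊕ Fin m → ℝ) → Vec d → ℝ) (w : Fin n ⊕ Fin m → ℝ) (b : ℝ),
      |∑ i ∈ Finset.range N, (f w (e i) - ∫ v, f w v ∂p.ν)| ≤ N * b →
      |(N : ℝ)⁻¹ * ∑ i ∈ Finset.range N, f w (e i) - ∫ v, f w v ∂p.ν| ≤ b := by
    intro f w b h
    have h1 : (N : ℝ)⁻¹ * ∑ i ∈ Finset.range N, f w (e i) - ∫ v, f w v ∂p.ν =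
        (N : ℝ)⁻¹ * ∑ i ∈ Finset.range N, (f w (e i) - ∫ v, f w v ∂p.ν) := by
      rw [Finset.sum_sub_distrib, Finset.sum_const, Finset.card_range, nsmul_eq_mul]
      field_simp
    rw [h1, abs_mul, abs_of_pos (by positivity), inv_mul_le_iff₀ hN']
    exact h
  have hparam : ∀ x ∈ Metric.closedBall X δ, ∀ y ∈ closure p.Y, ∃ w : Fin n ⊕ Fin m → ℝ,
      ‖w‖ ≤ R ∧ X + xPart w = x ∧ yPart w = y := by
    intro x hx y hy
    have hx' : ‖x - X‖ ≤ R := by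
      rw [← dist_eq_norm]
      exact (Metric.mem_closedBall.1 hx).trans (hδle.trans hRδ)
    obtain ⟨w, hw, hwx, hwy⟩ := exists_param hx' (hRY y hy)
    exact ⟨w, hw, by rw [hwx, add_sub_cancel], hwy⟩
  have hE1 : ∀ y ∈ closure p.Y,
      |(N : ℝ)⁻¹ * ∑ i ∈ Finset.range N, p.l (x, y, p.ψ x + e i) - p.L x y| ≤ t * δ ^ 2 := by
    intro y hy
    obtain ⟨w, hw, rfl, rfl⟩ := hparam x hx y hy
    refine havg (p.valueField X) w _ ?_
    exact abs_sum_centred_le_of_notMem_chainBad (fun w => hp.integrable_l _ _)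
      (hp.abs_valueField_sub_le X) (by positivity) hgV hw
  have hE2 : ∀ y ∈ closure p.Y, ∀ j, |(N : ℝ)⁻¹ * ∑ i ∈ Finset.range N,
      p.dl x y (e i) (EuclideanSpace.single j 1) - p.DL x y (EuclideanSpace.single j 1)| ≤
      t * δ := by
    intro y hy j
    obtain ⟨w, hw, rfl, rfl⟩ := hparam x hx y hy
    rw [← hp.integral_gradField]
    refine havg (p.gradField X j) w _ ?_
    exact abs_sum_centred_le_of_notMem_chainBad (hp.integrable_gradField X j)
      (hp.abs_gradField_sub_le X j) (by positivity) (hgG j) hw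
  have hEe : ‖∑ i ∈ Finset.range N, e i‖ ≤ N * (t * δ ^ 2) :=
    norm_sum_le_of_coord (by positivity) fun a => (hgE a).le
  have hEu : ∀ j, ‖∑ i ∈ Finset.range N, v i j • e i‖ ≤ N * (t * δ ^ 2) := fun j =>
    norm_sum_le_of_coord (by positivity) fun a => by simpa using (hgU j a).le
  have hreg := fun x' (hx' : x' ∈ Metric.closedBall X δ) =>
    hp.regression_error_le hN hΛ hδ hv hpo hls (by positivity) hEe hEu
      (S := (s₀ + s₁ * t) * δ ^ 2) (le_of_eq (by rw [hs₀, hs₁, hW]; ring)) hx'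
  have hz : ∀ i, X + δ • v i ∈ Metric.closedBall X δ := by
    intro i
    rw [Metric.mem_closedBall, dist_eq_norm, add_sub_cancel_left, norm_smul, Real.norm_eq_abs,
      abs_of_pos hδ]
    exact mul_le_of_le_one_right hδ.le (hv i)
  set D : ℝ := (s₀ + s₁ * t) * δ ^ 2 + ℓ₀ * δ ^ 2 with hD
  have hL : ∀ y ∈ closure p.Y,
      |(p.empirical N B₁ B₀ (p.fitResidual (fun i => X + δ • v i) e B₁ B₀)).L x y - p.L x y| ≤
        2 * L₁ * D + t * δ ^ 2 := fun y hy =>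
    hp.abs_empirical_L_sub_le hN hz (fun x' hx' => (hreg x' hx').1) hx (hE1 y hy)
  have hη : 2 * L₁ * D + t * δ ^ 2 = (2 * L₁ * (s₀ + ℓ₀) + (2 * L₁ * s₁ + 1) * t) * δ ^ 2 := by
    rw [hD]; ring
  constructor
  · refine (hp.abs_empirical_Phi_sub_le hN hL).trans_lt ?_
    rw [hη]
    exact mul_lt_mul_of_pos_right hs1 (by positivity)
  · refine (hp.norm_fderiv_Phi_sub_le hN hz (fun x' hx' => (hreg x' hx').1) hx (by positivity)
      (hreg x hx).2 hL hE2).trans_lt ?_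
    have hsqrt : Real.sqrt (8 * (2 * L₁ * D + t * δ ^ 2) / μ) =
        Real.sqrt (8 / μ * (2 * L₁ * (s₀ + ℓ₀)) + 8 / μ * (2 * L₁ * s₁ + 1) * t) * δ := by
      rw [hη, ← Real.sqrt_sq hδ.le, ← Real.sqrt_mul' _ (sq_nonneg _), Real.sqrt_sq hδ.le]
      congr 1
      ring
    have hDle : D ≤ (s₀ + ℓ₀ + s₁ * t) * δmax * δ := by
      have h1 : 0 ≤ s₀ + ℓ₀ + s₁ * t := by positivity
      calc D = (s₀ + ℓ₀ + s₁ * t) * δ * δ := by rw [hD]; ring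
        _ ≤ _ := by gcongr
    have hD' : 2 * ((s₀ + s₁ * t) * δ ^ 2) / δ + ℓ₀ * δ = (2 * s₀ + ℓ₀ + 2 * s₁ * t) * δ := by
      field_simp
      ring
    rw [hsqrt, hD', ← hK]
    have h2 : ℓ₁ * (2 * D) * (1 + L₀) ≤
        ℓ₁ * (2 * ((s₀ + ℓ₀ + s₁ * t) * δmax * δ)) * (1 + L₀) := by gcongr
    have h3 := mul_lt_mul_of_pos_right hs2 hδ
    linarith

end Problem

/-! ### Conditioning on the past -/

section Conditioning

/-- Freezing: if `ε` is independent of `𝓗`, an event about `ε` and an `𝓗`-measurable design `q`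
may be estimated for each value of the design separately. -/
lemma measure_inter_le_of_indep {Ω D E : Type*} {𝓗 mΩ : MeasurableSpace Ω} [MeasurableSpace D]
    [MeasurableSpace E] {P : Measure Ω} [IsProbabilityMeasure P] (h𝓗 : 𝓗 ≤ mΩ) {q : Ω → D}
    (hq : Measurable[𝓗] q) {ε : Ω → E} (hε : Measurable ε)
    (hind : Indep (MeasurableSpace.comap ε inferInstance) 𝓗 P) {S : Set (D × E)}
    (hS : MeasurableSet S) {A : Set Ω} (hA : MeasurableSet[𝓗] A) {b : ENNReal}
    (hb : ∀ᵐ ω ∂P, ω ∈ A → P {ω' | (q ω, ε ω') ∈ S} ≤ b) :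
    P (A ∩ {ω | (q ω, ε ω) ∈ S}) ≤ b * P A := by
  -- the membership in `A` is recorded as a second component of the design
  set X : Ω → D × Prop := fun ω => (q ω, ω ∈ A) with hX
  have hXm : Measurable[𝓗] X := Measurable.prodMk hq ((@measurable_mem Ω A 𝓗).2 hA)
  have hXm' : Measurable X := hXm.mono h𝓗 le_rfl
  have hindep : IndepFun X ε P :=
    (IndepFun_iff_Indep X ε P).2 (indep_of_indep_of_le_left hind.symm hXm.comap_le)
  set T : Set ((D × Prop) × E) := {t | t.1.2 ∧ (t.1.1, t.2) ∈ S} with hT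
  have hTm : MeasurableSet T := by
    have h1 : MeasurableSet {t : (D × Prop) × E | t.1.2} :=
      measurableSet_setOfPred.2 (measurable_snd.comp measurable_fst)
    have h2 : MeasurableSet {t : (D × Prop) × E | (t.1.1, t.2) ∈ S} :=
      ((measurable_fst.comp measurable_fst).prodMk measurable_snd) hS
    exact h1.inter h2
  have h1 : P (A ∩ {ω | (q ω, ε ω) ∈ S}) = P.map (fun ω => (X ω, ε ω)) T := by
    rw [Measure.map_apply (hXm'.prodMk hε) hTm]
    rfl
  have : IsProbabilityMeasure (P.map ε) := Measure.isProbabilityMeasure_map hε.aemeasurable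
  have hAm : MeasurableSet A := h𝓗 _ hA
  rw [h1, hindep.map_prod_eq_prod_map_map hXm'.aemeasurable hε.aemeasurable,
    Measure.prod_apply hTm, lintegral_map (measurable_measure_prodMk_left hTm) hXm']
  calc _ ≤ ∫⁻ ω, A.indicator (fun _ => b) ω ∂P := by
        refine lintegral_mono_ae ?_
        filter_upwards [hb] with ω hω
        rw [Measure.map_apply hε (measurable_prodMk_left hTm)]
        by_cases hωA : ω ∈ A
        · rw [Set.indicator_of_mem hωA]
          refine (measure_mono ?_).trans (hω hωA)
          exact fun ω' hω' => hω'.2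
        · rw [Set.indicator_of_notMem hωA, nonpos_iff_eq_zero]
          have : ε ⁻¹' (Prod.mk (X ω) ⁻¹' T) = ∅ := by
            ext ω'
            simp [hT, hX, hωA]
          rw [this, measure_empty]
    _ = b * P A := by rw [lintegral_indicator_const hAm]

lemma condExp_indicator_inter_le {Ω : Type*} {𝓕 mΩ : MeasurableSpace Ω} {P : Measure Ω}
    [IsProbabilityMeasure P] (h𝓕 : 𝓕 ≤ mΩ) {E G : Set Ω} (hE : MeasurableSet E)
    (hG : MeasurableSet G) {b : ℝ} (hb : 0 ≤ b)
    (h : ∀ H, MeasurableSet[𝓕] H → P (E ∩ (G ∩ H)) ≤ ENNReal.ofReal b * P (G ∩ H)) :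
    ∀ᵐ ω ∂P, (P⟦E ∩ G | 𝓕⟧) ω ≤ b * (P⟦G | 𝓕⟧) ω := by
  have hi : ∀ B : Set Ω, MeasurableSet B →
      Integrable (B.indicator fun _ => (1 : ℝ)) P := fun B hB => (integrable_const 1).indicator hB
  have hint : ∀ B : Set Ω, MeasurableSet B → ∀ H, MeasurableSet[𝓕] H →
      ∫ ω in H, (P⟦B | 𝓕⟧) ω ∂(P.trim h𝓕) = P.real (B ∩ H) := by
    intro B hB H hH
    rw [← setIntegral_trim h𝓕 stronglyMeasurable_condExp hH, setIntegral_condExp h𝓕 (hi B hB) hH,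
      integral_indicator hB]
    simp [measureReal_restrict_apply hB]
  refine ae_le_of_ae_le_trim (hm := h𝓕) ?_
  have hI : ∀ B : Set Ω, Integrable (P⟦B | 𝓕⟧) (P.trim h𝓕) := fun B =>
    integrable_condExp.trim h𝓕 stronglyMeasurable_condExp
  refine ae_le_of_forall_setIntegral_le (hI _) ((hI _).const_mul b) fun H hH _ => ?_
  rw [integral_const_mul, hint _ (hE.inter hG) H hH, hint _ hG H hH, Set.inter_assoc]
  have h1 := ENNReal.toReal_mono (by finiteness) (h H hH)
  rwa [ENNReal.toReal_mul, ENNReal.toReal_ofReal hb] at h1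

end Conditioning

/-! ### The error events of one iteration -/

lemma exists_mul_exp_neg_le_half {A a : ℝ} (hA : 0 < A) (ha : 0 < a) :
    ∃ C > (0 : ℝ), ∀ α : ℝ, 0 < α → α < 1 → ∀ Q : ℝ, C * (1 + Real.log α⁻¹) ≤ Q →
      A * Real.exp (-(a * Q)) ≤ α / 2 := by
  refine ⟨(1 + |Real.log (2 * A)|) / a, by positivity, fun α hα hα1 Q hQ => ?_⟩
  have hlog : 0 ≤ Real.log α⁻¹ := Real.log_nonneg ((one_le_inv₀ hα).2 hα1.le)
  have h1 : (1 + |Real.log (2 * A)|) * (1 + Real.log α⁻¹) ≤ a * Q := by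
    rw [div_mul_eq_mul_div, div_le_iff₀ ha] at hQ
    linarith
  have h2 : Real.log (2 * A) + Real.log α⁻¹ ≤ a * Q := by
    have := le_abs_self (Real.log (2 * A))
    have := mul_nonneg (abs_nonneg (Real.log (2 * A))) hlog
    linarith
  have h3 : Real.exp (-(a * Q)) ≤ Real.exp (-(Real.log (2 * A) + Real.log α⁻¹)) :=
    Real.exp_le_exp.2 (neg_le_neg h2)
  rw [Real.log_inv, neg_add, neg_neg, Real.exp_add, Real.exp_log hα, Real.exp_neg (Real.log _),
    Real.exp_log (by positivity)] at h3
  calc A * Real.exp (-(a * Q)) ≤ A * ((2 * A)⁻¹ * α) := by gcongr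
    _ = α / 2 := by field_simp

namespace Run

variable {n m d : ℕ} {p : Problem n m d} {ℓ₀ L₀ ℓ₁ L₁ : ℝ≥0} {μ : ℝ}

/-- The common core of the two parts: if `N κ² δ⁴` exceeds a multiple of `1 + log (1 / α)`, then
both error events have conditional probability at most `α / 2`. -/
lemma exists_condExp_bad_le (hA : p.Assumptions ℓ₀ L₀ ℓ₁ L₁ μ) {Λ : ℝ} (hΛ : 0 < Λ) {δmax : ℝ}
    (hδmax : 0 < δmax) :
    ∃ κ₀ > (0 : ℝ), ∃ C > (0 : ℝ), ∀ {Ω : Type u} [MeasurableSpace Ω] (P : Measure Ω)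
      [IsProbabilityMeasure P] (r : Run n m d Ω) (x₀ : Vec n) (δ₀ γ η₁ η₂ : ℝ),
      r.IsRun p P δmax x₀ δ₀ γ η₁ η₂ → ∀ (k : ℕ) (α : ℝ), 0 < α → α < 1 → ∀ κ ≥ κ₀,
      ∀ bad : Set Ω, MeasurableSet bad → bad ⊆ r.badValue p κ k ∪ r.badGradient p κ k →
      ∀ G : Set Ω, MeasurableSet[r.hist k] G →
      (∀ᵐ ω ∂P, ω ∈ G → r.Poised Λ k ω ∧
        C * (1 + Real.log α⁻¹) ≤ r.N k ω * κ ^ 2 * r.δ k ω ^ 4) →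
      ∀ᵐ ω ∂P, (P⟦bad ∩ G | r.past p k⟧) ω ≤ α / 2 * (P⟦G | r.past p k⟧) ω := by
  have hp := hA.regular
  obtain ⟨ρ, hρ⟩ := hp.isCompact_closure_Y.isBounded.exists_norm_le
  -- a cube containing all displacements in the trust region and all feasible points
  obtain ⟨R, hRdef⟩ := exists_nat_ge (max 1 (max δmax ρ))
  have hR1 : 1 ≤ R := by exact_mod_cast (le_max_left _ _).trans hRdef
  have hRδ : δmax ≤ R := ((le_max_left _ _).trans (le_max_right _ _)).trans hRdef
  have hRY : ∀ y ∈ closure p.Y, ‖y‖ ≤ R := fun y hy =>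
    (hρ y hy).trans (((le_max_right _ _).trans (le_max_right _ _)).trans hRdef)
  obtain ⟨c, hc, κ₀, hκ₀, hacc⟩ := hp.exists_accuracy_of_notMem_noiseBad hΛ hδmax hRδ hRY
  obtain ⟨A, hApos, a, ha, hprob⟩ := hA.measure_noiseBad_le.{u} hR1 hc hδmax
  obtain ⟨C, hC, hCexp⟩ := exists_mul_exp_neg_le_half hApos ha
  refine ⟨κ₀, hκ₀, C, hC, ?_⟩
  intro Ω _ P _ r x₀ δ₀ γ η₁ η₂ h k α hα hα1 κ hκ bad hbadm hbad G hG hcond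
  have hκpos : 0 < κ := hκ₀.trans_le hκ
  have hGm : MeasurableSet G := h.hist_le k _ hG
  refine condExp_indicator_inter_le ((h.past_le_hist hp k).trans (h.hist_le k)) hbadm hGm
    (by positivity) fun H hH => ?_
  have hGH : MeasurableSet[r.hist k] (G ∩ H) :=
    MeasurableSet.inter (m := r.hist k) hG (h.past_le_hist hp k _ hH)
  have hlog : 0 ≤ Real.log α⁻¹ := Real.log_nonneg ((one_le_inv₀ hα).2 hα1.le)
  have hNpos : ∀ ω, C * (1 + Real.log α⁻¹) ≤ r.N k ω * κ ^ 2 * r.δ k ω ^ 4 → 0 < r.N k ω := by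
    intro ω hω
    rcases Nat.eq_zero_or_pos (r.N k ω) with h0 | h0
    · rw [h0, Nat.cast_zero, zero_mul, zero_mul] at hω
      have : 0 < C * (1 + Real.log α⁻¹) := by positivity
      linarith
    · exact h0
  have hu : ∀ i ω, ‖r.u k i ω‖ ≤ 1 := fun i ω => by simpa using h.u_mem k i ω
  have hεm : ∀ i, Measurable (r.ε k i) := fun i => (h.meas_eps k i).mono (h.mid_le k) le_rfl
  set q : Ω → Vec n × ℝ × ℕ × (ℕ → Vec n) :=
    fun ω => (r.x k ω, r.δ k ω, r.N k ω, fun i => r.u k i ω) with hq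
  have hqm : Measurable[r.hist k] q :=
    Measurable.prodMk (h.meas_x k) (Measurable.prodMk (h.meas_delta k)
      (Measurable.prodMk (h.meas_N k) 
        ((@measurable_pi_iff Ω ℕ (fun _ => Vec n) (r.hist k) _ _).2 fun i => h.meas_u k i)))
  have hind : Indep (MeasurableSpace.comap (fun ω i => r.ε k i ω) inferInstance) (r.hist k) P := by
    refine indep_of_indep_of_le_left (h.eps_indep k) ?_
    simp only [MeasurableSpace.pi, MeasurableSpace.comap_iSup, MeasurableSpace.comap_comp]
    exact le_rfl
  have hfreeze := measure_inter_le_of_indep (h.hist_le k) hqm (measurable_pi_lambda _ hεm) hind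
    (hp.measurableSet_noiseBad R c κ) hGH (b := ENNReal.ofReal (α / 2)) (by
      filter_upwards [hcond] with ω hω hωA
      obtain ⟨-, hN⟩ := hω hωA.1
      refine (hprob P (r.ε k) hεm (h.eps_law k) (h.eps_iIndep k) (r.x k ω) (r.δ k ω) (r.N k ω)
        (fun i => r.u k i ω) (h.delta_pos k ω) (h.delta_le k ω) (hNpos ω hN) (fun i => hu i ω)
        κ hκpos).trans (ENNReal.ofReal_le_ofReal ?_)
      exact hCexp α hα hα1 _ hN)
  refine le_trans (measure_mono_ae ?_) hfreeze
  filter_upwards [hcond] with ω hω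
  rintro ⟨hωbad, hωG, hωH⟩
  obtain ⟨hpo, hN⟩ := hω hωG
  refine ⟨⟨hωG, hωH⟩, ?_⟩
  by_contra hgood
  have hmain := hacc κ hκ (r.x k ω) (r.δ k ω) (r.N k ω) (fun i => r.u k i ω)
    (fun i => r.ε k i ω) (r.B₁ k ω) (r.B₀ k ω) (h.delta_pos k ω) (h.delta_le k ω) (hNpos ω hN)
    (fun i => hu i ω) hpo (h.least_squares k ω) hgood
  rcases hbad hωbad with ⟨x, hx, hxbad⟩ | ⟨x, hx, hxbad⟩
  · rw [Phik_eq_empirical] at hxbad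
    exact absurd (hmain x hx).1 (not_lt.2 hxbad)
  · rw [norm_gradient_eq, norm_gradient_eq, Phik_eq_empirical] at hxbad
    exact absurd ((norm_sub_norm_le _ _).trans_lt (hmain x hx).2) (not_lt.2 hxbad)

end Run

end SMDD

theorem proposition1 {n m d : ℕ} (p : SMDD.Problem n m d) (ℓ₀ L₀ ℓ₁ L₁ : ℝ≥0) (μ : ℝ)
    (hp : p.Assumptions ℓ₀ L₀ ℓ₁ L₁ μ) (Λ : ℝ) (hΛ : 0 < Λ) (δmax : ℝ) (hδmax : 0 < δmax) :
    -- part (i)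
    (∃ κ₀ > (0 : ℝ), ∃ C₁ > (0 : ℝ), ∃ C₂ > (0 : ℝ),
      ∀ {Ω : Type u} [MeasurableSpace Ω] (P : Measure Ω) [IsProbabilityMeasure P]
        (r : SMDD.Run n m d Ω) (x₀ : SMDD.Vec n) (δ₀ γ η₁ η₂ : ℝ),
        r.IsRun p P δmax x₀ δ₀ γ η₁ η₂ →
        ∀ (k : ℕ) (α : ℝ), 0 < α → α < 1 → ∀ κ_ef ≥ κ₀,
        NullMeasurableSet (r.badValue p κ_ef k) P ∧
        ∀ G : Set Ω, MeasurableSet[r.hist k] G →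
          (∀ᵐ ω ∂P, ω ∈ G → r.Poised Λ k ω ∧
            (r.N k ω : ℝ) ≥
              max (C₁ * ((r.δ k ω ^ 4)⁻¹ * (κ_ef ^ 2)⁻¹ * α⁻¹)) (C₂ * (α ^ 2)⁻¹)) →
          ∀ᵐ ω ∂P, (P⟦r.badValue p κ_ef k ∩ G | r.past p k⟧) ω ≤
            α / 2 * (P⟦G | r.past p k⟧) ω) ∧
    -- part (ii)
    (Differentiable ℝ p.Φ ∧
      ∃ κ₀ > (0 : ℝ), ∃ C₁ > (0 : ℝ), ∃ C₂ > (0 : ℝ), ∃ C₃ > (0 : ℝ),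
      ∀ {Ω : Type u} [MeasurableSpace Ω] (P : Measure Ω) [IsProbabilityMeasure P]
        (r : SMDD.Run n m d Ω) (x₀ : SMDD.Vec n) (δ₀ γ η₁ η₂ : ℝ),
        r.IsRun p P δmax x₀ δ₀ γ η₁ η₂ →
        ∀ (k : ℕ) (α : ℝ), 0 < α → α < 1 → ∀ κ_ed ≥ κ₀,
        (∀ ω, Differentiable ℝ (r.Φk p k ω)) ∧
        NullMeasurableSet (r.badGradient p κ_ed k) P ∧
        ∀ G : Set Ω, MeasurableSet[r.hist k] G →
          (∀ᵐ ω ∂P, ω ∈ G → r.Poised Λ k ω ∧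
            (r.N k ω : ℝ) ≥
              max (C₁ * (1 + Real.log α⁻¹) * ((r.δ k ω ^ 4)⁻¹ * (κ_ed ^ 2)⁻¹))
                (max (C₂ * (α ^ 2)⁻¹)
                  (C₃ * ((r.δ k ω ^ 2)⁻¹ * (κ_ed ^ 2)⁻¹ * α⁻¹)))) →
          ∀ᵐ ω ∂P, (P⟦r.badGradient p κ_ed k ∩ G | r.past p k⟧) ω ≤
            α / 2 * (P⟦G | r.past p k⟧) ω) := by
  obtain ⟨κ₀, hκ₀, C, hC, hcore⟩ := SMDD.Run.exists_condExp_bad_le.{u} hp hΛ hδmax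
  have hreg := hp.regular
  refine ⟨⟨κ₀, hκ₀, C, hC, 1, one_pos, ?_⟩, hreg.differentiable_Phi,
    κ₀, hκ₀, C, hC, 1, one_pos, 1, one_pos, ?_⟩
  · intro Ω _ P _ r x₀ δ₀ γ η₁ η₂ h k α hα hα1 κ hκ
    have hκpos : 0 < κ := hκ₀.trans_le hκ
    have hm := h.measurableSet_badValue hreg k κ
    refine ⟨hm.nullMeasurableSet, fun G hG hcond => ?_⟩
    refine hcore P r x₀ δ₀ γ η₁ η₂ h k α hα hα1 κ hκ _ hm Set.subset_union_left G hG ?_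
    filter_upwards [hcond] with ω hω hωG
    obtain ⟨hpo, hN⟩ := hω hωG
    refine ⟨hpo, ?_⟩
    have hδ := h.delta_pos k ω
    -- `1 + log (1 / α) ≤ 1 / α`, so the requirement here is stronger than the logarithmic one
    have hlog : 1 + Real.log α⁻¹ ≤ α⁻¹ := by
      have := Real.log_le_sub_one_of_pos (inv_pos.2 hα)
      linarith
    calc C * (1 + Real.log α⁻¹) ≤ C * α⁻¹ := by gcongr
      _ = C * ((r.δ k ω ^ 4)⁻¹ * (κ ^ 2)⁻¹ * α⁻¹) * κ ^ 2 * r.δ k ω ^ 4 := by field_simp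
      _ ≤ r.N k ω * κ ^ 2 * r.δ k ω ^ 4 := by
        gcongr
        exact (le_max_left _ _).trans hN
  · intro Ω _ P _ r x₀ δ₀ γ η₁ η₂ h k α hα hα1 κ hκ
    have hκpos : 0 < κ := hκ₀.trans_le hκ
    have hm := h.measurableSet_badGradient hreg k κ
    refine ⟨SMDD.Run.differentiable_Phik hreg r k, hm.nullMeasurableSet, fun G hG hcond => ?_⟩
    refine hcore P r x₀ δ₀ γ η₁ η₂ h k α hα hα1 κ hκ _ hm Set.subset_union_right G hG ?_
    filter_upwards [hcond] with ω hω hωG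
    obtain ⟨hpo, hN⟩ := hω hωG
    refine ⟨hpo, ?_⟩
    have hδ := h.delta_pos k ω
    calc C * (1 + Real.log α⁻¹)
        = C * (1 + Real.log α⁻¹) * ((r.δ k ω ^ 4)⁻¹ * (κ ^ 2)⁻¹) * κ ^ 2 * r.δ k ω ^ 4 := by
          field_simp
      _ ≤ r.N k ω * κ ^ 2 * r.δ k ω ^ 4 := by
        gcongr
        exact (le_max_left _ _).trans hN
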